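/- Let $V$ be a complex vector space of dimension $10$ and let $G=G(3,V)\subset \mathbf P(\bigwedge^3V)$ be the Grassmannian of $3$-dimensional vector subspaces of $V$ in its Plücker embedding, where $\mathbf P$ denotes the projective space of lines. Identify $\bigwedge^3V^*$ with $(\bigwedge^3V)^*$, and let $G^*\subset\mathbf P(\bigwedge^3V^*)$ be the projective dual variety of $G$, that is, the Zariski closure of the set of hyperplanes tangent to $G$ at some (smooth) point. For a nonzero $\sigma\in\bigwedge^3V^*$, let $F_\sigma\subset G$ be the corresponding hyperplane section, which consists of the points $[W]\in G$ such that $\sigma$ vanishes on $\bigwedge^3W$. The dual variety $G^*$ is an irreducible hypersurface in $\mathbf P(\bigwedge^3V^*)$. Moreover, there is a nonempty Zariski open subset of $G^*$ such that, for every nonzero $\sigma$ with $[\sigma]$ in it, $F_\sigma$ has a unique singular point, and this point is $[W]$ for a $3$-dimensional vector subspace $W\subset V$ such that $\sigma\vert_{\bigwedge^2W\wedge V}=0$, i.e. $\sigma(w_1\wedge w_2\wedge v)=0$ for all $w_1,w_2\in W$ and $v\in V$. -/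

import Mathlib

open scoped LinearAlgebra.Projectivization

/-- The algebra of polynomial functions on a complex vector space: the algebra of functions
generated by the linear forms (for a finite-dimensional space it is the symmetric algebra of the
dual, the field being infinite). -/
def polyFun (N : Type*) [AddCommGroup N] [Module ℂ N] : Subalgebra ℂ (N → ℂ) :=
  Algebra.adjoin ℂ {f : N → ℂ | ∃ l : Module.Dual ℂ N, ∀ v, f v = l v}

/-- `f` is a homogeneous polynomial (function) of degree `d`. -/
def IsForm {N : Type*} [AddCommGroup N] [Module ℂ N] (d : ℕ) (f : N → ℂ) : Prop :=
  f ∈ polyFun N ∧ ∀ (t : ℂ) (v : N), f (t • v) = t ^ d * f v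

/-- The zero locus in the projective space of lines of `N`. It is used only for homogeneous `f`,
where it does not depend on the chosen representatives. -/
def projZeros {N : Type*} [AddCommGroup N] [Module ℂ N] (f : N → ℂ) : Set (ℙ ℂ N) :=
  {x | f x.rep = 0}

/-- The Zariski topology on projective space: the complements of the zero loci of
homogeneous polynomials form a basis of open sets. -/
@[reducible] def zariskiTopology (N : Type*) [AddCommGroup N] [Module ℂ N] : TopologicalSpace (ℙ ℂ N) :=
  TopologicalSpace.generateFrom
    {U | ∃ (d : ℕ) (f : N → ℂ), IsForm d f ∧ U = (projZeros f)ᶜ}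

/-- Openness for the Zariski topology. -/
def IsZariskiOpen {N : Type*} [AddCommGroup N] [Module ℂ N] (U : Set (ℙ ℂ N)) : Prop :=
  @IsOpen (ℙ ℂ N) (zariskiTopology N) U

/-- A hypersurface: the zero locus of one nonzero homogeneous polynomial of positive degree. -/
def IsProjHypersurface {N : Type*} [AddCommGroup N] [Module ℂ N] (X : Set (ℙ ℂ N)) : Prop :=
  ∃ (d : ℕ) (f : N → ℂ), 0 < d ∧ f ≠ 0 ∧ IsForm d f ∧ X = projZeros f

/-- Irreducibility for the Zariski topology (nonemptiness included). -/
def IsZariskiIrreducible {N : Type*} [AddCommGroup N] [Module ℂ N] (X : Set (ℙ ℂ N)) : Prop :=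
  @IsIrreducible (ℙ ℂ N) (zariskiTopology N) X

/-- `x` is a smooth (nonsingular) point of the projective variety `X`: in a Zariski neighbourhood
of `x`, the variety `X` is the zero locus of finitely many homogeneous polynomials whose
differentials at `x` are linearly independent. -/
def IsSmoothPoint {N : Type*} [AddCommGroup N] [Module ℂ N]
    (X : Set (ℙ ℂ N)) (x : ℙ ℂ N) : Prop :=
  x ∈ X ∧ ∃ (c : ℕ) (d : Fin c → ℕ) (f : Fin c → N → ℂ) (U : Set (ℙ ℂ N)),
    (∀ i, IsForm (d i) (f i)) ∧ IsZariskiOpen U ∧ x ∈ U ∧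
    X ∩ U = (⋂ i, projZeros (f i)) ∩ U ∧
    LinearIndependent ℂ (fun (i : Fin c) (w : N) => lineDeriv ℂ (f i) x.rep w)

/-- The set of singular points of the projective variety `X`. -/
def singularPoints {N : Type*} [AddCommGroup N] [Module ℂ N]
    (X : Set (ℙ ℂ N)) : Set (ℙ ℂ N) :=
  {x | x ∈ X ∧ ¬ IsSmoothPoint X x}

/-- The embedded (Zariski) tangent space of `X` at `x`, as a set of vectors of `N`: the vectors
killed by the differentials at `x` of all homogeneous polynomials vanishing on `X`. -/
def embTangent {N : Type*} [AddCommGroup N] [Module ℂ N]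
    (X : Set (ℙ ℂ N)) (x : ℙ ℂ N) : Set N :=
  {w | ∀ (d : ℕ) (f : N → ℂ), IsForm d f → X ⊆ projZeros f → lineDeriv ℂ f x.rep w = 0}

/-- The projective dual of `X`, in the projective space of hyperplanes: the Zariski closure of the
set of hyperplanes that contain the embedded tangent space of `X` at some smooth point. -/
def dualVariety {N : Type*} [AddCommGroup N] [Module ℂ N] (X : Set (ℙ ℂ N)) :
    Set (ℙ ℂ (Module.Dual ℂ N)) :=
  @closure _ (zariskiTopology (Module.Dual ℂ N))
    {φ | ∃ x, IsSmoothPoint X x ∧ ∀ w ∈ embTangent X x, φ.rep w = 0}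

/-- The hyperplane section of `X` defined by the linear form `φ`. -/
def hyperplaneSection {N : Type*} [AddCommGroup N] [Module ℂ N]
    (X : Set (ℙ ℂ N)) (φ : Module.Dual ℂ N) : Set (ℙ ℂ N) :=
  {x | x ∈ X ∧ φ x.rep = 0}

/-- The image of `⋀^d W` in `⋀^d V`; it is a line when `W` has dimension `d`. -/
noncomputable def pluckerLine {V : Type*} [AddCommGroup V] [Module ℂ V] (d : ℕ) (W : Submodule ℂ V) :
    Submodule ℂ (⋀[ℂ]^d V) :=
  LinearMap.range (exteriorPower.map d W.subtype)

/-- The Grassmannian of `d`-dimensional subspaces of `V` in its Plücker embedding. -/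
def pluckerGrassmannian (d : ℕ) (V : Type*) [AddCommGroup V] [Module ℂ V] :
    Set (ℙ ℂ (⋀[ℂ]^d V)) :=
  {x | ∃ W : Submodule ℂ V, Module.finrank ℂ W = d ∧ x.submodule = pluckerLine d W}

/-! ### Polynomial functions on a complex vector space, studied by restriction to lines. -/

section PolynomialFunctions

variable {M M' : Type*} [AddCommGroup M] [Module ℂ M] [AddCommGroup M'] [Module ℂ M']

/-! A form σ is tangent to G at [W] exactly when it vanishes on ⋀²W∧V, so the dual variety is the
closure of the projectivized cone `tangentCone` of all such σ (`dualVariety_pluckerGrassmannian`).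
Over an affine chart of G this cone is parametrized by pairs (A, τ), where A is a 3×7 matrix and τ
is a form in the conormal space at the centre, transported by a unipotent automorphism
(`conormalMap`). There is one parameter fewer than the dimension of the space of forms. At A = 0 and
τ = `morseForm` the derivative is injective even after the value at the centre is forgotten, because
the Hessian of `morseForm` along G is nondegenerate (`injective_chartHessian_morseForm`). Hence the
cone has codimension one and its ideal is generated by a single f (`exists_tangentCone_equation`).
Irreducibility comes from the affine parameter space, and homogeneity of f from stability of the
cone under dilations (`exists_isForm_of_generator`).

What remains is reflexivity, made explicit. Differentiating f = 0 along the parametrization shows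
that the differential of f at a form tangent at [W] is a multiple of evaluation at ⋀³W
(`lineDeriv_eq_zero_of_apply_chartPoint`). Where this differential is nonzero, W is therefore unique
and can be read off from the gradient of f. The tangency of the subspace so read off is a polynomial
identity modulo f, so it holds at every zero of f, and no proof that the cone is closed is needed
(`isTangentTo_gradient`). The open set is the locus where one fixed partial derivative of f is
nonzero.

For the singularities of F_σ, explicit chart equations show that G is smooth and that F_σ is smooth
wherever σ is not conormal. At the point of tangency, a nonzero differential of f forces the Hessian
of σ to be nondegenerate (`injective_chartHessian_of_lineDeriv_ne_zero`), and a germ with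
nondegenerate quadratic part cannot be cut out by equations with independent differentials
(`not_isSmoothPoint_hyperplaneSection`). -/

theorem linear_mem_polyFun (l : Module.Dual ℂ M) : (fun v => l v) ∈ polyFun M :=
  Algebra.subset_adjoin ⟨l, fun _ => rfl⟩

theorem const_mem_polyFun (c : ℂ) : (fun _ : M => c) ∈ polyFun M :=
  (polyFun M).algebraMap_mem c

theorem mul_mem_polyFun {f g : M → ℂ} (hf : f ∈ polyFun M) (hg : g ∈ polyFun M) :
    (fun v => f v * g v) ∈ polyFun M :=
  (polyFun M).mul_mem hf hg

theorem add_mem_polyFun {f g : M → ℂ} (hf : f ∈ polyFun M) (hg : g ∈ polyFun M) :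
    (fun v => f v + g v) ∈ polyFun M :=
  (polyFun M).add_mem hf hg

theorem sub_mem_polyFun {f g : M → ℂ} (hf : f ∈ polyFun M) (hg : g ∈ polyFun M) :
    (fun v => f v - g v) ∈ polyFun M :=
  (polyFun M).sub_mem hf hg

theorem pow_mem_polyFun {f : M → ℂ} (hf : f ∈ polyFun M) (n : ℕ) :
    (fun v => f v ^ n) ∈ polyFun M :=
  (polyFun M).pow_mem hf n

theorem sum_mem_polyFun {ι : Type*} (s : Finset ι) {f : ι → M → ℂ}
    (hf : ∀ i ∈ s, f i ∈ polyFun M) : (fun v => ∑ i ∈ s, f i v) ∈ polyFun M := by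
  have := (polyFun M).sum_mem hf
  convert this using 1
  ext v; simp

theorem prod_mem_polyFun {ι : Type*} (s : Finset ι) {f : ι → M → ℂ}
    (hf : ∀ i ∈ s, f i ∈ polyFun M) : (fun v => ∏ i ∈ s, f i v) ∈ polyFun M := by
  have := (polyFun M).prod_mem hf
  convert this using 1
  ext v; simp

theorem polyFun_induction {p : (f : M → ℂ) → f ∈ polyFun M → Prop}
    (hl : ∀ l : Module.Dual ℂ M, p (fun v => l v) (linear_mem_polyFun l))
    (hc : ∀ c : ℂ, p (fun _ => c) (const_mem_polyFun c))
    (ha : ∀ f g hf hg, p f hf → p g hg → p (fun v => f v + g v) (add_mem_polyFun hf hg))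
    (hm : ∀ f g hf hg, p f hf → p g hg → p (fun v => f v * g v) (mul_mem_polyFun hf hg))
    {f : M → ℂ} (hf : f ∈ polyFun M) : p f hf := by
  induction hf using Algebra.adjoin_induction with
  | mem f h =>
    have : f = fun v => h.choose v := funext h.choose_spec
    have h2 := hl h.choose
    revert h2
    generalize h.choose = l at this ⊢
    subst this
    exact id
  | algebraMap c => exact hc c
  | add f g hf hg h1 h2 => exact ha f g hf hg h1 h2
  | mul f g hf hg h1 h2 => exact hm f g hf hg h1 h2

/-- A map all of whose coordinates are polynomial functions. -/
def IsPolyMap (γ : M' → M) : Prop :=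
  ∀ l : Module.Dual ℂ M, (fun x => l (γ x)) ∈ polyFun M'

theorem IsPolyMap.comp_mem {γ : M' → M} (hγ : IsPolyMap γ) {f : M → ℂ} (hf : f ∈ polyFun M) :
    (fun x => f (γ x)) ∈ polyFun M' := by
  induction hf using polyFun_induction with
  | hl l => exact hγ l
  | hc c => exact const_mem_polyFun c
  | ha f g _ _ h1 h2 => exact add_mem_polyFun h1 h2
  | hm f g _ _ h1 h2 => exact mul_mem_polyFun h1 h2

theorem IsPolyMap.comp {M'' : Type*} [AddCommGroup M''] [Module ℂ M''] {γ : M' → M} {δ : M'' → M'}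
    (hγ : IsPolyMap γ) (hδ : IsPolyMap δ) : IsPolyMap (fun x => γ (δ x)) :=
  fun l => hδ.comp_mem (hγ l)

theorem isPolyMap_linear (l : M' →ₗ[ℂ] M) : IsPolyMap (fun x => l x) :=
  fun k => linear_mem_polyFun (k ∘ₗ l)

theorem isPolyMap_const (m : M) : IsPolyMap (fun _ : M' => m) :=
  fun k => const_mem_polyFun (k m)

theorem IsPolyMap.add {γ δ : M' → M} (hγ : IsPolyMap γ) (hδ : IsPolyMap δ) :
    IsPolyMap (fun x => γ x + δ x) := fun l => by
  simpa using add_mem_polyFun (hγ l) (hδ l)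

theorem IsPolyMap.sub {γ δ : M' → M} (hγ : IsPolyMap γ) (hδ : IsPolyMap δ) :
    IsPolyMap (fun x => γ x - δ x) := fun l => by
  simpa using sub_mem_polyFun (hγ l) (hδ l)

theorem IsPolyMap.smul {f : M' → ℂ} {γ : M' → M} (hf : f ∈ polyFun M') (hγ : IsPolyMap γ) :
    IsPolyMap (fun x => f x • γ x) := fun l => by
  simpa using mul_mem_polyFun hf (hγ l)

theorem IsPolyMap.sum {ι : Type*} (s : Finset ι) {γ : ι → M' → M} (h : ∀ i ∈ s, IsPolyMap (γ i)) :
    IsPolyMap (fun x => ∑ i ∈ s, γ i x) := fun l => by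
  simpa using sum_mem_polyFun s (fun i hi => h i hi l)

theorem IsPolyMap.linear_comp {M'' : Type*} [AddCommGroup M''] [Module ℂ M''] {γ : M'' → M'}
    (hγ : IsPolyMap γ) (l : M' →ₗ[ℂ] M) : IsPolyMap (fun x => l (γ x)) :=
  (isPolyMap_linear l).comp hγ

theorem isPolyMap_id : IsPolyMap (fun x : M => x) := isPolyMap_linear LinearMap.id

theorem id_mem_polyFun : (fun t : ℂ => t) ∈ polyFun ℂ := linear_mem_polyFun LinearMap.id

theorem isPolyMap_line (v w : M) : IsPolyMap (fun t : ℂ => v + t • w) :=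
  (isPolyMap_const v).add ((isPolyMap_const w).smul id_mem_polyFun)

theorem exists_polynomial_of_mem_polyFun {f : ℂ → ℂ} (hf : f ∈ polyFun ℂ) :
    ∃ p : Polynomial ℂ, ∀ t, f t = p.eval t := by
  induction hf using polyFun_induction with
  | hl l =>
    refine ⟨Polynomial.C (l 1) * Polynomial.X, fun t => ?_⟩
    show l t = _
    have h := l.map_smul t 1
    rw [smul_eq_mul, mul_one] at h
    rw [h, Polynomial.eval_mul, Polynomial.eval_C, Polynomial.eval_X, smul_eq_mul, mul_comm]
  | hc c => exact ⟨Polynomial.C c, fun t => by simp⟩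
  | ha f g _ _ h1 h2 =>
    obtain ⟨p, hp⟩ := h1
    obtain ⟨q, hq⟩ := h2
    exact ⟨p + q, fun t => by simp [hp, hq]⟩
  | hm f g _ _ h1 h2 =>
    obtain ⟨p, hp⟩ := h1
    obtain ⟨q, hq⟩ := h2
    exact ⟨p * q, fun t => by simp [hp, hq]⟩

theorem polyFun_line_eq_zero {f g : ℂ → ℂ} (hf : f ∈ polyFun ℂ) (hg : g ∈ polyFun ℂ)
    (h : ∀ t, f t * g t = 0) {t₀ : ℂ} (h₀ : g t₀ ≠ 0) (t : ℂ) : f t = 0 := by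
  obtain ⟨p, hp⟩ := exists_polynomial_of_mem_polyFun hf
  obtain ⟨q, hq⟩ := exists_polynomial_of_mem_polyFun hg
  have h1 : p * q = 0 := Polynomial.funext fun t => by simpa [hp, hq] using h t
  rcases mul_eq_zero.1 h1 with h2 | h2
  · simp [hp, h2]
  · simp [hq, h2] at h₀

theorem polyFun_line_eq_zero_of_finite {f : ℂ → ℂ} (hf : f ∈ polyFun ℂ) {s : Set ℂ}
    (hs : s.Finite) (h : ∀ t ∉ s, f t = 0) (t : ℂ) : f t = 0 := by
  obtain ⟨p, hp⟩ := exists_polynomial_of_mem_polyFun hf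
  have : p = 0 := by
    refine Polynomial.eq_zero_of_infinite_isRoot p (hs.infinite_compl.mono fun t ht => ?_)
    simpa [hp] using h t ht
  simp [hp, this]

/-- The line joining a nonzero of f to a nonzero of g reduces this to polynomials in one variable.
-/
theorem polyFun_eq_zero_or {f g : M → ℂ} (hf : f ∈ polyFun M) (hg : g ∈ polyFun M)
    (h : ∀ v, f v * g v = 0) : (∀ v, f v = 0) ∨ (∀ v, g v = 0) := by
  by_contra! hc
  obtain ⟨⟨v, hv⟩, ⟨w, hw⟩⟩ := hc
  have := polyFun_line_eq_zero ((isPolyMap_line v (w - v)).comp_mem hf)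
    ((isPolyMap_line v (w - v)).comp_mem hg) (fun t => h _) (t₀ := 1) (by simpa using hw) 0
  simp [hv] at this

/-- Differentiability of a curve in a vector space, tested on linear forms. -/
def HasWeakDerivAt (γ : ℂ → M) (γ' : M) (t : ℂ) : Prop :=
  ∀ l : Module.Dual ℂ M, HasDerivAt (fun s => l (γ s)) (l γ') t

theorem hasWeakDerivAt_line (v w : M) (t : ℂ) : HasWeakDerivAt (fun s => v + s • w) w t := by
  intro l
  simpa using ((hasDerivAt_id t).mul_const (l w)).const_add (l v)

/-- M carries no norm, so the chain rule is stated along curves differentiable against every linear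
form. It follows by induction on f from the sum and Leibniz rules, which also show that the
differential depends polynomially on the base point. -/
theorem exists_differential {f : M → ℂ} (hf : f ∈ polyFun M) :
    ∃ D : M → Module.Dual ℂ M, (∀ v w, lineDeriv ℂ f v w = D v w) ∧
      (∀ w, (fun v => D v w) ∈ polyFun M) ∧
      ∀ (γ : ℂ → M) (γ' : M) (t : ℂ), HasWeakDerivAt γ γ' t →
        HasDerivAt (fun s => f (γ s)) (D (γ t) γ') t := by
  suffices h : ∃ D : M → Module.Dual ℂ M, (∀ w, (fun v => D v w) ∈ polyFun M) ∧
      ∀ (γ : ℂ → M) (γ' : M) (t : ℂ), HasWeakDerivAt γ γ' t →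
        HasDerivAt (fun s => f (γ s)) (D (γ t) γ') t by
    obtain ⟨D, h1, h2⟩ := h
    refine ⟨D, fun v w => ?_, h1, h2⟩
    have := (h2 _ w 0 (hasWeakDerivAt_line v w 0)).deriv
    simpa [lineDeriv] using this
  induction hf using polyFun_induction with
  | hl l => exact ⟨fun _ => l, fun w => const_mem_polyFun _, fun γ γ' t h => h l⟩
  | hc c => exact ⟨fun _ => 0, fun w => const_mem_polyFun _, fun γ γ' t h => hasDerivAt_const _ _⟩
  | ha f g _ _ h1 h2 =>
    obtain ⟨D, hD, hD'⟩ := h1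
    obtain ⟨E, hE, hE'⟩ := h2
    exact ⟨fun v => D v + E v, fun w => add_mem_polyFun (hD w) (hE w),
      fun γ γ' t h => (hD' γ γ' t h).add (hE' γ γ' t h)⟩
  | hm f g hf hg h1 h2 =>
    obtain ⟨D, hD, hD'⟩ := h1
    obtain ⟨E, hE, hE'⟩ := h2
    exact ⟨fun v => g v • D v + f v • E v,
      fun w => add_mem_polyFun (mul_mem_polyFun hg (hD w)) (mul_mem_polyFun hf (hE w)),
      fun γ γ' t h => ((hD' γ γ' t h).mul (hE' γ γ' t h)).congr_deriv (by simp; ring)⟩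

theorem lineDeriv_mem_polyFun {f : M → ℂ} (hf : f ∈ polyFun M) (w : M) :
    (fun v => lineDeriv ℂ f v w) ∈ polyFun M := by
  obtain ⟨D, h1, h2, -⟩ := exists_differential hf
  simpa only [h1] using h2 w

theorem contDiff_of_mem_polyFun {E : Type*} [NormedAddCommGroup E] [NormedSpace ℂ E]
    [FiniteDimensional ℂ E] {f : E → ℂ} (hf : f ∈ polyFun E) {n : WithTop ℕ∞} :
    ContDiff ℂ n f := by
  induction hf using polyFun_induction with
  | hl l => exact (LinearMap.toContinuousLinearMap l).contDiff
  | hc c => exact contDiff_const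
  | ha f g _ _ h1 h2 => exact h1.add h2
  | hm f g _ _ h1 h2 => exact h1.mul h2

theorem contDiff_of_isPolyMap {E F : Type*} [NormedAddCommGroup E] [NormedSpace ℂ E]
    [FiniteDimensional ℂ E] [NormedAddCommGroup F] [NormedSpace ℂ F]
    [FiniteDimensional ℂ F] {γ : E → F} (hγ : IsPolyMap γ) {n : WithTop ℕ∞} :
    ContDiff ℂ n γ := by
  let b := Module.finBasis ℂ F
  have : γ = fun x => ∑ i, (b.coord i (γ x)) • b i := by
    ext x; simp [b.sum_repr]
  rw [this]
  exact ContDiff.sum fun i _ => (contDiff_of_mem_polyFun (hγ (b.coord i))).smul contDiff_const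

theorem mem_polyFun_iff_mvPolynomial {ι : Type*} [Fintype ι] (e : M ≃ₗ[ℂ] (ι → ℂ)) {f : M → ℂ} :
    f ∈ polyFun M ↔ ∃ p : MvPolynomial ι ℂ, ∀ v, f v = MvPolynomial.eval (e v) p := by
  classical
  constructor
  · intro hf
    induction hf using polyFun_induction with
    | hl l =>
      refine ⟨∑ i, MvPolynomial.C (l (e.symm (Pi.single i 1))) * MvPolynomial.X i, fun v => ?_⟩
      have : v = ∑ i, e v i • e.symm (Pi.single i 1) := by
        apply e.injective
        simp only [map_sum, map_smul, LinearEquiv.apply_symm_apply]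
        exact pi_eq_sum_univ' (e v)
      conv_lhs => rw [this]
      simp [mul_comm]
    | hc c => exact ⟨MvPolynomial.C c, fun t => by simp⟩
    | ha f g _ _ h1 h2 =>
      obtain ⟨p, hp⟩ := h1
      obtain ⟨q, hq⟩ := h2
      exact ⟨p + q, fun t => by simp [hp, hq]⟩
    | hm f g _ _ h1 h2 =>
      obtain ⟨p, hp⟩ := h1
      obtain ⟨q, hq⟩ := h2
      exact ⟨p * q, fun t => by simp [hp, hq]⟩
  · rintro ⟨p, hp⟩
    rw [show f = fun v => MvPolynomial.eval (e v) p from funext hp]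
    clear hp
    induction p using MvPolynomial.induction_on with
    | C a => simpa using const_mem_polyFun a
    | add p q h1 h2 =>
      simpa using add_mem_polyFun h1 h2
    | mul_X p i h1 =>
      simpa using mul_mem_polyFun h1
        (linear_mem_polyFun (LinearMap.proj i ∘ₗ e.toLinearMap))

end PolynomialFunctions

/-! ### The Zariski topology expressed through homogeneous forms. -/

section Zariski

variable {M : Type*} [AddCommGroup M] [Module ℂ M]

theorem IsForm.mul {d e : ℕ} {f g : M → ℂ} (hf : IsForm d f) (hg : IsForm e g) :
    IsForm (d + e) (fun v => f v * g v) :=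
  ⟨mul_mem_polyFun hf.1 hg.1, fun t v => by simp only [hf.2, hg.2]; ring⟩

theorem IsForm.rep_mk_eq_zero_iff {d : ℕ} {f : M → ℂ} (hf : IsForm d f) {v : M} (hv : v ≠ 0) :
    f (Projectivization.mk ℂ v hv).rep = 0 ↔ f v = 0 := by
  obtain ⟨a, ha⟩ := Projectivization.exists_smul_eq_mk_rep ℂ v hv
  rw [← ha, Units.smul_def, hf.2]
  simp

theorem mem_projZeros {f : M → ℂ} {x : ℙ ℂ M} : x ∈ projZeros f ↔ f x.rep = 0 := Iff.rfl

/-- Products of forms give intersections, and the constant 1, of degree zero, gives the whole space.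
-/
theorem isTopologicalBasis_zariski :
    @TopologicalSpace.IsTopologicalBasis _ (zariskiTopology M)
      {U | ∃ (d : ℕ) (f : M → ℂ), IsForm d f ∧ U = (projZeros f)ᶜ} := by
  refine @TopologicalSpace.IsTopologicalBasis.mk _ (zariskiTopology M) _ ?_ ?_ rfl
  · rintro _ ⟨d, f, hf, rfl⟩ _ ⟨e, g, hg, rfl⟩ x hx
    refine ⟨_, ⟨_, _, hf.mul hg, rfl⟩, ?_, ?_⟩
    · simpa [projZeros] using hx
    · intro y hy
      simpa [projZeros] using hy
  · refine Set.eq_univ_of_forall fun x => ⟨_, ⟨0, fun _ => 1, ⟨const_mem_polyFun 1, by simp⟩, rfl⟩, ?_⟩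
    simp [projZeros]

theorem isZariskiOpen_compl_projZeros {d : ℕ} {f : M → ℂ} (hf : IsForm d f) :
    IsZariskiOpen (projZeros f)ᶜ :=
  @TopologicalSpace.IsTopologicalBasis.isOpen _ (zariskiTopology M) _ _ isTopologicalBasis_zariski
    ⟨d, f, hf, rfl⟩

theorem mem_zariskiClosure_iff {Z : Set (ℙ ℂ M)} {x : ℙ ℂ M} :
    x ∈ @closure _ (zariskiTopology M) Z ↔
      ∀ (d : ℕ) (f : M → ℂ), IsForm d f → Z ⊆ projZeros f → f x.rep = 0 := by
  rw [@TopologicalSpace.IsTopologicalBasis.mem_closure_iff _ (zariskiTopology M) _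
    isTopologicalBasis_zariski]
  constructor
  · intro h d f hf hZ
    by_contra hx
    obtain ⟨y, hy, hyZ⟩ := h _ ⟨d, f, hf, rfl⟩ hx
    exact hy (hZ hyZ)
  · rintro h _ ⟨d, f, hf, rfl⟩ hx
    by_contra hc
    refine hx (h d f hf fun y hy => ?_)
    by_contra hy'
    exact hc ⟨y, hy', hy⟩

theorem IsZariskiOpen.exists_form {U : Set (ℙ ℂ M)} (hU : IsZariskiOpen U) {x : ℙ ℂ M}
    (hx : x ∈ U) : ∃ (d : ℕ) (f : M → ℂ), IsForm d f ∧ f x.rep ≠ 0 ∧ (projZeros f)ᶜ ⊆ U := by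
  obtain ⟨_, ⟨d, f, hf, rfl⟩, h1, h2⟩ :=
    @TopologicalSpace.IsTopologicalBasis.exists_subset_of_mem_open _ (zariskiTopology M) _
      isTopologicalBasis_zariski x U hx hU
  exact ⟨d, f, hf, h1, h2⟩

/-- Irreducibility is primeness of the vanishing ideal, which only has to be tested on pairs of
forms since these give a basis of open sets. -/
theorem isZariskiIrreducible_closure {Z : Set (ℙ ℂ M)} (hne : Z.Nonempty)
    (h : ∀ (d e : ℕ) (f g : M → ℂ), IsForm d f → IsForm e g →
      Z ⊆ projZeros (fun v => f v * g v) → Z ⊆ projZeros f ∨ Z ⊆ projZeros g) :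
    IsZariskiIrreducible (@closure _ (zariskiTopology M) Z) := by
  let _ := zariskiTopology M
  refine IsIrreducible.closure ⟨hne, ?_⟩
  rintro U W hU hW ⟨x, hxZ, hxU⟩ ⟨y, hyZ, hyW⟩
  obtain ⟨d, f, hf, hfx, hfU⟩ := IsZariskiOpen.exists_form hU hxU
  obtain ⟨e, g, hg, hgy, hgW⟩ := IsZariskiOpen.exists_form hW hyW
  by_contra hc
  rcases h d e f g hf hg (fun z hz => by
    by_contra hz'
    have hz' : ¬ (f z.rep = 0 ∨ g z.rep = 0) := by simpa [projZeros] using hz'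
    push Not at hz'
    exact hc ⟨z, hz, hfU hz'.1, hgW hz'.2⟩) with h' | h'
  · exact hfx (h' hxZ)
  · exact hgy (h' hyZ)

end Zariski

/-! ### The equation of a parametrized hypersurface. -/

section Hypersurface

-- The kernel is a nonzero prime of a factorial ring, so it contains a prime element f, and
-- injectivity on constants forces f to have positive degree. By Gauss's lemma f stays irreducible
-- over the fraction field. If f did not divide some g of the kernel there, a Bézout relation uf +
-- vg = 1 would map to 0 = 1 in the fraction field of A. Primitivity brings the divisibility back to
-- R.
open Polynomial in
theorem exists_generator_ker_of_injective_C {R A : Type*} [CommRing R] [IsDomain R]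
    [UniqueFactorizationMonoid R] [CommRing A] [IsDomain A] (θ : R[X] →+* A)
    (hθ : Function.Injective (θ.comp C)) (hker : RingHom.ker θ ≠ ⊥) :
    ∃ f : R[X], θ f = 0 ∧ f.natDegree ≠ 0 ∧ ∀ g, θ g = 0 → f ∣ g := by
  obtain ⟨f, hf, hfp⟩ := Ideal.IsPrime.exists_mem_prime_of_ne_bot (RingHom.ker_isPrime θ) hker
  rw [RingHom.mem_ker] at hf
  have hirr := hfp.irreducible
  have hdeg : f.natDegree ≠ 0 := by
    intro h
    obtain ⟨r, hr⟩ : ∃ r, f = C r := ⟨_, eq_C_of_natDegree_eq_zero h⟩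
    have : r = 0 := hθ (by simpa [hr] using hf)
    exact hfp.ne_zero (by simp [hr, this])
  refine ⟨f, hf, hdeg, fun g hg => ?_⟩
  have hprim : f.IsPrimitive := hirr.isPrimitive hdeg
  let K := FractionRing R
  let L := FractionRing A
  have hirr' : Irreducible (f.map (algebraMap R K)) :=
    (hprim.irreducible_iff_irreducible_map_fraction_map (K := K)).1 hirr
  have hinj : Function.Injective ((algebraMap A L).comp (θ.comp C)) :=
    (IsFractionRing.injective A L).comp hθ
  let ψ : K →+* L := IsFractionRing.lift hinj
  let Θ : K[X] →+* L := eval₂RingHom ψ (algebraMap A L (θ X))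
  have hΘ : ∀ p : R[X], Θ (p.map (algebraMap R K)) = algebraMap A L (θ p) := by
    intro p
    have : Θ.comp (mapRingHom (algebraMap R K)) = (algebraMap A L).comp θ := by
      apply Polynomial.ringHom_ext
      · intro r; simp [Θ, ψ]
      · simp [Θ]
    exact congrArg (fun φ : R[X] →+* L => φ p) this
  refine Polynomial.IsPrimitive.dvd_of_fraction_map_dvd_fraction_map (K := K) hprim ?_
  by_contra hnd
  obtain ⟨u, v, huv⟩ := (EuclideanDomain.dvd_or_coprime _ _ hirr').resolve_left hnd
  have := congrArg Θ huv
  simp [hΘ, hf, hg] at this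

variable {M : Type*} [AddCommGroup M] [Module ℂ M] {κ : Type*}

open Polynomial in
/-- Evaluation of a polynomial in one distinguished variable and further variables. -/
noncomputable def evalProd (e : M ≃ₗ[ℂ] ℂ × (κ → ℂ)) (v : M) : (MvPolynomial κ ℂ)[X] →+* ℂ :=
  eval₂RingHom (MvPolynomial.eval (e v).2) (e v).1

open Polynomial in
theorem evalProd_mem_polyFun [Fintype κ] (e : M ≃ₗ[ℂ] ℂ × (κ → ℂ)) (p : (MvPolynomial κ ℂ)[X]) :
    (fun v => evalProd e v p) ∈ polyFun M := by
  have h2 : ∀ q : MvPolynomial κ ℂ, (fun v => MvPolynomial.eval (e v).2 q) ∈ polyFun M := fun q =>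
    ((isPolyMap_linear (LinearMap.snd ℂ ℂ (κ → ℂ) ∘ₗ e.toLinearMap)).comp_mem
      ((mem_polyFun_iff_mvPolynomial (LinearEquiv.refl ℂ (κ → ℂ))).2 ⟨q, fun _ => rfl⟩))
  have h1 : (fun v => (e v).1) ∈ polyFun M :=
    linear_mem_polyFun (LinearMap.fst ℂ ℂ (κ → ℂ) ∘ₗ e.toLinearMap)
  induction p using Polynomial.induction_on' with
  | add p q hp hq => simpa using add_mem_polyFun hp hq
  | monomial n a =>
    simpa [evalProd, eval₂_monomial] using mul_mem_polyFun (h2 a) (pow_mem_polyFun h1 n)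

open Polynomial in
theorem exists_evalProd_eq [Fintype κ] (e : M ≃ₗ[ℂ] ℂ × (κ → ℂ)) {f : M → ℂ} (hf : f ∈ polyFun M) :
    ∃ p, ∀ v, f v = evalProd e v p := by
  induction hf using polyFun_induction with
  | hl l =>
    have h1 : (fun z => l (e.symm (0, z))) ∈ polyFun (κ → ℂ) :=
      linear_mem_polyFun (l ∘ₗ e.symm.toLinearMap ∘ₗ LinearMap.inr ℂ ℂ (κ → ℂ))
    obtain ⟨q, hq⟩ := (mem_polyFun_iff_mvPolynomial (LinearEquiv.refl ℂ (κ → ℂ))).1 h1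
    refine ⟨C (MvPolynomial.C (l (e.symm (1, 0)))) * X + C q, fun v => ?_⟩
    have : v = (e v).1 • e.symm (1, 0) + e.symm (0, (e v).2) := by
      apply e.injective
      simp
    have hq' := hq (e v).2
    simp only [LinearEquiv.refl_apply] at hq'
    show l v = _
    conv_lhs => rw [this, map_add, map_smul, hq', smul_eq_mul, mul_comm]
    simp [evalProd]
  | hc c => exact ⟨C (MvPolynomial.C c), fun v => by simp [evalProd]⟩
  | ha f g _ _ h1 h2 =>
    obtain ⟨p, hp⟩ := h1
    obtain ⟨q, hq⟩ := h2
    exact ⟨p + q, fun t => by simp [hp, hq]⟩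
  | hm f g _ _ h1 h2 =>
    obtain ⟨p, hp⟩ := h1
    obtain ⟨q, hq⟩ := h2
    exact ⟨p * q, fun t => by simp [hp, hq]⟩

open Polynomial in
theorem lineDeriv_evalProd (e : M ≃ₗ[ℂ] ℂ × (κ → ℂ)) (p : (MvPolynomial κ ℂ)[X]) (v : M) :
    lineDeriv ℂ (fun v => evalProd e v p) v (e.symm (1, 0)) = evalProd e v (derivative p) := by
  have h : ∀ t : ℂ, evalProd e (v + t • e.symm (1, 0)) p =
      (p.map (MvPolynomial.eval (e v).2)).eval ((e v).1 + t) := by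
    intro t
    simp [evalProd, eval_map]
  rw [lineDeriv]
  simp only [h]
  have := ((p.map (MvPolynomial.eval (e v).2)).hasDerivAt ((e v).1 + 0)).comp_const_add (e v).1 0
  rw [this.deriv]
  simp [evalProd, eval_map, derivative_map]

open Polynomial Cardinal in
/-- The closure of the image of a polynomial map from an affine space of dimension one less than
the target is a hypersurface as soon as the map becomes dominant after a projection. -/
theorem exists_hypersurface_equation [Fintype κ] (e : M ≃ₗ[ℂ] ℂ × (κ → ℂ)) {Φ : (κ → ℂ) → M}
    (hΦ : IsPolyMap Φ)
    (hdom : ∀ g ∈ polyFun (κ → ℂ), (∀ y, g (e (Φ y)).2 = 0) → ∀ z, g z = 0) :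
    ∃ f ∈ polyFun M, (∀ y, f (Φ y) = 0) ∧
      (∀ g ∈ polyFun M, (∀ y, g (Φ y) = 0) → ∃ h ∈ polyFun M, ∀ v, g v = f v * h v) ∧
      ∃ y, lineDeriv ℂ f (Φ y) (e.symm (1, 0)) ≠ 0 := by
  have hpoly : ∀ g ∈ polyFun M, ∃ p : MvPolynomial κ ℂ, ∀ y, g (Φ y) = MvPolynomial.eval y p :=
    fun g hg => (mem_polyFun_iff_mvPolynomial (LinearEquiv.refl ℂ (κ → ℂ))).1 (hΦ.comp_mem hg)
  obtain ⟨P₀, hP₀⟩ := hpoly _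
    (linear_mem_polyFun (LinearMap.fst ℂ ℂ (κ → ℂ) ∘ₗ e.toLinearMap))
  choose P hP using fun k => hpoly _
    (linear_mem_polyFun (LinearMap.proj k ∘ₗ LinearMap.snd ℂ ℂ (κ → ℂ) ∘ₗ e.toLinearMap))
  simp only [LinearMap.coe_comp, LinearEquiv.coe_coe, Function.comp_apply, LinearMap.fst_apply,
    LinearMap.snd_apply, LinearMap.proj_apply] at hP₀ hP
  let A := MvPolynomial κ ℂ
  -- Substitution of the coordinates of Φ, the distinguished one for X; its kernel is the ideal of
  -- the image of Φ.
  let θ : A[X] →+* A := eval₂RingHom (MvPolynomial.bind₁ P).toRingHom P₀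
  have haeval : ∀ y (q : A), MvPolynomial.eval y (MvPolynomial.bind₁ P q) =
      MvPolynomial.eval (e (Φ y)).2 q := by
    intro y q
    induction q using MvPolynomial.induction_on with
    | C a => simp
    | add p q h1 h2 => simp [h1, h2]
    | mul_X p i h1 => rw [map_mul, map_mul, h1]; simp [hP]
  have hθ : ∀ y p, MvPolynomial.eval y (θ p) = evalProd e (Φ y) p := by
    intro y p
    have : (MvPolynomial.eval y).comp θ = evalProd e (Φ y) := by
      apply Polynomial.ringHom_ext
      · intro a; simp [θ, evalProd, haeval]
      · simp [θ, evalProd, hP₀]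
    exact congrArg (fun φ : A[X] →+* ℂ => φ p) this
  have hθ0 : ∀ p, θ p = 0 ↔ ∀ y, evalProd e (Φ y) p = 0 := by
    intro p
    simp only [← hθ]
    exact ⟨fun h y => by simp [h], fun h => MvPolynomial.funext fun y => by simpa using h y⟩
  have hinj : Function.Injective (θ.comp C) := by
    rw [injective_iff_map_eq_zero]
    intro q hq
    have hq' : ∀ y, MvPolynomial.eval (e (Φ y)).2 q = 0 := by
      intro y
      rw [← haeval]
      have : θ (C q) = MvPolynomial.bind₁ P q := by simp [θ]
      rw [← this]
      simpa using congrArg (MvPolynomial.eval y) hq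
    have := hdom (fun z => MvPolynomial.eval z q)
      ((mem_polyFun_iff_mvPolynomial (LinearEquiv.refl ℂ (κ → ℂ))).2 ⟨q, fun _ => rfl⟩) hq'
    exact MvPolynomial.funext fun z => by simpa using this z
  -- Injectivity would make the coordinates of Φ, one more in number than the variables,
  -- algebraically independent, against the transcendence degree of A.
  have hker : RingHom.ker θ ≠ ⊥ := by
    intro hbot
    have hθinj : Function.Injective θ := (RingHom.injective_iff_ker_eq_bot θ).2 hbot
    have hind : AlgebraicIndependent ℂ (fun o : Option κ => o.elim P₀ P) := by
      rw [algebraicIndependent_iff_injective_aeval, MvPolynomial.aeval_eq_bind₁]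
      have : ∀ q, MvPolynomial.bind₁ (fun o : Option κ => o.elim P₀ P) q =
          θ (MvPolynomial.optionEquivLeft ℂ κ q) := by
        intro q
        induction q using MvPolynomial.induction_on with
        | C a =>
          simp only [MvPolynomial.bind₁_C_right, MvPolynomial.optionEquivLeft_C, θ,
            coe_eval₂RingHom, eval₂_C]
          exact (MvPolynomial.bind₁_C_right P a).symm
        | add p q h1 h2 => simp [h1, h2]
        | mul_X p i h1 =>
          rw [map_mul, map_mul, map_mul, h1]
          congr 1
          cases i with
          | none => simp [θ, MvPolynomial.optionEquivLeft_X_none]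
          | some i =>
            simp only [MvPolynomial.bind₁_X_right, MvPolynomial.optionEquivLeft_X_some, θ,
              coe_eval₂RingHom, eval₂_C]
            exact (MvPolynomial.bind₁_X_right P i).symm
      intro p q hpq
      simp only [this] at hpq
      exact (MvPolynomial.optionEquivLeft ℂ κ).injective (hθinj hpq)
    have := hind.lift_cardinalMk_le_trdeg
    rw [MvPolynomial.trdeg_of_isDomain] at this
    simp only [mk_fintype, Fintype.card_option, lift_natCast, Nat.cast_le] at this
    omega
  obtain ⟨f, hf0, hfdeg, hfdvd⟩ := exists_generator_ker_of_injective_C θ hinj hker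
  refine ⟨fun v => evalProd e v f, evalProd_mem_polyFun e f, (hθ0 f).1 hf0, ?_, ?_⟩
  · intro g hg hgΦ
    obtain ⟨p, hp⟩ := exists_evalProd_eq e hg
    obtain ⟨q, hq⟩ := hfdvd p ((hθ0 p).2 fun y => by rw [← hp]; exact hgΦ y)
    exact ⟨fun v => evalProd e v q, evalProd_mem_polyFun e q, fun v => by rw [hp, hq, map_mul]⟩
  -- If the partial derivative vanished on the image, f would divide its own X-derivative, which is
  -- nonzero and of smaller degree.
  · by_contra! hc
    simp only [lineDeriv_evalProd] at hc
    have h1 := hfdvd _ ((hθ0 _).2 hc)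
    by_cases hd : derivative f = 0
    · exact hfdeg (derivative_eq_zero.1 hd)
    · exact absurd (natDegree_le_of_dvd h1 hd) (not_le.2 (natDegree_derivative_lt hfdeg))

/-- On each line through a the restriction is a polynomial with infinitely many zeros. -/
theorem polyFun_eq_zero_of_eventually {F : Type*} [NormedAddCommGroup F] [NormedSpace ℂ F]
    {g : F → ℂ} (hg : g ∈ polyFun F) {a : F} (hz : ∀ᶠ y in nhds a, g y = 0) (z : F) : g z = 0 := by
  have hline : Filter.Tendsto (fun t : ℂ => a + t • (z - a)) (nhdsWithin 0 {0}ᶜ) (nhds a) := by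
    refine tendsto_nhdsWithin_of_tendsto_nhds ?_
    have : Continuous fun t : ℂ => a + t • (z - a) := by fun_prop
    simpa using this.tendsto 0
  obtain ⟨p, hp⟩ := exists_polynomial_of_mem_polyFun ((isPolyMap_line a (z - a)).comp_mem hg)
  have hp0 : p = 0 := by
    refine p.eq_zero_of_infinite_isRoot ?_
    have h2 := (hline.eventually hz).frequently
    intro hfin
    have h3 : ∀ᶠ t in nhdsWithin (0 : ℂ) {0}ᶜ, t ∉ {t | p.IsRoot t} := by
      have h4 : ({t | p.IsRoot t} \ {0})ᶜ ∈ nhds (0 : ℂ) :=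
        (hfin.subset Set.sdiff_subset).isClosed.isOpen_compl.mem_nhds (by simp)
      filter_upwards [nhdsWithin_le_nhds h4, self_mem_nhdsWithin] with t ht ht0
      simp only [Set.mem_compl_iff, Set.mem_sdiff, not_and, not_not] at ht ht0
      exact fun h => ht0 (ht h)
    obtain ⟨t, ht1, ht2⟩ := (h2.and_eventually h3).exists
    exact ht2 (by simpa [Polynomial.IsRoot, ← hp] using ht1)
  have := hp 1
  simpa [hp0] using this

/-- Dominance of a polynomial map with surjective derivative at a point. -/
theorem polyFun_eq_zero_of_surjective_fderiv {E F : Type*} [NormedAddCommGroup E] [NormedSpace ℂ E]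
    [FiniteDimensional ℂ E] [NormedAddCommGroup F] [NormedSpace ℂ F] [FiniteDimensional ℂ F]
    {Ψ : E → F} (hΨ : IsPolyMap Ψ) {a : E} (hsurj : Function.Surjective (fderiv ℂ Ψ a))
    {g : F → ℂ} (hg : g ∈ polyFun F) (h : ∀ y, g (Ψ y) = 0) (z : F) : g z = 0 := by
  have hd : HasStrictFDerivAt Ψ (fderiv ℂ Ψ a) a :=
    (contDiff_of_isPolyMap hΨ (n := 1)).contDiffAt.hasStrictFDerivAt one_ne_zero
  have := FiniteDimensional.complete ℂ E
  have := FiniteDimensional.complete ℂ F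
  -- A surjective strict derivative makes Ψ open at a, so g vanishes on a neighbourhood of Ψ a.
  have hmap := hd.map_nhds_eq_of_surj (LinearMap.range_eq_top.2 hsurj)
  refine polyFun_eq_zero_of_eventually hg (a := Ψ a) ?_ z
  rw [← hmap]
  exact Filter.eventually_map.2 (Filter.Eventually.of_forall h)

end Hypersurface

/-! ### Decomposable trivectors and the action of endomorphisms on them. -/

section Wedge

theorem update_zero {α : Type*} (x y z v : α) : Function.update ![x, y, z] 0 v = ![v, y, z] := by
  ext i; fin_cases i <;> rfl

theorem update_one {α : Type*} (x y z v : α) : Function.update ![x, y, z] 1 v = ![x, v, z] := by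
  ext i; fin_cases i <;> rfl

theorem update_two {α : Type*} (x y z v : α) : Function.update ![x, y, z] 2 v = ![x, y, v] := by
  ext i; fin_cases i <;> rfl

theorem fin_three_eta {α : Type*} (x : Fin 3 → α) : x = ![x 0, x 1, x 2] := by
  ext i; fin_cases i <;> rfl

variable {V : Type*} [AddCommGroup V] [Module ℂ V]

/-- The decomposable trivector attached to a triple of vectors. -/
noncomputable abbrev wedge (x : Fin 3 → V) : ⋀[ℂ]^3 V := exteriorPower.ιMulti ℂ 3 x

theorem wedge_add₀ (x x' y z : V) : wedge ![x + x', y, z] = wedge ![x, y, z] + wedge ![x', y, z] := by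
  simpa only [update_zero] using (exteriorPower.ιMulti ℂ 3).map_update_add ![x, y, z] 0 x x'

theorem wedge_add₁ (x y y' z : V) : wedge ![x, y + y', z] = wedge ![x, y, z] + wedge ![x, y', z] := by
  simpa only [update_one] using (exteriorPower.ιMulti ℂ 3).map_update_add ![x, y, z] 1 y y'

theorem wedge_add₂ (x y z z' : V) : wedge ![x, y, z + z'] = wedge ![x, y, z] + wedge ![x, y, z'] := by
  simpa only [update_two] using (exteriorPower.ιMulti ℂ 3).map_update_add ![x, y, z] 2 z z'

theorem wedge_smul₀ (t : ℂ) (x y z : V) : wedge ![t • x, y, z] = t • wedge ![x, y, z] := by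
  simpa only [update_zero] using (exteriorPower.ιMulti ℂ 3).map_update_smul ![x, y, z] 0 t x

theorem wedge_smul₁ (t : ℂ) (x y z : V) : wedge ![x, t • y, z] = t • wedge ![x, y, z] := by
  simpa only [update_one] using (exteriorPower.ιMulti ℂ 3).map_update_smul ![x, y, z] 1 t y

theorem wedge_smul₂ (t : ℂ) (x y z : V) : wedge ![x, y, t • z] = t • wedge ![x, y, z] := by
  simpa only [update_two] using (exteriorPower.ιMulti ℂ 3).map_update_smul ![x, y, z] 2 t z

theorem wedge_swap₀₁ (x y z : V) : wedge ![y, x, z] = - wedge ![x, y, z] := by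
  have := (exteriorPower.ιMulti ℂ 3).map_swap ![x, y, z] (i := 0) (j := 1) (by decide)
  rw [← this]; congr 1; ext i; fin_cases i <;> rfl

theorem wedge_swap₁₂ (x y z : V) : wedge ![x, z, y] = - wedge ![x, y, z] := by
  have := (exteriorPower.ιMulti ℂ 3).map_swap ![x, y, z] (i := 1) (j := 2) (by decide)
  rw [← this]; congr 1; ext i; fin_cases i <;> rfl

theorem wedge_self₀₁ (x z : V) : wedge ![x, x, z] = 0 :=
  (exteriorPower.ιMulti ℂ 3).map_eq_zero_of_eq ![x, x, z] (i := 0) (j := 1) rfl (by decide)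

/-- This cubic expansion in t is the source of the first- and second-order operators `lieAct` and
`lieAct₂`. -/
theorem wedge_add_smul (x c : Fin 3 → V) (t : ℂ) :
    wedge (fun i => x i + t • c i) = wedge x + t • (∑ i, wedge (Function.update x i (c i))) +
      t ^ 2 • (∑ i, wedge (Function.update c i (x i))) + t ^ 3 • wedge c := by
  rw [fin_three_eta x, fin_three_eta c, fin_three_eta (fun i => _ + t • _)]
  simp only [Fin.sum_univ_three, Matrix.cons_val_zero, Matrix.cons_val_one, Matrix.cons_val,
    update_zero, update_one, update_two,
    wedge_add₀, wedge_add₁, wedge_add₂, wedge_smul₀, wedge_smul₁, wedge_smul₂]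
  module

/-- Tested against a linear form, the left side is an alternating trilinear form in the rows of m,
hence a multiple of the determinant; m = 1 gives the factor. -/
theorem wedge_matrix (m : Matrix (Fin 3) (Fin 3) ℂ) (y : Fin 3 → V) :
    wedge (fun i => ∑ k, m i k • y k) = m.det • wedge y := by
  have h : ∀ l : Module.Dual ℂ (⋀[ℂ]^3 V),
      l (wedge (fun i => ∑ k, m i k • y k) - m.det • wedge y) = 0 := by
    intro l
    let f : (Fin 3 → ℂ) [⋀^Fin 3]→ₗ[ℂ] ℂ :=
      (l.compAlternatingMap (exteriorPower.ιMulti ℂ 3)).compLinearMap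
        (Fintype.linearCombination ℂ y)
    have hf : f = f (Pi.basisFun ℂ (Fin 3)) • Matrix.detRowAlternating := by
      rw [← Pi.basisFun_det]; exact AlternatingMap.eq_smul_basis_det _ f
    have h1 : ∀ m : Fin 3 → Fin 3 → ℂ, f m = l (wedge (fun i => ∑ k, m i k • y k)) := fun m => by
      simp [f, Fintype.linearCombination_apply, wedge]
    have h2 : f (Pi.basisFun ℂ (Fin 3)) = l (wedge y) := by
      rw [h1]; simp [Pi.single_apply]
    have h3 : f (fun i k => m i k) = l (wedge y) * m.det := by
      rw [← h2]; exact congrArg (fun φ => φ m) hf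
    rw [h1] at h3
    rw [map_sub, map_smul, h3, smul_eq_mul, mul_comm, sub_self]
  rwa [Module.forall_dual_apply_eq_zero_iff, sub_eq_zero] at h

theorem linearMap_ext_wedge {N : Type*} [AddCommGroup N] [Module ℂ N] {f g : ⋀[ℂ]^3 V →ₗ[ℂ] N}
    (h : ∀ x, f (wedge x) = g (wedge x)) : f = g :=
  exteriorPower.linearMap_ext (AlternatingMap.ext h)

/-- The action of an endomorphism on trivectors as a derivation. -/
noncomputable def lieAct (C : V →ₗ[ℂ] V) : ⋀[ℂ]^3 V →ₗ[ℂ] ⋀[ℂ]^3 V :=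
  -- The odd part of t ↦ ⋀³(1 + tC) consists of the terms in t and t³; at t = 1 the cubic one is
  -- ⋀³C, and removing it leaves the linear coefficient.
  (1 / 2 : ℂ) • (exteriorPower.map 3 (1 + C) - exteriorPower.map 3 (1 + (-1 : ℂ) • C)) -
    exteriorPower.map 3 C

theorem map_wedge (C : V →ₗ[ℂ] V) (x : Fin 3 → V) :
    exteriorPower.map 3 C (wedge x) = wedge (fun i => C (x i)) :=
  exteriorPower.map_apply_ιMulti C x

theorem map_one_add_smul_wedge (C : V →ₗ[ℂ] V) (x : Fin 3 → V) (t : ℂ) :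
    exteriorPower.map 3 (1 + t • C) (wedge x) =
      wedge x + t • (∑ i, wedge (Function.update x i (C (x i)))) +
      t ^ 2 • (∑ i, wedge (Function.update (fun j => C (x j)) i (x i))) +
      t ^ 3 • wedge (fun i => C (x i)) := by
  rw [map_wedge, ← wedge_add_smul]; rfl

theorem lieAct_wedge (C : V →ₗ[ℂ] V) (x : Fin 3 → V) :
    lieAct C (wedge x) = ∑ i, wedge (Function.update x i (C (x i))) := by
  have h1 := map_one_add_smul_wedge C x 1
  rw [one_smul] at h1
  have h2 := map_one_add_smul_wedge C x (-1)
  have h3 := map_wedge C x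
  simp only [lieAct, LinearMap.sub_apply, LinearMap.smul_apply, h1, h2, h3]
  module

/-- The second order part of the action of `1 + t • C` on trivectors. -/
noncomputable def lieAct₂ (C : V →ₗ[ℂ] V) : ⋀[ℂ]^3 V →ₗ[ℂ] ⋀[ℂ]^3 V :=
  exteriorPower.map 3 (1 + C) - 1 - lieAct C - exteriorPower.map 3 C

theorem map_one_add_smul (C : V →ₗ[ℂ] V) (t : ℂ) :
    exteriorPower.map 3 (1 + t • C) =
      1 + t • lieAct C + t ^ 2 • lieAct₂ C + t ^ 3 • exteriorPower.map 3 C := by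
  apply linearMap_ext_wedge
  intro x
  have h1 := map_one_add_smul_wedge C x 1
  rw [one_smul] at h1
  have h2 := map_one_add_smul_wedge C x t
  have h3 := map_wedge C x
  simp only [lieAct₂, LinearMap.sub_apply, LinearMap.add_apply, LinearMap.smul_apply, h1, h2, h3,
    lieAct_wedge, Module.End.one_apply]
  module

/-- The linear form on trivectors given by the determinant of three linear forms. -/
noncomputable def detForm (φ : Fin 3 → Module.Dual ℂ V) : Module.Dual ℂ (⋀[ℂ]^3 V) :=
  exteriorPower.alternatingMapLinearEquiv
    (Matrix.detRowAlternating.compLinearMap (LinearMap.pi φ))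

theorem detForm_wedge (φ : Fin 3 → Module.Dual ℂ V) (x : Fin 3 → V) :
    detForm φ (wedge x) = Matrix.det (Matrix.of fun i j => φ j (x i)) := by
  simp [detForm, exteriorPower.alternatingMapLinearEquiv_apply_ιMulti]
  rfl

theorem detForm_wedge' (φ : Fin 3 → Module.Dual ℂ V) (x : Fin 3 → V) :
    detForm φ (wedge x) = φ 0 (x 0) * φ 1 (x 1) * φ 2 (x 2) - φ 0 (x 0) * φ 2 (x 1) * φ 1 (x 2)
      - φ 1 (x 0) * φ 0 (x 1) * φ 2 (x 2) + φ 1 (x 0) * φ 2 (x 1) * φ 0 (x 2)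
      + φ 2 (x 0) * φ 0 (x 1) * φ 1 (x 2) - φ 2 (x 0) * φ 1 (x 1) * φ 0 (x 2) := by
  rw [detForm_wedge, Matrix.det_fin_three]; simp only [Matrix.of_apply]

end Wedge

/-! ### Tangency of a trivector form along a subspace. -/

section Tangency

variable {V : Type*} [AddCommGroup V] [Module ℂ V]

/-- The trivector form `σ` vanishes on `⋀² W ∧ V`. -/
def IsTangentTo (W : Submodule ℂ V) (σ : Module.Dual ℂ (⋀[ℂ]^3 V)) : Prop :=
  ∀ w₁ ∈ W, ∀ w₂ ∈ W, ∀ v : V, σ (wedge ![w₁, w₂, v]) = 0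

/-- Bilinearity and alternation reduce tangency to replacing one vector of the frame at a time. The
frame need not be independent, which is what allows its use for the frame built from a gradient. -/
theorem isTangentTo_span_iff (w : Fin 3 → V) (σ : Module.Dual ℂ (⋀[ℂ]^3 V)) :
    IsTangentTo (Submodule.span ℂ (Set.range w)) σ ↔
      ∀ i v, σ (wedge (Function.update w i v)) = 0 := by
  have hm : ∀ i, w i ∈ Submodule.span ℂ (Set.range w) := fun i => Submodule.subset_span ⟨i, rfl⟩
  constructor
  · intro h i v
    rw [fin_three_eta w]
    fin_cases i
    · have := h (w 1) (hm 1) (w 2) (hm 2) v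
      simp only [Fin.zero_eta, update_zero]
      rw [wedge_swap₀₁, wedge_swap₁₂]; simpa using this
    · have := h (w 0) (hm 0) (w 2) (hm 2) v
      simp only [Fin.mk_one, update_one]
      rw [wedge_swap₁₂]; simpa using this
    · simpa only [Fin.reduceFinMk, update_two] using h (w 0) (hm 0) (w 1) (hm 1) v
  · intro h x hx y hy v
    have h0 := h 0 v
    have h1 := h 1 v
    have h2 := h 2 v
    rw [fin_three_eta w] at h0 h1 h2
    rw [update_zero] at h0
    rw [update_one] at h1
    rw [update_two] at h2
    have hb : ∀ i j, σ (wedge ![w i, w j, v]) = 0 := by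
      have e12 : σ (wedge ![w 1, w 2, v]) = 0 := by
        rw [wedge_swap₁₂, wedge_swap₀₁]; simpa using h0
      have e02 : σ (wedge ![w 0, w 2, v]) = 0 := by
        rw [wedge_swap₁₂]; simpa using h1
      have e21 : σ (wedge ![w 2, w 1, v]) = 0 := by rw [wedge_swap₀₁]; simpa using e12
      have e20 : σ (wedge ![w 2, w 0, v]) = 0 := by rw [wedge_swap₀₁]; simpa using e02
      have e10 : σ (wedge ![w 1, w 0, v]) = 0 := by rw [wedge_swap₀₁]; simpa using h2
      intro i j
      by_cases hij : i = j
      · subst hij; rw [wedge_self₀₁, map_zero]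
      · fin_cases i <;> fin_cases j <;> first | exact absurd rfl hij | assumption
    induction hx using Submodule.span_induction with
    | zero =>
      have := wedge_smul₀ 0 0 y v
      rw [zero_smul, zero_smul] at this
      rw [this, map_zero]
    | add a a' _ _ ha ha' => rw [wedge_add₀, map_add, ha, ha', add_zero]
    | smul c a _ ha => rw [wedge_smul₀, map_smul, ha, smul_zero]
    | mem a ha =>
      obtain ⟨i, rfl⟩ := ha
      induction hy using Submodule.span_induction with
      | zero =>
        have := wedge_smul₁ 0 (w i) 0 v
        rw [zero_smul, zero_smul] at this
        rw [this, map_zero]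
      | add a a' _ _ ha ha' => rw [wedge_add₁, map_add, ha, ha', add_zero]
      | smul c a _ ha => rw [wedge_smul₁, map_smul, ha, smul_zero]
      | mem a ha =>
        obtain ⟨j, rfl⟩ := ha
        exact hb i j

theorem IsTangentTo.comp_map {W W' : Submodule ℂ V} {σ : Module.Dual ℂ (⋀[ℂ]^3 V)}
    (h : IsTangentTo W' σ) {g : V →ₗ[ℂ] V} (hg : ∀ w ∈ W, g w ∈ W') :
    IsTangentTo W (σ ∘ₗ exteriorPower.map 3 g) := by
  intro x hx y hy v
  rw [LinearMap.comp_apply, map_wedge, fin_three_eta (fun i => g _)]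
  exact h _ (hg x hx) _ (hg y hy) _

end Tangency

/-! ### Polynomial dependence of pairings, wedges and induced maps on parameters. -/

section Pairing

variable {V N Y : Type*} [AddCommGroup V] [Module ℂ V] [FiniteDimensional ℂ V]
  [AddCommGroup N] [Module ℂ N] [FiniteDimensional ℂ N] [AddCommGroup Y] [Module ℂ Y]

theorem IsPolyMap.dual_apply {σ : Y → Module.Dual ℂ N} {n : Y → N} (hσ : IsPolyMap σ)
    (hn : IsPolyMap n) : (fun y => σ y (n y)) ∈ polyFun Y := by
  let b := Module.finBasis ℂ N
  have h : (fun y => σ y (n y)) = fun y => ∑ k, b.coord k (n y) * σ y (b k) := by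
    ext y
    have h := congrArg (σ y) (b.sum_repr (n y))
    rw [map_sum] at h
    simp only [map_smul, smul_eq_mul] at h
    exact h.symm
  rw [h]
  exact sum_mem_polyFun _ fun k _ =>
    mul_mem_polyFun (hn (b.coord k)) (hσ (Module.Dual.eval ℂ N (b k)))

theorem isPolyMap_dual {σ : Y → Module.Dual ℂ N} (h : ∀ n, (fun y => σ y n) ∈ polyFun Y) :
    IsPolyMap σ := by
  intro l
  obtain ⟨n, rfl⟩ := (Module.evalEquiv ℂ N).surjective l
  exact h n

theorem isPolyMap_wedge {x : Fin 3 → Y → V} (hx : ∀ i, IsPolyMap (x i)) :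
    IsPolyMap (fun y => wedge (fun i => x i y)) := by
  let b := Module.finBasis ℂ V
  have h : (fun y => wedge (fun i => x i y)) = fun y =>
      ∑ r : Fin 3 → Fin (Module.finrank ℂ V), (∏ i, b.coord (r i) (x i y)) •
        wedge (fun i => b (r i)) := by
    ext1 y
    have h1 : (fun i => x i y) = fun i => ∑ k, b.coord k (x i y) • b k := by
      ext1 i; exact (b.sum_repr (x i y)).symm
    rw [h1]
    have := (exteriorPower.ιMulti ℂ 3 (M := V)).toMultilinearMap.map_sum
      (fun i k => b.coord k (x i y) • b k)
    refine this.trans (Finset.sum_congr rfl fun r _ => ?_)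
    exact (exteriorPower.ιMulti ℂ 3 (M := V)).toMultilinearMap.map_smul_univ _ _
  rw [h]
  exact IsPolyMap.sum _ fun r _ =>
    (isPolyMap_const _).smul (prod_mem_polyFun _ fun i _ => hx i _)

theorem isPolyMap_map {C : Y → V →ₗ[ℂ] V} (hC : ∀ v, IsPolyMap (fun y => C y v))
    {n : Y → ⋀[ℂ]^3 V} (hn : IsPolyMap n) :
    IsPolyMap (fun y => exteriorPower.map 3 (C y) (n y)) := by
  have h0 : ∀ m : ⋀[ℂ]^3 V, IsPolyMap (fun y => exteriorPower.map 3 (C y) m) := by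
    intro m
    have hm : m ∈ Submodule.span ℂ (Set.range (exteriorPower.ιMulti ℂ 3 (M := V))) := by
      rw [exteriorPower.ιMulti_span]; trivial
    induction hm using Submodule.span_induction with
    | mem m hm =>
      obtain ⟨x, rfl⟩ := hm
      simp only [exteriorPower.map_apply_ιMulti]
      exact isPolyMap_wedge fun i => hC (x i)
    | zero => simpa using isPolyMap_const (0 : ⋀[ℂ]^3 V)
    | add a b _ _ ha hb => simpa using ha.add hb
    | smul c a _ ha => simpa using IsPolyMap.smul (const_mem_polyFun c) ha
  intro l
  have := IsPolyMap.dual_apply (σ := fun y => l ∘ₗ exteriorPower.map 3 (C y)) (n := n)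
    (isPolyMap_dual fun m => h0 m l) hn
  exact this

end Pairing

/-! ### Affine charts of the Grassmannian and the conormal space at their centre. -/

section Chart

variable {V : Type*} [AddCommGroup V] [Module ℂ V] {α : Type*}

/-- The trivector at the centre of the chart attached to a basis. -/
noncomputable def chartPoint (b : Module.Basis (Fin 3 ⊕ α) ℂ V) : ⋀[ℂ]^3 V :=
  wedge (fun i => b (Sum.inl i))

/-- The tangent vectors at the centre of the chart attached to a basis. -/
noncomputable def chartTangent (b : Module.Basis (Fin 3 ⊕ α) ℂ V) (i : Fin 3) (a : α) :
    ⋀[ℂ]^3 V :=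
  wedge (Function.update (fun i => b (Sum.inl i)) i (b (Sum.inr a)))

/-- The first Plücker coordinate in a chart. -/
noncomputable def chartCoordZero (b : Module.Basis (Fin 3 ⊕ α) ℂ V) :
    Module.Dual ℂ (⋀[ℂ]^3 V) :=
  detForm (fun j => b.coord (Sum.inl j))

/-- The Plücker coordinates restricting to affine coordinates of the chart. -/
noncomputable def chartCoord (b : Module.Basis (Fin 3 ⊕ α) ℂ V) (i : Fin 3) (a : α) :
    Module.Dual ℂ (⋀[ℂ]^3 V) :=
  detForm (Function.update (fun j => b.coord (Sum.inl j)) i (b.coord (Sum.inr a)))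

/-- The homogenized frame of the subspace with affine coordinates `A` in a chart. -/
noncomputable def chartFrame [Fintype α] (b : Module.Basis (Fin 3 ⊕ α) ℂ V) (s : ℂ)
    (A : Fin 3 → α → ℂ) (i : Fin 3) : V :=
  s • b (Sum.inl i) + ∑ a, A i a • b (Sum.inr a)

theorem coord_inl_chartFrame [Fintype α] (b : Module.Basis (Fin 3 ⊕ α) ℂ V) (s : ℂ)
    (A : Fin 3 → α → ℂ) (i j : Fin 3) :
    b.coord (Sum.inl j) (chartFrame b s A i) = if i = j then s else 0 := by
  classical
  simp [chartFrame, Finsupp.single_apply]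

theorem coord_inr_chartFrame [Fintype α] (b : Module.Basis (Fin 3 ⊕ α) ℂ V) (s : ℂ)
    (A : Fin 3 → α → ℂ) (i : Fin 3) (a : α) :
    b.coord (Sum.inr a) (chartFrame b s A i) = A i a := by
  classical
  simp [chartFrame, Finsupp.single_apply]

theorem chartCoordZero_chartFrame [Fintype α] (b : Module.Basis (Fin 3 ⊕ α) ℂ V) (s : ℂ)
    (A : Fin 3 → α → ℂ) : chartCoordZero b (wedge (chartFrame b s A)) = s ^ 3 := by
  rw [chartCoordZero, detForm_wedge']
  simp only [coord_inl_chartFrame]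
  simp
  ring

theorem chartCoord_chartFrame [Fintype α] (b : Module.Basis (Fin 3 ⊕ α) ℂ V) (s : ℂ)
    (A : Fin 3 → α → ℂ) (i : Fin 3) (a : α) :
    chartCoord b i a (wedge (chartFrame b s A)) = s ^ 2 * A i a := by
  rw [chartCoord, detForm_wedge']
  fin_cases i <;> simp [coord_inl_chartFrame, coord_inr_chartFrame, -Module.Basis.coord_apply] <;>
    ring_nf <;> simp

theorem coord_inl_inl (b : Module.Basis (Fin 3 ⊕ α) ℂ V) (i j : Fin 3) :
    b.coord (Sum.inl j) (b (Sum.inl i)) = if i = j then 1 else 0 := by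
  classical
  simp [Finsupp.single_apply]

theorem coord_inl_inr (b : Module.Basis (Fin 3 ⊕ α) ℂ V) (j : Fin 3) (a : α) :
    b.coord (Sum.inl j) (b (Sum.inr a)) = 0 := by
  simp

theorem coord_inr_inl (b : Module.Basis (Fin 3 ⊕ α) ℂ V) (i : Fin 3) (a : α) :
    b.coord (Sum.inr a) (b (Sum.inl i)) = 0 := by
  simp

theorem coord_inr_inr [DecidableEq α] (b : Module.Basis (Fin 3 ⊕ α) ℂ V) (a c : α) :
    b.coord (Sum.inr c) (b (Sum.inr a)) = if a = c then 1 else 0 := by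
  simp [Finsupp.single_apply]

theorem chartCoordZero_chartPoint (b : Module.Basis (Fin 3 ⊕ α) ℂ V) :
    chartCoordZero b (chartPoint b) = 1 := by
  rw [chartCoordZero, chartPoint, detForm_wedge']
  simp only [coord_inl_inl]
  simp

theorem chartCoordZero_chartTangent (b : Module.Basis (Fin 3 ⊕ α) ℂ V) (i : Fin 3) (a : α) :
    chartCoordZero b (chartTangent b i a) = 0 := by
  rw [chartCoordZero, chartTangent, detForm_wedge']
  fin_cases i <;> simp [coord_inl_inl, coord_inl_inr, -Module.Basis.coord_apply]

theorem chartCoord_chartPoint (b : Module.Basis (Fin 3 ⊕ α) ℂ V) (i : Fin 3) (a : α) :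
    chartCoord b i a (chartPoint b) = 0 := by
  rw [chartCoord, chartPoint, detForm_wedge']
  fin_cases i <;> simp [coord_inl_inl, coord_inr_inl, -Module.Basis.coord_apply]

theorem chartCoord_chartTangent [DecidableEq α] (b : Module.Basis (Fin 3 ⊕ α) ℂ V)
    (i j : Fin 3) (a c : α) :
    chartCoord b j c (chartTangent b i a) = if i = j ∧ a = c then 1 else 0 := by
  rw [chartCoord, chartTangent, detForm_wedge']
  fin_cases i <;> fin_cases j <;>
    simp [coord_inl_inl, coord_inr_inl, coord_inl_inr, coord_inr_inr, -Module.Basis.coord_apply]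

theorem chartPoint_ne_zero (b : Module.Basis (Fin 3 ⊕ α) ℂ V) : chartPoint b ≠ 0 := by
  intro h
  have := chartCoordZero_chartPoint b
  simp [h] at this

/-- The first Plücker coordinate is the determinant of the left 3×3 block m of the frame. When m is
invertible, m⁻¹ puts the frame in graph form without changing its span, and the wedge changes by det
m. -/
theorem exists_chartFrame [Fintype α] (b : Module.Basis (Fin 3 ⊕ α) ℂ V) (x : Fin 3 → V)
    (hx : chartCoordZero b (wedge x) ≠ 0) :
    ∃ A, wedge x = chartCoordZero b (wedge x) • wedge (chartFrame b 1 A) ∧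
      Submodule.span ℂ (Set.range x) = Submodule.span ℂ (Set.range (chartFrame b 1 A)) := by
  classical
  let m : Matrix (Fin 3) (Fin 3) ℂ := Matrix.of fun i j => b.coord (Sum.inl j) (x i)
  have hm : chartCoordZero b (wedge x) = m.det := detForm_wedge _ _
  rw [hm] at hx ⊢
  have hu : IsUnit m.det := isUnit_iff_ne_zero.2 hx
  let y : Fin 3 → V := fun i => ∑ k, m⁻¹ i k • x k
  have hxy : x = fun i => ∑ k, m i k • y k := by
    ext1 i
    simp only [y, Finset.smul_sum, smul_smul]
    rw [Finset.sum_comm]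
    simp only [← Finset.sum_smul]
    have : ∀ j, ∑ k, m i k * m⁻¹ k j = (1 : Matrix (Fin 3) (Fin 3) ℂ) i j := fun j => by
      rw [← Matrix.mul_nonsing_inv m hu]; rfl
    simp [this, Matrix.one_apply]
  have hy : y = chartFrame b 1 (fun i a => b.coord (Sum.inr a) (y i)) := by
    ext1 i
    apply b.ext_elem
    rintro (j | a)
    · have h1 := coord_inl_chartFrame b 1 (fun i a => b.coord (Sum.inr a) (y i)) i j
      rw [Module.Basis.coord_apply] at h1
      rw [h1]
      have : ∑ k, m⁻¹ i k * m k j = (1 : Matrix (Fin 3) (Fin 3) ℂ) i j := by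
        rw [← Matrix.nonsing_inv_mul m hu]; rfl
      simpa [y, m, Matrix.one_apply] using this
    · have h1 := coord_inr_chartFrame b 1 (fun i a => b.coord (Sum.inr a) (y i)) i a
      rw [Module.Basis.coord_apply] at h1
      rw [h1]; rfl
  refine ⟨fun i a => b.coord (Sum.inr a) (y i), ?_, ?_⟩
  · rw [← hy, ← wedge_matrix, ← hxy]
  · rw [← hy]
    apply le_antisymm <;> rw [Submodule.span_le] <;> rintro _ ⟨i, rfl⟩
    · rw [hxy]
      exact Submodule.sum_mem _ fun k _ => Submodule.smul_mem _ _ (Submodule.subset_span ⟨k, rfl⟩)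
    · exact Submodule.sum_mem _ fun k _ => Submodule.smul_mem _ _ (Submodule.subset_span ⟨k, rfl⟩)

/-- The nilpotent endomorphism of `V` with matrix `A` in a chart. -/
noncomputable def chartEnd [Fintype α] (b : Module.Basis (Fin 3 ⊕ α) ℂ V) :
    (Fin 3 → α → ℂ) →ₗ[ℂ] V →ₗ[ℂ] V where
  toFun A := b.constr ℂ (Sum.elim (fun i => ∑ a, A i a • b (Sum.inr a)) (fun _ => 0))
  map_add' A B := b.ext (by rintro (i | a) <;>
    simp [add_smul, Finset.sum_add_distrib, Module.Basis.constr_basis,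
      -Module.Basis.constr_apply_fintype])
  map_smul' c A := b.ext (by rintro (i | a) <;>
    simp [mul_smul, Finset.smul_sum, Module.Basis.constr_basis,
      -Module.Basis.constr_apply_fintype])

theorem chartEnd_inl [Fintype α] (b : Module.Basis (Fin 3 ⊕ α) ℂ V) (A : Fin 3 → α → ℂ)
    (i : Fin 3) : chartEnd b A (b (Sum.inl i)) = ∑ a, A i a • b (Sum.inr a) := by
  simp [chartEnd, Module.Basis.constr_basis, -Module.Basis.constr_apply_fintype]

theorem chartEnd_inr [Fintype α] (b : Module.Basis (Fin 3 ⊕ α) ℂ V) (A : Fin 3 → α → ℂ)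
    (a : α) : chartEnd b A (b (Sum.inr a)) = 0 := by
  simp [chartEnd, Module.Basis.constr_basis, -Module.Basis.constr_apply_fintype]

/-- Each of these maps kills the complement and has its image there. This makes 1 + C and 1 − C
mutually inverse. -/
theorem chartEnd_comp_self [Fintype α] (b : Module.Basis (Fin 3 ⊕ α) ℂ V) (A B : Fin 3 → α → ℂ) :
    chartEnd b A * chartEnd b B = 0 := by
  refine b.ext ?_
  rintro (i | a) <;> simp [chartEnd_inl, chartEnd_inr]

theorem chartFrame_eq [Fintype α] (b : Module.Basis (Fin 3 ⊕ α) ℂ V) (s : ℂ) (A : Fin 3 → α → ℂ)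
    (i : Fin 3) : chartFrame b s A i = s • b (Sum.inl i) + chartEnd b A (b (Sum.inl i)) := by
  rw [chartEnd_inl]; rfl

theorem sub_chartEnd_chartFrame [Fintype α] (b : Module.Basis (Fin 3 ⊕ α) ℂ V)
    (A : Fin 3 → α → ℂ) (i : Fin 3) :
    (1 - chartEnd b A) (chartFrame b 1 A i) = b (Sum.inl i) := by
  have := congrArg (fun f : V →ₗ[ℂ] V => f (b (Sum.inl i))) (chartEnd_comp_self b A A)
  simp only [Module.End.mul_apply, LinearMap.zero_apply] at this
  simp [chartFrame_eq, this]

theorem one_sub_mul_one_add_chartEnd [Fintype α] (b : Module.Basis (Fin 3 ⊕ α) ℂ V)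
    (A : Fin 3 → α → ℂ) : (1 + chartEnd b A) * (1 - chartEnd b A) = 1 := by
  have := chartEnd_comp_self b A A
  rw [mul_sub, add_mul, add_mul, this]; simp

/-- The forms vanishing on the affine tangent space at the centre of a chart. -/
noncomputable def conormal (b : Module.Basis (Fin 3 ⊕ α) ℂ V) :
    Submodule ℂ (Module.Dual ℂ (⋀[ℂ]^3 V)) where
  carrier := {τ | τ (chartPoint b) = 0 ∧ ∀ i a, τ (chartTangent b i a) = 0}
  add_mem' h h' := ⟨by simp [h.1, h'.1], fun i a => by simp [h.2, h'.2]⟩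
  zero_mem' := ⟨rfl, fun _ _ => rfl⟩
  smul_mem' c τ h := ⟨by simp [h.1], fun i a => by simp [h.2]⟩

/-- By linearity the free vector runs over the basis: a complementary vector gives a tangent vector
at the centre, the replaced vector itself gives the centre, and the other two give a repeated
factor. -/
theorem isTangentTo_iff_mem_conormal (b : Module.Basis (Fin 3 ⊕ α) ℂ V)
    (σ : Module.Dual ℂ (⋀[ℂ]^3 V)) :
    IsTangentTo (Submodule.span ℂ (Set.range fun i => b (Sum.inl i))) σ ↔ σ ∈ conormal b := by
  rw [isTangentTo_span_iff]
  constructor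
  · intro h
    refine ⟨?_, fun i a => h i _⟩
    have := h 0 (b (Sum.inl 0))
    rwa [Function.update_eq_self_iff.2 rfl] at this
  · intro h i
    have : σ ∘ₗ ((exteriorPower.ιMulti ℂ 3).toMultilinearMap.toLinearMap
        (fun i => b (Sum.inl i)) i) = 0 := by
      refine b.ext ?_
      rintro (j | a)
      · by_cases hij : j = i
        · subst hij
          have h1 := h.1
          rw [chartPoint] at h1
          simpa using h1
        · have : exteriorPower.ιMulti ℂ 3 (Function.update (fun i => b (Sum.inl i)) i
              (b (Sum.inl j))) = 0 :=
            (exteriorPower.ιMulti ℂ 3).map_eq_zero_of_eq _ (i := i) (j := j)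
              (by simp [Function.update_of_ne hij]) (Ne.symm hij)
          simp [this]
      · exact h.2 i a
    intro v
    exact congrArg (fun f => f v) this

/-- The chart coordinates are dual to the centre and its tangent vectors, so subtracting the
matching combination projects onto the conormal space. -/
theorem sub_mem_conormal [Fintype α] (b : Module.Basis (Fin 3 ⊕ α) ℂ V)
    (φ : Module.Dual ℂ (⋀[ℂ]^3 V)) :
    φ - (φ (chartPoint b) • chartCoordZero b +
      ∑ i, ∑ a, φ (chartTangent b i a) • chartCoord b i a) ∈ conormal b := by
  classical
  constructor
  · simp [chartCoordZero_chartPoint, chartCoord_chartPoint]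
  · intro j c
    simp [chartCoordZero_chartTangent, chartCoord_chartTangent, ite_and]

theorem eq_zero_of_chartCoord_eq_zero [Fintype α] (b : Module.Basis (Fin 3 ⊕ α) ℂ V)
    {z : ⋀[ℂ]^3 V} (h0 : chartCoordZero b z = 0) (h1 : ∀ i a, chartCoord b i a z = 0)
    (h2 : ∀ τ ∈ conormal b, τ z = 0) : z = 0 := by
  rw [← Module.forall_dual_apply_eq_zero_iff ℂ]
  intro φ
  have := h2 _ (sub_mem_conormal b φ)
  simpa [h0, h1] using this

/-- Dual trivectors in terms of a chart: the value at the centre, the values on tangent vectors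
and the part in the conormal space. -/
noncomputable def dualChartEquiv [Fintype α] (b : Module.Basis (Fin 3 ⊕ α) ℂ V) :
    Module.Dual ℂ (⋀[ℂ]^3 V) ≃ₗ[ℂ] ℂ × (Fin 3 → α → ℂ) × conormal b where
  toFun φ := (φ (chartPoint b), fun i a => φ (chartTangent b i a), ⟨_, sub_mem_conormal b φ⟩)
  map_add' φ ψ := by
    refine Prod.ext (by simp) (Prod.ext (by ext; simp) (Subtype.ext ?_))
    simp only [LinearMap.add_apply, add_smul, Finset.sum_add_distrib, Prod.mk_add_mk,
      Submodule.coe_add]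
    abel
  map_smul' c φ := by
    refine Prod.ext (by simp) (Prod.ext (by ext; simp) (Subtype.ext ?_))
    simp [smul_sub, smul_smul, Finset.smul_sum]
  invFun z := z.1 • chartCoordZero b + (∑ i, ∑ a, z.2.1 i a • chartCoord b i a) + z.2.2
  left_inv φ := by simp
  right_inv z := by
    classical
    obtain ⟨c, A, τ, hτ⟩ := z
    have h0 : ∀ φ : Module.Dual ℂ (⋀[ℂ]^3 V), φ = c • chartCoordZero b +
        (∑ i, ∑ a, A i a • chartCoord b i a) + τ → φ (chartPoint b) = c := by
      rintro φ rfl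
      simp [chartCoordZero_chartPoint, chartCoord_chartPoint, hτ.1]
    have h1 : ∀ φ : Module.Dual ℂ (⋀[ℂ]^3 V), φ = c • chartCoordZero b +
        (∑ i, ∑ a, A i a • chartCoord b i a) + τ → ∀ i a, φ (chartTangent b i a) = A i a := by
      rintro φ rfl i a
      simp [chartCoordZero_chartTangent, chartCoord_chartTangent, ite_and, hτ.2]
    refine Prod.ext (h0 _ rfl) (Prod.ext (by ext i a; exact h1 _ rfl i a) (Subtype.ext ?_))
    simp only [h0 _ rfl, h1 _ rfl]
    abel

theorem dualChartEquiv_symm_one [Fintype α] (b : Module.Basis (Fin 3 ⊕ α) ℂ V) :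
    (dualChartEquiv b).symm (1, 0) = chartCoordZero b := by
  simp [dualChartEquiv]

end Chart

/-! ### The Hessian of a conormal form and an explicit nondegenerate example. -/

section Hessian

variable {V : Type*} [AddCommGroup V] [Module ℂ V]

theorem lieAct_add (C D : V →ₗ[ℂ] V) : lieAct (C + D) = lieAct C + lieAct D := by
  apply linearMap_ext_wedge
  intro x
  simp only [lieAct_wedge, LinearMap.add_apply, AlternatingMap.map_update_add,
    Finset.sum_add_distrib]

theorem lieAct_smul (c : ℂ) (C : V →ₗ[ℂ] V) : lieAct (c • C) = c • lieAct C := by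
  apply linearMap_ext_wedge
  intro x
  simp only [lieAct_wedge, LinearMap.smul_apply, AlternatingMap.map_update_smul, Finset.smul_sum]

variable {α : Type*}

/-- The Hessian at the centre of a chart of the equation of a hyperplane section. -/
noncomputable def chartHessian [Fintype α] (b : Module.Basis (Fin 3 ⊕ α) ℂ V) (σ : Module.Dual ℂ (⋀[ℂ]^3 V)) :
    (Fin 3 → α → ℂ) →ₗ[ℂ] (Fin 3 → α → ℂ) where
  toFun A i a := σ (lieAct (chartEnd b A) (chartTangent b i a))
  map_add' A B := by ext i a; simp [lieAct_add]
  map_smul' c A := by ext i a; simp [lieAct_smul]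

theorem chartHessian_apply [Fintype α] (b : Module.Basis (Fin 3 ⊕ α) ℂ V) (σ : Module.Dual ℂ (⋀[ℂ]^3 V))
    (A : Fin 3 → α → ℂ) (i : Fin 3) (a : α) :
    chartHessian b σ A i a = σ (lieAct (chartEnd b A) (chartTangent b i a)) := rfl

theorem chartHessian_add_smul [Fintype α] (b : Module.Basis (Fin 3 ⊕ α) ℂ V)
    (σ τ : Module.Dual ℂ (⋀[ℂ]^3 V)) (s : ℂ) :
    chartHessian b (σ + s • τ) = chartHessian b σ + s • chartHessian b τ := by
  ext A i a; simp [chartHessian_apply]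

/-- The determinantal form coupling the `k`-th vector of the centre with two complementary
directions. -/
noncomputable def couplingForm (b : Module.Basis (Fin 3 ⊕ α) ℂ V) (k : Fin 3) (p q : α) :
    Module.Dual ℂ (⋀[ℂ]^3 V) :=
  detForm ![b.coord (Sum.inl k), b.coord (Sum.inr p), b.coord (Sum.inr q)]

theorem couplingForm_mem_conormal (b : Module.Basis (Fin 3 ⊕ α) ℂ V) (k : Fin 3) (p q : α) :
    couplingForm b k p q ∈ conormal b := by
  classical
  constructor
  · simp [couplingForm, chartPoint, detForm_wedge', coord_inr_inl, -Module.Basis.coord_apply]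
  · intro i a
    rw [couplingForm, chartTangent, detForm_wedge']
    fin_cases i <;> simp [coord_inr_inl, -Module.Basis.coord_apply]

theorem coord_inl_chartEnd [Fintype α] (b : Module.Basis (Fin 3 ⊕ α) ℂ V) (A : Fin 3 → α → ℂ) (i j : Fin 3) :
    b.coord (Sum.inl j) (chartEnd b A (b (Sum.inl i))) = 0 := by
  simp [chartEnd_inl]

theorem coord_inr_chartEnd [Fintype α] (b : Module.Basis (Fin 3 ⊕ α) ℂ V) (A : Fin 3 → α → ℂ) (i : Fin 3)
    (a : α) : b.coord (Sum.inr a) (chartEnd b A (b (Sum.inl i))) = A i a := by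
  classical
  simp [chartEnd_inl, Finsupp.single_apply]

/-- In the chart the quadratic part of the coupling form is the 2×2 minor of A on rows k + 1, k + 2
(cyclically in `Fin 3`) and columns p, q; these are its partial derivatives. -/
theorem couplingForm_lieAct_next [Fintype α] [DecidableEq α] (b : Module.Basis (Fin 3 ⊕ α) ℂ V) (k : Fin 3)
    (p q : α) (A : Fin 3 → α → ℂ) (a : α) :
    couplingForm b k p q (lieAct (chartEnd b A) (chartTangent b (k + 1) a)) =
      (if a = p then 1 else 0) * A (k + 2) q - (if a = q then 1 else 0) * A (k + 2) p := by
  rw [couplingForm, chartTangent, lieAct_wedge, map_sum, Fin.sum_univ_three]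
  simp only [detForm_wedge']
  fin_cases k <;> simp [coord_inl_inl, coord_inr_inl, coord_inl_inr, coord_inr_inr,
    coord_inl_chartEnd, coord_inr_chartEnd, chartEnd_inr, -Module.Basis.coord_apply]
  all_goals ring

theorem couplingForm_lieAct_prev [Fintype α] [DecidableEq α] (b : Module.Basis (Fin 3 ⊕ α) ℂ V) (k : Fin 3)
    (p q : α) (A : Fin 3 → α → ℂ) (a : α) :
    couplingForm b k p q (lieAct (chartEnd b A) (chartTangent b (k + 2) a)) =
      (if a = q then 1 else 0) * A (k + 1) p - (if a = p then 1 else 0) * A (k + 1) q := by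
  rw [couplingForm, chartTangent, lieAct_wedge, map_sum, Fin.sum_univ_three]
  simp only [detForm_wedge']
  fin_cases k <;> simp [coord_inl_inl, coord_inr_inl, coord_inl_inr, coord_inr_inr,
    coord_inl_chartEnd, coord_inr_chartEnd, chartEnd_inr, -Module.Basis.coord_apply]
  all_goals ring

theorem couplingForm_lieAct_self [Fintype α] [DecidableEq α] (b : Module.Basis (Fin 3 ⊕ α) ℂ V) (k : Fin 3)
    (p q : α) (A : Fin 3 → α → ℂ) (a : α) :
    couplingForm b k p q (lieAct (chartEnd b A) (chartTangent b k a)) = 0 := by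
  rw [couplingForm, chartTangent, lieAct_wedge, map_sum, Fin.sum_univ_three]
  simp only [detForm_wedge']
  fin_cases k <;> simp [coord_inl_inl, coord_inr_inl, coord_inl_inr, coord_inr_inr,
    coord_inl_chartEnd, coord_inr_chartEnd, chartEnd_inr, -Module.Basis.coord_apply]

/-- A form in the conormal space with nondegenerate Hessian. -/
noncomputable def morseForm (b : Module.Basis (Fin 3 ⊕ Fin 7) ℂ V) :
    Module.Dual ℂ (⋀[ℂ]^3 V) :=
  -- The terms separate the columns {0, 1, 2} from {3, 4, 5, 6}. On the first block the quadratic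
  -- part is the sum of the principal 2×2 minors of a 3×3 matrix, with nondegenerate polar form tr A
  -- tr B − tr AB. The last four terms are chosen to give a nondegenerate form in the twelve
  -- remaining variables.
  couplingForm b 2 0 1 + couplingForm b 0 1 2 + couplingForm b 1 2 0 + couplingForm b 2 3 4 +
    couplingForm b 0 5 6 + couplingForm b 1 3 5 + couplingForm b 1 4 6

theorem morseForm_mem_conormal (b : Module.Basis (Fin 3 ⊕ Fin 7) ℂ V) :
    morseForm b ∈ conormal b := by
  refine add_mem (add_mem (add_mem (add_mem (add_mem (add_mem ?_ ?_) ?_) ?_) ?_) ?_) ?_ <;>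
    exact couplingForm_mem_conormal _ _ _ _

/-- The kernel is given by 21 sparse linear equations in the 21 entries of A, and elimination leaves
only zero. -/
theorem injective_chartHessian_morseForm (b : Module.Basis (Fin 3 ⊕ Fin 7) ℂ V) :
    Function.Injective (chartHessian b (morseForm b)) := by
  rw [injective_iff_map_eq_zero]
  intro A hA
  have h : ∀ i a, morseForm b (lieAct (chartEnd b A) (chartTangent b i a)) = 0 := fun i a =>
    congrFun (congrFun hA i) a
  simp only [morseForm, LinearMap.add_apply] at h
  have h0 := h 0
  have h1 := h 1
  have h2 := h 2
  have n0 := fun p q a => couplingForm_lieAct_next b 0 p q A a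
  have n1 := fun p q a => couplingForm_lieAct_next b 1 p q A a
  have n2 := fun p q a => couplingForm_lieAct_next b 2 p q A a
  have p0 := fun p q a => couplingForm_lieAct_prev b 0 p q A a
  have p1 := fun p q a => couplingForm_lieAct_prev b 1 p q A a
  have p2 := fun p q a => couplingForm_lieAct_prev b 2 p q A a
  simp only [Fin.isValue, Fin.reduceAdd] at n0 n1 n2 p0 p1 p2
  simp only [couplingForm_lieAct_self, n0, n1, n2, p0, p1, p2] at h0 h1 h2
  have e := fun a => And.intro (h0 a) (And.intro (h1 a) (h2 a))
  clear h0 h1 h2 n0 n1 n2 p0 p1 p2 h hA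
  have e0 := e 0
  have e1 := e 1
  have e2 := e 2
  have e3 := e 3
  have e4 := e 4
  have e5 := e 5
  have e6 := e 6
  clear e
  simp at e0 e1 e2 e3 e4 e5 e6
  ext i a
  fin_cases i <;> fin_cases a <;> simp <;> grind

end Hessian

/-! ### Homogeneity of the generator and derivatives of polynomial curves. -/

section Homogeneity

variable {M : Type*} [AddCommGroup M] [Module ℂ M]

theorem polynomial_eq_C_of_forall_ne_zero {p : Polynomial ℂ} (h : ∀ t, p.eval t ≠ 0) :
    ∃ c, p = Polynomial.C c := by
  by_contra! hc
  have hd : p.degree ≠ 0 := fun hd => hc _ (Polynomial.eq_C_of_degree_eq_zero hd)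
  obtain ⟨t, ht⟩ := IsAlgClosed.exists_root p hd
  exact h t ht

theorem polyFun_eq_of_forall_ne_zero {f : M → ℂ} (hf : f ∈ polyFun M) (h : ∀ v, f v ≠ 0)
    (v w : M) : f v = f w := by
  obtain ⟨p, hp⟩ := exists_polynomial_of_mem_polyFun ((isPolyMap_line v (w - v)).comp_mem hf)
  obtain ⟨c, rfl⟩ := polynomial_eq_C_of_forall_ne_zero (p := p) fun t => by rw [← hp]; exact h _
  have h0 := hp 0
  have h1 := hp 1
  simp only [zero_smul, add_zero, one_smul, add_sub_cancel, Polynomial.eval_C] at h0 h1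
  rw [h0, h1]

theorem isForm_of_forall_smul {f : M → ℂ} (hf : f ∈ polyFun M) {d : ℕ}
    (h : ∀ t : ℂ, t ≠ 0 → ∀ v, f (t • v) = t ^ d * f v) : IsForm d f := by
  refine ⟨hf, fun t v => ?_⟩
  have h1 : (fun s : ℂ => f (s • v) - s ^ d * f v) ∈ polyFun ℂ := by
    refine sub_mem_polyFun ?_ (mul_mem_polyFun (pow_mem_polyFun id_mem_polyFun d)
      (const_mem_polyFun _))
    simpa using (isPolyMap_line (0 : M) v).comp_mem hf
  exact sub_eq_zero.1 (polyFun_line_eq_zero_of_finite h1 (Set.finite_singleton 0)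
    (fun s hs => sub_eq_zero.2 (h s hs v)) t)

/-- A generator of the ideal of a cone is homogeneous. -/
theorem exists_isForm_of_generator {S : Set M} (hS : ∀ t : ℂ, ∀ v ∈ S, t • v ∈ S)
    (h0 : (0 : M) ∈ S) {f : M → ℂ} (hf : f ∈ polyFun M) (hfS : ∀ v ∈ S, f v = 0)
    (hgen : ∀ g ∈ polyFun M, (∀ v ∈ S, g v = 0) → ∃ h ∈ polyFun M, ∀ v, g v = f v * h v)
    {v₀ : M} (hv₀ : f v₀ ≠ 0) : ∃ d, 0 < d ∧ IsForm d f := by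
  have hscale : ∀ (t : ℂ) (g : M → ℂ), g ∈ polyFun M → (fun v => g (t • v)) ∈ polyFun M :=
    fun t g hg => (isPolyMap_linear (t • (LinearMap.id : M →ₗ[ℂ] M))).comp_mem hg
  -- Every dilate of f vanishes on the cone, hence is a multiple of f.
  choose h hh hfh using fun t : ℂ => hgen _ (hscale t f hf) fun v hv => hfS _ (hS t v hv)
  -- Dilating by t and then by t⁻¹ and cancelling f shows that the cofactor has no zeros, so it is
  -- constant in v.
  have hinv : ∀ t : ℂ, t ≠ 0 → ∀ v, h t v * h t⁻¹ (t • v) = 1 := by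
    intro t ht
    have := polyFun_eq_zero_or hf (sub_mem_polyFun (mul_mem_polyFun (hh t) (hscale t _ (hh t⁻¹)))
      (const_mem_polyFun 1)) fun v => by
        have h2 := hfh t⁻¹ (t • v)
        rw [smul_smul, inv_mul_cancel₀ ht, one_smul, hfh] at h2
        linear_combination -h2
    rcases this with h1 | h1
    · exact absurd (h1 v₀) hv₀
    · exact fun v => sub_eq_zero.1 (h1 v)
  have hconst : ∀ t : ℂ, t ≠ 0 → ∀ v, f (t • v) = f v * h t v₀ := by
    intro t ht v
    rw [hfh, polyFun_eq_of_forall_ne_zero (hh t) (fun w => left_ne_zero_of_mul_eq_one (hinv t ht w))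
      v v₀]
  have hline : (fun t : ℂ => f (t • v₀)) ∈ polyFun ℂ := by
    simpa using (isPolyMap_line (0 : M) v₀).comp_mem hf
  obtain ⟨p, hp⟩ := exists_polynomial_of_mem_polyFun hline
  have hp1 : p.eval 1 = f v₀ := by rw [← hp, one_smul]
  have hp0 : p ≠ 0 := by rintro rfl; simp at hp1; exact hv₀ hp1.symm
  -- On the line of v₀ the function f has no zero except possibly at the origin, so it is a constant
  -- times t ^ d, with d the multiplicity of the root 0.
  obtain ⟨q, hq, hq0⟩ := Polynomial.exists_eq_pow_rootMultiplicity_mul_and_not_dvd p hp0 0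
  set d := p.rootMultiplicity 0
  rw [map_zero, sub_zero] at hq hq0
  have hpt : ∀ t : ℂ, t ≠ 0 → p.eval t ≠ 0 := by
    intro t ht
    rw [← hp, hconst t ht]
    exact mul_ne_zero hv₀ (left_ne_zero_of_mul_eq_one (hinv t ht v₀))
  obtain ⟨c, rfl⟩ := polynomial_eq_C_of_forall_ne_zero (p := q) fun t => by
    by_cases ht : t = 0
    · subst ht
      rwa [Ne, ← Polynomial.IsRoot, ← Polynomial.dvd_iff_isRoot, map_zero, sub_zero]
    · have := hpt t ht
      rw [hq, Polynomial.eval_mul] at this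
      exact right_ne_zero_of_mul this
  have hform : IsForm d f := isForm_of_forall_smul hf fun t ht v => by
    have h1 : f v₀ * h t v₀ = t ^ d * f v₀ := by
      rw [← hconst t ht, ← hp1, hp, hq]; simp; ring
    have h2 : h t v₀ = t ^ d := mul_left_cancel₀ hv₀ (by rw [h1, mul_comm])
    rw [hconst t ht, h2, mul_comm]
  -- In degree zero, f v₀ would equal f 0, which vanishes.
  refine ⟨d, Nat.pos_of_ne_zero fun hd => hv₀ ?_, hform⟩
  have := hform.2 0 v₀
  rw [hd, pow_zero, one_mul, zero_smul, hfS 0 h0] at this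
  exact this.symm

theorem isForm_lineDeriv {d : ℕ} {f : M → ℂ} (hf : IsForm d f) (hd : 0 < d) (w : M) :
    IsForm (d - 1) (fun v => lineDeriv ℂ f v w) := by
  refine isForm_of_forall_smul (lineDeriv_mem_polyFun hf.1 w) fun t ht v => ?_
  obtain ⟨D, hD, -, hD'⟩ := exists_differential hf.1
  have h1 := (hD' (fun s : ℂ => t • v + s • (t • w)) (t • w) 0 (hasWeakDerivAt_line _ _ _))
  have h2 := (hD' (fun s : ℂ => v + s • w) w 0 (hasWeakDerivAt_line _ _ _)).const_mul (t ^ d)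
  have h3 : (fun s : ℂ => f (t • v + s • (t • w))) = fun s => t ^ d * f (v + s • w) := by
    ext s; rw [← hf.2]; congr 1; module
  rw [h3] at h1
  have h4 := h1.unique h2
  simp only [zero_smul, add_zero, map_smul, smul_eq_mul] at h4
  rw [hD, hD]
  refine mul_left_cancel₀ ht ?_
  rw [h4, ← mul_assoc, ← pow_succ', Nat.sub_add_cancel hd]

theorem lineDeriv_self_of_isForm {d : ℕ} {f : M → ℂ} (hf : IsForm d f) {v : M} (hv : f v = 0) :
    lineDeriv ℂ f v v = 0 := by
  have : (fun t : ℂ => f (v + t • v)) = fun _ => 0 := by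
    ext t
    rw [show v + t • v = (1 + t) • v by module, hf.2, hv, mul_zero]
  rw [lineDeriv, this, deriv_const]

/-- Transport by ⋀³(1 ± tC) is cubic in t, and a conormal form moving linearly with t raises the
degree to four. -/
theorem hasWeakDerivAt_quartic (a₀ a₁ a₂ a₃ a₄ : M) :
    HasWeakDerivAt (fun t : ℂ => a₀ + t • a₁ + t ^ 2 • a₂ + t ^ 3 • a₃ + t ^ 4 • a₄) a₁ 0 := by
  intro l
  have h := ((((hasDerivAt_id (0 : ℂ)).mul_const (l a₁)).const_add (l a₀)).add
    (((hasDerivAt_id (0 : ℂ)).pow 2).mul_const (l a₂))).add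
    ((((hasDerivAt_id (0 : ℂ)).pow 3).mul_const (l a₃)).add
    (((hasDerivAt_id (0 : ℂ)).pow 4).mul_const (l a₄)))
  refine (h.congr_deriv (by simp)).congr_of_eventuallyEq (Filter.Eventually.of_forall fun t => ?_)
  simp
  ring

end Homogeneity

/-! ### The cone of tangent forms and its parametrization over a chart. -/

section TangentCone

variable {V : Type*} [AddCommGroup V] [Module ℂ V]

/-- The cone of trivector forms tangent to the Grassmannian somewhere. -/
def tangentCone (V : Type*) [AddCommGroup V] [Module ℂ V] : Set (Module.Dual ℂ (⋀[ℂ]^3 V)) :=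
  {σ | ∃ W : Submodule ℂ V, Module.finrank ℂ W = 3 ∧ IsTangentTo W σ}

theorem linearIndependent_of_wedge_ne_zero {x : Fin 3 → V} (h : wedge x ≠ 0) :
    LinearIndependent ℂ x := by
  by_contra hc
  exact h ((exteriorPower.ιMulti ℂ 3).map_linearDependent x hc)

theorem finrank_span_of_linearIndependent {x : Fin 3 → V} (h : LinearIndependent ℂ x) :
    Module.finrank ℂ (Submodule.span ℂ (Set.range x)) = 3 := by
  simpa using finrank_span_eq_card h

theorem exists_basis_extending (hV : Module.finrank ℂ V = 10) {w : Fin 3 → V}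
    (hw : LinearIndependent ℂ w) :
    ∃ b : Module.Basis (Fin 3 ⊕ Fin 7) ℂ V, (fun i => b (Sum.inl i)) = w := by
  have : FiniteDimensional ℂ V := Module.finite_of_finrank_pos (by omega)
  let b := Module.Basis.sumExtend hw
  have hfin : Finite (Fin 3 ⊕ Module.Basis.sumExtendIndex hw) := Module.Finite.finite_basis b
  have : Finite (Module.Basis.sumExtendIndex hw) :=
    Finite.of_injective (Sum.inr : _ → Fin 3 ⊕ Module.Basis.sumExtendIndex hw) Sum.inr_injective
  let _ := Fintype.ofFinite (Module.Basis.sumExtendIndex hw)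
  have hc := Module.finrank_eq_card_basis b
  have hc' : Fintype.card (Module.Basis.sumExtendIndex hw) = 7 := by
    rw [hV] at hc
    simp only [Fintype.card_sum, Fintype.card_fin] at hc
    omega
  refine ⟨b.reindex (Equiv.sumCongr (Equiv.refl _) (Fintype.equivFinOfCardEq hc')), ?_⟩
  ext i
  simp [b, Module.Basis.sumExtend]
  rfl

theorem exists_basis_of_finrank_eq_three (hV : Module.finrank ℂ V = 10) {W : Submodule ℂ V}
    (hW : Module.finrank ℂ W = 3) : ∃ b : Module.Basis (Fin 3 ⊕ Fin 7) ℂ V,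
      Submodule.span ℂ (Set.range fun i => b (Sum.inl i)) = W := by
  have : FiniteDimensional ℂ W := Module.finite_of_finrank_pos (by omega)
  let w := Module.finBasisOfFinrankEq ℂ W hW
  obtain ⟨b, hb⟩ := exists_basis_extending hV (w := fun i => (w i : V))
    (w.linearIndependent.map' W.subtype (Submodule.ker_subtype W))
  refine ⟨b, ?_⟩
  rw [hb, show (fun i => (w i : V)) = W.subtype ∘ w from rfl, Set.range_comp,
    ← Submodule.map_span, w.span_eq, Submodule.map_top, Submodule.range_subtype]

variable {α : Type*}

theorem linearIndependent_chartFrame [Fintype α] (b : Module.Basis (Fin 3 ⊕ α) ℂ V)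
    (A : Fin 3 → α → ℂ) : LinearIndependent ℂ (chartFrame b 1 A) := by
  refine linearIndependent_of_wedge_ne_zero fun h => ?_
  have := chartCoordZero_chartFrame b 1 A
  simp [h] at this

theorem chartFrame_one_zero [Fintype α] (b : Module.Basis (Fin 3 ⊕ α) ℂ V) :
    chartFrame b 1 0 = fun i => b (Sum.inl i) := by
  ext i; simp [chartFrame]

theorem conormal_le_tangentCone (b : Module.Basis (Fin 3 ⊕ α) ℂ V)
    {σ : Module.Dual ℂ (⋀[ℂ]^3 V)} (h : σ ∈ conormal b) : σ ∈ tangentCone V :=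
  ⟨_, finrank_span_of_linearIndependent (b.linearIndependent.comp _ Sum.inl_injective),
    (isTangentTo_iff_mem_conormal b σ).2 h⟩

/-- Transport of a conormal form to the point of the chart with affine coordinates `A`. -/
noncomputable def conormalMap [Fintype α] (b : Module.Basis (Fin 3 ⊕ α) ℂ V) (A : Fin 3 → α → ℂ)
    (τ : Module.Dual ℂ (⋀[ℂ]^3 V)) : Module.Dual ℂ (⋀[ℂ]^3 V) :=
  τ ∘ₗ exteriorPower.map 3 (1 - chartEnd b A)

/-- The map 1 − C carries the graph of A back to the centre of the chart, where τ is tangent. -/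
theorem isTangentTo_conormalMap [Fintype α] (b : Module.Basis (Fin 3 ⊕ α) ℂ V)
    (A : Fin 3 → α → ℂ) {τ : Module.Dual ℂ (⋀[ℂ]^3 V)} (hτ : τ ∈ conormal b) :
    IsTangentTo (Submodule.span ℂ (Set.range (chartFrame b 1 A))) (conormalMap b A τ) := by
  refine ((isTangentTo_iff_mem_conormal b τ).2 hτ).comp_map ?_
  intro w hw
  have : Submodule.span ℂ (Set.range (chartFrame b 1 A)) ≤
      (Submodule.span ℂ (Set.range fun i => b (Sum.inl i))).comap (1 - chartEnd b A) := by
    rw [Submodule.span_le]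
    rintro _ ⟨i, rfl⟩
    rw [SetLike.mem_coe, Submodule.mem_comap, sub_chartEnd_chartFrame]
    exact Submodule.subset_span ⟨i, rfl⟩
  exact this hw

theorem conormalMap_mem_tangentCone [Fintype α] (b : Module.Basis (Fin 3 ⊕ α) ℂ V)
    (A : Fin 3 → α → ℂ) {τ : Module.Dual ℂ (⋀[ℂ]^3 V)} (hτ : τ ∈ conormal b) :
    conormalMap b A τ ∈ tangentCone V :=
  ⟨_, finrank_span_of_linearIndependent (linearIndependent_chartFrame b A),
    isTangentTo_conormalMap b A hτ⟩

theorem exists_conormalMap_eq [Fintype α] (b : Module.Basis (Fin 3 ⊕ α) ℂ V)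
    (A : Fin 3 → α → ℂ) {σ : Module.Dual ℂ (⋀[ℂ]^3 V)}
    (hσ : IsTangentTo (Submodule.span ℂ (Set.range (chartFrame b 1 A))) σ) :
    ∃ τ ∈ conormal b, conormalMap b A τ = σ := by
  refine ⟨σ ∘ₗ exteriorPower.map 3 (1 + chartEnd b A), ?_, ?_⟩
  · rw [← isTangentTo_iff_mem_conormal]
    refine hσ.comp_map ?_
    intro w hw
    have : (Submodule.span ℂ (Set.range fun i => b (Sum.inl i))) ≤
        (Submodule.span ℂ (Set.range (chartFrame b 1 A))).comap (1 + chartEnd b A) := by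
      rw [Submodule.span_le]
      rintro _ ⟨i, rfl⟩
      refine Submodule.subset_span ⟨i, ?_⟩
      simp [chartFrame_eq]
    exact this hw
  · rw [conormalMap, LinearMap.comp_assoc, ← exteriorPower.map_comp, ← Module.End.mul_eq_comp,
      one_sub_mul_one_add_chartEnd, Module.End.one_eq_id, exteriorPower.map_id, LinearMap.comp_id]

theorem conormalMap_neg_smul [Fintype α] (b : Module.Basis (Fin 3 ⊕ α) ℂ V) (A : Fin 3 → α → ℂ)
    (τ : Module.Dual ℂ (⋀[ℂ]^3 V)) (t : ℂ) :
    conormalMap b (-(t • A)) τ = τ + t • (τ ∘ₗ lieAct (chartEnd b A)) +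
      t ^ 2 • (τ ∘ₗ lieAct₂ (chartEnd b A)) +
      t ^ 3 • (τ ∘ₗ exteriorPower.map 3 (chartEnd b A)) := by
  rw [conormalMap, map_neg, map_smul, sub_neg_eq_add, map_one_add_smul]
  simp only [LinearMap.comp_add, LinearMap.comp_smul]
  rfl

theorem isPolyMap_conormalMap [FiniteDimensional ℂ V] [Fintype α]
    (b : Module.Basis (Fin 3 ⊕ α) ℂ V) {Y : Type*} [AddCommGroup Y] [Module ℂ Y]
    {A : Y → Fin 3 → α → ℂ} {τ : Y → Module.Dual ℂ (⋀[ℂ]^3 V)} (hA : IsPolyMap A)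
    (hτ : IsPolyMap τ) : IsPolyMap (fun y => conormalMap b (A y) (τ y)) := by
  refine isPolyMap_dual fun n => hτ.dual_apply (n := fun y =>
    exteriorPower.map 3 (1 - chartEnd b (A y)) n) (isPolyMap_map (fun v => ?_) (isPolyMap_const n))
  exact (isPolyMap_const v).sub (hA.linear_comp ((chartEnd b).flip v))

theorem lieAct_chartPoint [Fintype α] (b : Module.Basis (Fin 3 ⊕ α) ℂ V) (A : Fin 3 → α → ℂ) :
    lieAct (chartEnd b A) (chartPoint b) = ∑ i, ∑ a, A i a • chartTangent b i a := by
  rw [chartPoint, lieAct_wedge]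
  refine Finset.sum_congr rfl fun i _ => ?_
  rw [chartEnd_inl]
  refine ((exteriorPower.ιMulti ℂ 3).toMultilinearMap.map_update_sum _ _ _ _).trans
    (Finset.sum_congr rfl fun a _ => ?_)
  exact (exteriorPower.ιMulti ℂ 3).toMultilinearMap.map_update_smul _ _ _ _

theorem isTangentTo_smul {W : Submodule ℂ V} {σ : Module.Dual ℂ (⋀[ℂ]^3 V)}
    (h : IsTangentTo W σ) (t : ℂ) : IsTangentTo W (t • σ) := fun x hx y hy v => by
  rw [LinearMap.smul_apply, h x hx y hy v, smul_zero]

theorem smul_mem_tangentCone (t : ℂ) {σ : Module.Dual ℂ (⋀[ℂ]^3 V)} (h : σ ∈ tangentCone V) :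
    t • σ ∈ tangentCone V :=
  let ⟨W, hW, hσ⟩ := h
  ⟨W, hW, isTangentTo_smul hσ t⟩

end TangentCone

/-! ### The equation of the tangent cone and its differential. -/

section DualEquation

variable {V : Type*} [AddCommGroup V] [Module ℂ V]

/-- The exceptional s are negatives of eigenvalues of g⁻¹ ∘ f. -/
theorem finite_not_injective_add_smul {E : Type*} [AddCommGroup E] [Module ℂ E]
    [FiniteDimensional ℂ E] (f g : E →ₗ[ℂ] E) (hg : Function.Injective g) :
    {s : ℂ | ¬ Function.Injective (f + s • g)}.Finite := by
  let e := LinearEquiv.ofInjectiveEndo g hg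
  have hT := (Module.End.finite_hasEigenvalue (e.symm.toLinearMap ∘ₗ f)).image (fun x => -x)
  refine hT.subset fun s hs => ⟨-s, ?_, neg_neg s⟩
  rw [Set.mem_ofPred_eq, injective_iff_map_eq_zero] at hs
  push Not at hs
  obtain ⟨v, hv, hv0⟩ := hs
  refine Module.End.hasEigenvalue_of_hasEigenvector (x := v) ⟨?_, hv0⟩
  rw [Module.End.mem_eigenspace_iff]
  apply e.injective
  have h1 : f v = -(s • g v) := eq_neg_of_add_eq_zero_left hv
  have h2 : e v = g v := rfl
  simp [h1, h2]

theorem conormalMap_zero {α : Type*} [Fintype α] (b : Module.Basis (Fin 3 ⊕ α) ℂ V)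
    (τ : Module.Dual ℂ (⋀[ℂ]^3 V)) : conormalMap b 0 τ = τ := by
  simp [conormalMap, Module.End.one_eq_id, exteriorPower.map_id]

/-- Here f = 0 is differentiated while the point of tangency moves in direction A. -/
theorem lineDeriv_lieAct_eq_zero {α : Type*} [Fintype α] {f : Module.Dual ℂ (⋀[ℂ]^3 V) → ℂ}
    (hf : f ∈ polyFun (Module.Dual ℂ (⋀[ℂ]^3 V))) (hfS : ∀ σ ∈ tangentCone V, f σ = 0)
    (b : Module.Basis (Fin 3 ⊕ α) ℂ V) {σ : Module.Dual ℂ (⋀[ℂ]^3 V)} (hσ : σ ∈ conormal b)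
    (A : Fin 3 → α → ℂ) : lineDeriv ℂ f σ (σ ∘ₗ lieAct (chartEnd b A)) = 0 := by
  obtain ⟨D, hD, -, hD'⟩ := exists_differential hf
  have hγ : HasWeakDerivAt (fun t : ℂ => conormalMap b (-(t • A)) σ)
      (σ ∘ₗ lieAct (chartEnd b A)) 0 := by
    simpa only [conormalMap_neg_smul, smul_zero, add_zero] using
      hasWeakDerivAt_quartic σ (σ ∘ₗ lieAct (chartEnd b A)) (σ ∘ₗ lieAct₂ (chartEnd b A))
        (σ ∘ₗ exteriorPower.map 3 (chartEnd b A)) 0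
  have h1 := hD' _ _ _ hγ
  have h2 : (fun t : ℂ => f (conormalMap b (-(t • A)) σ)) = fun _ => 0 :=
    funext fun t => hfS _ (conormalMap_mem_tangentCone b _ hσ)
  rw [h2] at h1
  have h3 := h1.unique (hasDerivAt_const _ _)
  rw [hD]
  simpa [conormalMap_zero] using h3

/-- Here the point of tangency stays fixed and σ moves inside the linear conormal space. -/
theorem lineDeriv_conormal_eq_zero {α : Type*} {f : Module.Dual ℂ (⋀[ℂ]^3 V) → ℂ}
    (hfS : ∀ σ ∈ tangentCone V, f σ = 0) (b : Module.Basis (Fin 3 ⊕ α) ℂ V)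
    {σ φ : Module.Dual ℂ (⋀[ℂ]^3 V)} (hσ : σ ∈ conormal b) (hφ : φ ∈ conormal b) :
    lineDeriv ℂ f σ φ = 0 := by
  have : (fun t : ℂ => f (σ + t • φ)) = fun _ => 0 := funext fun t =>
    hfS _ (conormal_le_tangentCone b (add_mem hσ (Submodule.smul_mem _ _ hφ)))
  rw [lineDeriv, this, deriv_const]

/-- The differential of an equation of the dual variety at a form tangent to the Grassmannian
is a multiple of the evaluation at the point of tangency. -/
theorem lineDeriv_eq_zero_of_apply_chartPoint {f : Module.Dual ℂ (⋀[ℂ]^3 V) → ℂ}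
    (hf : f ∈ polyFun (Module.Dual ℂ (⋀[ℂ]^3 V))) (hfS : ∀ σ ∈ tangentCone V, f σ = 0)
    (b : Module.Basis (Fin 3 ⊕ Fin 7) ℂ V) {σ φ : Module.Dual ℂ (⋀[ℂ]^3 V)}
    (hσ : σ ∈ conormal b) (hφ : φ (chartPoint b) = 0) : lineDeriv ℂ f σ φ = 0 := by
  -- If the Hessian is invertible, some A makes σ ∘ `lieAct` agree with φ on the tangent vectors at
  -- the centre. The difference is conormal, since both vanish at the centre, and both pieces are
  -- killed by the differential.
  have key : ∀ σ ∈ conormal b, Function.Injective (chartHessian b σ) → lineDeriv ℂ f σ φ = 0 := by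
    intro σ hσ hinj
    obtain ⟨D, hD, -, -⟩ := exists_differential hf
    obtain ⟨A, hA⟩ := (LinearMap.injective_iff_surjective.1 hinj)
      (fun i a => φ (chartTangent b i a))
    have h1 := lineDeriv_lieAct_eq_zero hf hfS b hσ A
    have h2 : φ - σ ∘ₗ lieAct (chartEnd b A) ∈ conormal b := by
      constructor
      · rw [LinearMap.sub_apply, hφ, LinearMap.comp_apply, lieAct_chartPoint]
        simp [hσ.2]
      · intro i a
        rw [LinearMap.sub_apply, LinearMap.comp_apply, ← chartHessian_apply, hA, sub_self]
    have h3 := lineDeriv_conormal_eq_zero hfS b hσ h2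
    rw [hD] at h1 h3 ⊢
    rwa [map_sub, h1, sub_zero] at h3
  -- For an arbitrary σ, adding s times `morseForm` makes the Hessian invertible for all but
  -- finitely many s, and the derivative is polynomial in s.
  have hline := (isPolyMap_line σ (morseForm b)).comp_mem (lineDeriv_mem_polyFun hf φ)
  have := polyFun_line_eq_zero_of_finite hline
    (finite_not_injective_add_smul (chartHessian b σ) (chartHessian b (morseForm b))
      (injective_chartHessian_morseForm b)) (fun s hs => by
        refine key _ (add_mem hσ (Submodule.smul_mem _ _ (morseForm_mem_conormal b))) ?_
        rw [chartHessian_add_smul]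
        simpa using hs) 0
  simpa using this

/-- Along the segment of frames joining the two centres, each of the two leading Plücker coordinates
is a nonzero polynomial, so they are simultaneously nonzero somewhere. -/
theorem exists_common_chart (b b' : Module.Basis (Fin 3 ⊕ Fin 7) ℂ V) :
    ∃ A, chartCoordZero b (wedge (chartFrame b' 1 A)) ≠ 0 := by
  have : FiniteDimensional ℂ V := Module.Finite.of_basis b
  have hz : IsPolyMap (fun t : ℂ => wedge (fun i => b' (Sum.inl i) +
      t • (b (Sum.inl i) - b' (Sum.inl i)))) := isPolyMap_wedge fun i => isPolyMap_line _ _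
  obtain ⟨t, ht⟩ : ∃ t : ℂ, chartCoordZero b (wedge (fun i => b' (Sum.inl i) +
      t • (b (Sum.inl i) - b' (Sum.inl i)))) * chartCoordZero b' (wedge (fun i => b' (Sum.inl i) +
      t • (b (Sum.inl i) - b' (Sum.inl i)))) ≠ 0 := by
    by_contra! hc
    rcases polyFun_eq_zero_or (hz (chartCoordZero b)) (hz (chartCoordZero b')) hc with h | h
    · have h1 := h 1
      have h2 := chartCoordZero_chartPoint b
      simp only [one_smul, add_sub_cancel] at h1
      rw [chartPoint, h1] at h2
      exact zero_ne_one h2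
    · have h1 := h 0
      have h2 := chartCoordZero_chartPoint b'
      simp only [zero_smul, add_zero] at h1
      rw [chartPoint, h1] at h2
      exact zero_ne_one h2
  obtain ⟨A, hA, -⟩ := exists_chartFrame b' _ (right_ne_zero_of_mul ht)
  refine ⟨A, fun h => left_ne_zero_of_mul ht ?_⟩
  rw [hA, map_smul, h, smul_zero]

/-- A single chart is dense in the tangent cone. -/
theorem eq_zero_on_tangentCone (hV : Module.finrank ℂ V = 10)
    (b : Module.Basis (Fin 3 ⊕ Fin 7) ℂ V) {g : Module.Dual ℂ (⋀[ℂ]^3 V) → ℂ}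
    (hg : g ∈ polyFun (Module.Dual ℂ (⋀[ℂ]^3 V)))
    (h : ∀ A, ∀ τ ∈ conormal b, g (conormalMap b A τ) = 0) {σ : Module.Dual ℂ (⋀[ℂ]^3 V)}
    (hσ : σ ∈ tangentCone V) : g σ = 0 := by
  have : FiniteDimensional ℂ V := Module.Finite.of_basis b
  obtain ⟨W, hW, hσW⟩ := hσ
  obtain ⟨b', hb'⟩ := exists_basis_of_finrank_eq_three hV hW
  rw [← hb', isTangentTo_iff_mem_conormal] at hσW
  obtain ⟨A, hA⟩ := exists_common_chart b b'
  have hsA : IsPolyMap (fun s : ℂ => s • A) := by simpa using isPolyMap_line (0 : Fin 3 → Fin 7 → ℂ) A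
  have hF : (fun s : ℂ => g (conormalMap b' (s • A) σ)) ∈ polyFun ℂ :=
    (isPolyMap_conormalMap b' hsA (isPolyMap_const σ)).comp_mem hg
  have hG : (fun s : ℂ => chartCoordZero b (wedge (chartFrame b' 1 (s • A)))) ∈ polyFun ℂ := by
    refine isPolyMap_wedge (x := fun i s => chartFrame b' 1 (s • A) i) (fun i => ?_)
      (chartCoordZero b)
    simp only [chartFrame_eq]
    exact (isPolyMap_const _).add (hsA.linear_comp ((chartEnd b').flip _))
  -- When the subspace with parameter s • A lies in the chart of b, the transported form belongs to
  -- the parametrized family, where g vanishes. This happens at s = 1, so g vanishes along the whole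
  -- curve, in particular at σ, where s = 0.
  have := polyFun_line_eq_zero hF hG (fun s => by
    by_cases hs : chartCoordZero b (wedge (chartFrame b' 1 (s • A))) = 0
    · rw [hs, mul_zero]
    · obtain ⟨B, -, hB⟩ := exists_chartFrame b _ hs
      have h1 := isTangentTo_conormalMap b' (s • A) hσW
      rw [hB] at h1
      obtain ⟨τ, hτ, hτ'⟩ := exists_conormalMap_eq b B h1
      rw [← hτ', h B τ hτ, zero_mul]) (t₀ := 1) (by simpa using hA) 0
  simpa [conormalMap_zero] using this

/-- The parametrization of the tangent cone over a chart. -/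
noncomputable def conormalParam {α : Type*} [Fintype α] (b : Module.Basis (Fin 3 ⊕ α) ℂ V)
    (y : (Fin 3 → α → ℂ) × conormal b) : Module.Dual ℂ (⋀[ℂ]^3 V) :=
  conormalMap b y.1 y.2

theorem isPolyMap_conormalParam [FiniteDimensional ℂ V] {α : Type*} [Fintype α]
    (b : Module.Basis (Fin 3 ⊕ α) ℂ V) : IsPolyMap (conormalParam b) :=
  isPolyMap_conormalMap b (isPolyMap_linear (LinearMap.fst ℂ (Fin 3 → α → ℂ) (conormal b)))
    (isPolyMap_linear ((conormal b).subtype ∘ₗ LinearMap.snd ℂ (Fin 3 → α → ℂ) (conormal b)))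

/-- The ideal of the tangent cone is prime. -/
theorem eq_zero_or_on_tangentCone (hV : Module.finrank ℂ V = 10)
    {f g : Module.Dual ℂ (⋀[ℂ]^3 V) → ℂ} (hf : f ∈ polyFun (Module.Dual ℂ (⋀[ℂ]^3 V)))
    (hg : g ∈ polyFun (Module.Dual ℂ (⋀[ℂ]^3 V))) (h : ∀ σ ∈ tangentCone V, f σ * g σ = 0) :
    (∀ σ ∈ tangentCone V, f σ = 0) ∨ (∀ σ ∈ tangentCone V, g σ = 0) := by
  have : FiniteDimensional ℂ V := Module.finite_of_finrank_pos (by omega)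
  let b : Module.Basis (Fin 3 ⊕ Fin 7) ℂ V :=
    (Module.finBasisOfFinrankEq ℂ V hV).reindex (finSumFinEquiv (m := 3) (n := 7)).symm
  rcases polyFun_eq_zero_or ((isPolyMap_conormalParam b).comp_mem hf)
    ((isPolyMap_conormalParam b).comp_mem hg)
    (fun y => h _ (conormalMap_mem_tangentCone b y.1 y.2.2)) with h1 | h1
  · exact Or.inl fun σ => eq_zero_on_tangentCone hV b hf fun A τ hτ => h1 (A, ⟨τ, hτ⟩)
  · exact Or.inr fun σ => eq_zero_on_tangentCone hV b hg fun A τ hτ => h1 (A, ⟨τ, hτ⟩)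

theorem hasWeakDerivAt_conormalParam {α : Type*} [Fintype α] (b : Module.Basis (Fin 3 ⊕ α) ℂ V)
    (τ₀ : conormal b) (y : (Fin 3 → α → ℂ) × conormal b) :
    HasWeakDerivAt (fun t : ℂ => conormalParam b ((0, τ₀) + t • y))
      ((y.2 : Module.Dual ℂ (⋀[ℂ]^3 V)) - (τ₀ : Module.Dual ℂ (⋀[ℂ]^3 V)) ∘ₗ
        lieAct (chartEnd b y.1)) 0 := by
  have h : (fun t : ℂ => conormalParam b ((0, τ₀) + t • y)) = fun t : ℂ => τ₀.1 +
      t • (y.2.1 - τ₀.1 ∘ₗ lieAct (chartEnd b y.1)) +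
      t ^ 2 • (τ₀.1 ∘ₗ lieAct₂ (chartEnd b y.1) - y.2.1 ∘ₗ lieAct (chartEnd b y.1)) +
      t ^ 3 • (y.2.1 ∘ₗ lieAct₂ (chartEnd b y.1) -
        τ₀.1 ∘ₗ exteriorPower.map 3 (chartEnd b y.1)) +
      t ^ 4 • (-(y.2.1 ∘ₗ exteriorPower.map 3 (chartEnd b y.1))) := by
    ext1 t
    have h1 := conormalMap_neg_smul b y.1 (τ₀.1 + t • y.2.1) (-t)
    rw [neg_smul, neg_neg] at h1
    simp only [conormalParam, Prod.fst_add, Prod.snd_add, Prod.smul_fst, Prod.smul_snd, zero_add,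
      Submodule.coe_add, Submodule.coe_smul]
    rw [h1]
    simp only [LinearMap.add_comp, LinearMap.smul_comp]
    module
  rw [h]
  exact hasWeakDerivAt_quartic _ _ _ _ _

/-- The parametrization of the tangent cone is dominant onto the hyperplane of forms
vanishing at the centre of the chart. -/
theorem conormalParam_dominant (b : Module.Basis (Fin 3 ⊕ Fin 7) ℂ V) {n : ℕ}
    (q : ((Fin 3 → Fin 7 → ℂ) × conormal b) ≃ₗ[ℂ] (Fin n → ℂ)) {g : (Fin n → ℂ) → ℂ}
    (hg : g ∈ polyFun (Fin n → ℂ))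
    (h : ∀ y, g (q (dualChartEquiv b (conormalParam b (q.symm y))).2) = 0) (z : Fin n → ℂ) :
    g z = 0 := by
  have : FiniteDimensional ℂ V := Module.Finite.of_basis b
  let L : Module.Dual ℂ (⋀[ℂ]^3 V) →ₗ[ℂ] (Fin n → ℂ) :=
    q.toLinearMap ∘ₗ LinearMap.snd ℂ ℂ ((Fin 3 → Fin 7 → ℂ) × conormal b) ∘ₗ
      (dualChartEquiv b).toLinearMap
  let Ψ : (Fin n → ℂ) → (Fin n → ℂ) := fun y => L (conormalParam b (q.symm y))
  have hΨ : IsPolyMap Ψ :=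
    ((isPolyMap_conormalParam b).linear_comp L).comp (isPolyMap_linear q.symm.toLinearMap)
  let τ₀ : conormal b := ⟨morseForm b, morseForm_mem_conormal b⟩
  refine polyFun_eq_zero_of_surjective_fderiv hΨ (a := q (0, τ₀)) ?_ hg h z
  have hderiv : ∀ y, fderiv ℂ Ψ (q (0, τ₀)) (q y) =
      L (y.2.1 - morseForm b ∘ₗ lieAct (chartEnd b y.1)) := by
    intro y
    have hd : DifferentiableAt ℂ Ψ (q (0, τ₀)) :=
      (contDiff_of_isPolyMap hΨ (n := 1)).differentiable one_ne_zero _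
    rw [← hd.lineDeriv_eq_fderiv]
    refine HasDerivAt.deriv ?_
    rw [hasDerivAt_pi]
    intro i
    have := hasWeakDerivAt_conormalParam b τ₀ y (LinearMap.proj i ∘ₗ L)
    simpa [Ψ] using this
  -- In a kernel vector (A, τ), the tangent components see only the Hessian of `morseForm` at A,
  -- since τ is conormal. So A = 0, and the conormal component then gives τ = 0. Source and target
  -- have equal dimension.
  have hinj : Function.Injective (fderiv ℂ Ψ (q (0, τ₀))) := by
    rw [injective_iff_map_eq_zero]
    intro v hv
    obtain ⟨⟨A, τ, hτ⟩, rfl⟩ := q.surjective v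
    rw [hderiv] at hv
    have h1 : ((dualChartEquiv b) (τ - morseForm b ∘ₗ lieAct (chartEnd b A))).2 = 0 :=
      q.injective (by simpa [L] using hv)
    have hA : A = 0 := by
      apply injective_chartHessian_morseForm b
      rw [map_zero]
      ext i a
      have h2 := congrFun (congrFun (congrArg Prod.fst h1) i) a
      have h3 : τ (chartTangent b i a) - morseForm b (lieAct (chartEnd b A)
        (chartTangent b i a)) = 0 := h2
      rw [hτ.2] at h3
      rw [chartHessian_apply]
      simpa using h3
    subst hA
    have hτ0 : τ = 0 := by
      rw [map_zero] at h1
      have hl : lieAct (0 : V →ₗ[ℂ] V) = 0 := by simpa using lieAct_smul 0 (0 : V →ₗ[ℂ] V)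
      rw [hl, LinearMap.comp_zero, sub_zero] at h1
      have h2 := congrArg (fun z => (z.2 : Module.Dual ℂ (⋀[ℂ]^3 V))) h1
      simpa [dualChartEquiv, hτ.1, hτ.2] using h2
    subst hτ0
    exact map_zero q
  exact (LinearMap.injective_iff_surjective (f := (fderiv ℂ Ψ (q (0, τ₀))).toLinearMap)).1 hinj

/-- `dualChartEquiv` splits off the value at the centre as the distinguished variable, so the
parameters number one fewer than the coordinates. Density of the chart identifies the ideal of the
image with that of the cone. -/
theorem exists_tangentCone_equation (hV : Module.finrank ℂ V = 10)
    (b : Module.Basis (Fin 3 ⊕ Fin 7) ℂ V) :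
    ∃ f ∈ polyFun (Module.Dual ℂ (⋀[ℂ]^3 V)), (∀ σ ∈ tangentCone V, f σ = 0) ∧
      (∀ g ∈ polyFun (Module.Dual ℂ (⋀[ℂ]^3 V)), (∀ σ ∈ tangentCone V, g σ = 0) →
        ∃ h ∈ polyFun (Module.Dual ℂ (⋀[ℂ]^3 V)), ∀ σ, g σ = f σ * h σ) ∧
      ∃ σ ∈ tangentCone V, lineDeriv ℂ f σ (chartCoordZero b) ≠ 0 := by
  have : FiniteDimensional ℂ V := Module.Finite.of_basis b
  let q := (Module.finBasis ℂ ((Fin 3 → Fin 7 → ℂ) × conormal b)).equivFun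
  obtain ⟨f, hf, hf0, hgen, y, hy⟩ := exists_hypersurface_equation
    ((dualChartEquiv b).trans ((LinearEquiv.refl ℂ ℂ).prodCongr q))
    ((isPolyMap_conormalParam b).comp (isPolyMap_linear q.symm.toLinearMap))
    (fun g hg h => conormalParam_dominant b q hg h)
  refine ⟨f, hf, fun σ => eq_zero_on_tangentCone hV b hf fun A τ hτ => ?_, fun g hg h =>
    hgen g hg fun y => h _ (conormalMap_mem_tangentCone b _ (q.symm y).2.2), ?_⟩
  · simpa [conormalParam] using hf0 (q (A, ⟨τ, hτ⟩))
  · refine ⟨_, conormalMap_mem_tangentCone b (q.symm y).1 (q.symm y).2.2, ?_⟩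
    have h1 : ((dualChartEquiv b).trans ((LinearEquiv.refl ℂ ℂ).prodCongr q)).symm (1, 0) =
        chartCoordZero b := by
      rw [← dualChartEquiv_symm_one b]
      simp
    rwa [h1] at hy

end DualEquation

/-! ### Reflexivity: the gradient of the equation determines the point of tangency. -/

section DualPoint

variable {V : Type*} [AddCommGroup V] [Module ℂ V]

theorem lineDeriv_eq_zero_of_apply_wedge (hV : Module.finrank ℂ V = 10)
    {f : Module.Dual ℂ (⋀[ℂ]^3 V) → ℂ} (hf : f ∈ polyFun (Module.Dual ℂ (⋀[ℂ]^3 V)))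
    (hfS : ∀ σ ∈ tangentCone V, f σ = 0) {w : Fin 3 → V} (hw : LinearIndependent ℂ w)
    {σ φ : Module.Dual ℂ (⋀[ℂ]^3 V)} (hσ : IsTangentTo (Submodule.span ℂ (Set.range w)) σ)
    (hφ : φ (wedge w) = 0) : lineDeriv ℂ f σ φ = 0 := by
  obtain ⟨b, rfl⟩ := exists_basis_extending hV hw
  rw [isTangentTo_iff_mem_conormal] at hσ
  exact lineDeriv_eq_zero_of_apply_chartPoint hf hfS b hσ hφ

/-- The differential at σ is a multiple of evaluation at the point of tangency; if it kills a form
nonzero there, the multiple is zero. -/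
theorem lineDeriv_eq_zero_of_eq_zero (hV : Module.finrank ℂ V = 10)
    {f : Module.Dual ℂ (⋀[ℂ]^3 V) → ℂ} (hf : f ∈ polyFun (Module.Dual ℂ (⋀[ℂ]^3 V)))
    (hfS : ∀ σ ∈ tangentCone V, f σ = 0) {w : Fin 3 → V} (hw : LinearIndependent ℂ w)
    {σ ψ : Module.Dual ℂ (⋀[ℂ]^3 V)} (hσ : IsTangentTo (Submodule.span ℂ (Set.range w)) σ)
    (hψ : ψ (wedge w) ≠ 0) (h : lineDeriv ℂ f σ ψ = 0) (φ : Module.Dual ℂ (⋀[ℂ]^3 V)) :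
    lineDeriv ℂ f σ φ = 0 := by
  have h1 := lineDeriv_eq_zero_of_apply_wedge hV hf hfS hw hσ
    (φ := φ - (φ (wedge w) / ψ (wedge w)) • ψ) (by simp [hψ])
  obtain ⟨D, hD, -, -⟩ := exists_differential hf
  rw [hD] at h h1 ⊢
  rwa [map_sub, map_smul, h, smul_zero, sub_zero] at h1

/-- The curve of forms tangent along a curve of subspaces, corrected by a conormal form to be
stationary. -/
theorem hasWeakDerivAt_conormalMap_stationary {α : Type*} [Fintype α]
    (b : Module.Basis (Fin 3 ⊕ α) ℂ V) (A : Fin 3 → α → ℂ) (σ : Module.Dual ℂ (⋀[ℂ]^3 V)) :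
    HasWeakDerivAt (fun t : ℂ => conormalMap b (-(t • A)) (σ - t • (σ ∘ₗ lieAct (chartEnd b A))))
      0 0 := by
  have h : (fun t : ℂ => conormalMap b (-(t • A)) (σ - t • (σ ∘ₗ lieAct (chartEnd b A)))) =
      fun t : ℂ => σ + t • (0 : Module.Dual ℂ (⋀[ℂ]^3 V)) +
      t ^ 2 • (σ ∘ₗ lieAct₂ (chartEnd b A) -
        (σ ∘ₗ lieAct (chartEnd b A)) ∘ₗ lieAct (chartEnd b A)) +
      t ^ 3 • (σ ∘ₗ exteriorPower.map 3 (chartEnd b A) -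
        (σ ∘ₗ lieAct (chartEnd b A)) ∘ₗ lieAct₂ (chartEnd b A)) +
      t ^ 4 • (-((σ ∘ₗ lieAct (chartEnd b A)) ∘ₗ exteriorPower.map 3 (chartEnd b A))) := by
    ext1 t
    rw [conormalMap_neg_smul]
    simp only [LinearMap.sub_comp, LinearMap.smul_comp]
    module
  rw [h]
  exact hasWeakDerivAt_quartic _ _ _ _ _

theorem eq_zero_of_stationary {k₀ k₁ k₂ k₃ : ℂ → ℂ} (h₀ : HasDerivAt k₀ 0 0)
    (h₁ : HasDerivAt k₁ 0 0) (h₂ : HasDerivAt k₂ 0 0) (h₃ : HasDerivAt k₃ 0 0)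
    (h : ∀ t, k₀ t + t * k₁ t + t ^ 2 * k₂ t + t ^ 3 * k₃ t = 0) : k₁ 0 = 0 := by
  have hder := ((h₀.add ((hasDerivAt_id (0 : ℂ)).mul h₁)).add
    (((hasDerivAt_id (0 : ℂ)).pow 2).mul h₂)).add
    (((hasDerivAt_id (0 : ℂ)).pow 3).mul h₃)
  have h2 := (hder.congr_of_eventuallyEq (f₁ := fun _ => 0)
    (Filter.Eventually.of_forall fun t => by simpa using (h t).symm)).unique
    (hasDerivAt_const _ _)
  simpa using h2

/-- At a smooth point of the dual hypersurface, the Hessian is nondegenerate. -/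
theorem injective_chartHessian_of_lineDeriv_ne_zero (hV : Module.finrank ℂ V = 10)
    {f : Module.Dual ℂ (⋀[ℂ]^3 V) → ℂ} (hf : f ∈ polyFun (Module.Dual ℂ (⋀[ℂ]^3 V)))
    (hfS : ∀ σ ∈ tangentCone V, f σ = 0) (b : Module.Basis (Fin 3 ⊕ Fin 7) ℂ V)
    {σ φ : Module.Dual ℂ (⋀[ℂ]^3 V)} (hσ : σ ∈ conormal b) (hφ : lineDeriv ℂ f σ φ ≠ 0) :
    Function.Injective (chartHessian b σ) := by
  rw [injective_iff_map_eq_zero]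
  intro A hA
  by_contra hA0
  obtain ⟨i, a, hia⟩ : ∃ i a, A i a ≠ 0 := by
    by_contra! hc
    exact hA0 (by ext i a; exact hc i a)
  -- A kernel vector A of the Hessian makes the first variation of σ conormal, so a first-order
  -- correction of the conormal form cancels it. This gives a curve of tangent forms with zero
  -- velocity whose point of tangency moves in the direction A.
  have hσ' : σ ∘ₗ lieAct (chartEnd b A) ∈ conormal b := by
    constructor
    · rw [LinearMap.comp_apply, lieAct_chartPoint]
      simp [hσ.2]
    · intro i a
      rw [LinearMap.comp_apply, ← chartHessian_apply, hA]; rfl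
  have hγ := hasWeakDerivAt_conormalMap_stationary b A σ
  have hmem : ∀ t : ℂ, σ - t • (σ ∘ₗ lieAct (chartEnd b A)) ∈ conormal b := fun t =>
    sub_mem hσ (Submodule.smul_mem _ _ hσ')
  have hγ0 : conormalMap b (-((0 : ℂ) • A)) (σ - (0 : ℂ) • (σ ∘ₗ lieAct (chartEnd b A))) = σ := by
    rw [zero_smul, zero_smul, neg_zero, sub_zero, conormalMap_zero]
  generalize hγdef : (fun t : ℂ => conormalMap b (-(t • A))
    (σ - t • (σ ∘ₗ lieAct (chartEnd b A)))) = γ at hγ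
  have hγt : ∀ t, IsTangentTo (Submodule.span ℂ (Set.range (chartFrame b 1 (-(t • A))))) (γ t) := by
    intro t
    rw [← hγdef]
    exact isTangentTo_conormalMap b _ (hmem t)
  have hγ0' : γ 0 = σ := by rw [← hγdef]; exact hγ0
  have hdiff : ∀ ψ, HasDerivAt (fun t => lineDeriv ℂ f (γ t) ψ) 0 0 := by
    intro ψ
    obtain ⟨E, -, -, hE⟩ := exists_differential (lineDeriv_mem_polyFun hf ψ)
    have := hE γ 0 0 hγ
    rwa [map_zero] at this
  obtain ⟨D, hD, -, -⟩ := exists_differential hf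
  -- The differential at γ t kills forms vanishing at the moving point of tangency, such as the
  -- transported chart coordinate, here expanded in powers of t.
  have hzero : ∀ t : ℂ, lineDeriv ℂ f (γ t) (chartCoord b i a) +
      t * lineDeriv ℂ f (γ t) (chartCoord b i a ∘ₗ lieAct (chartEnd b A)) +
      t ^ 2 * lineDeriv ℂ f (γ t) (chartCoord b i a ∘ₗ lieAct₂ (chartEnd b A)) +
      t ^ 3 * lineDeriv ℂ f (γ t) (chartCoord b i a ∘ₗ exteriorPower.map 3 (chartEnd b A)) = 0 := by
    intro t
    have h1 := lineDeriv_eq_zero_of_apply_wedge hV hf hfS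
      (linearIndependent_chartFrame b (-(t • A))) (hγt t)
      (φ := conormalMap b (-(t • A)) (chartCoord b i a)) (by
        rw [conormalMap, LinearMap.comp_apply, map_wedge]
        simp only [sub_chartEnd_chartFrame]
        exact chartCoord_chartPoint b i a)
    rw [conormalMap_neg_smul, hD] at h1
    simp only [hD]
    simpa only [map_add, map_smul, smul_eq_mul] using h1
  -- All the coefficients are stationary at 0, so the first-order term survives alone: the
  -- differential at σ kills a form whose value at the point of tangency is A i a ≠ 0, hence it is
  -- zero.
  have h3 := eq_zero_of_stationary (hdiff _) (hdiff _) (hdiff _) (hdiff _) hzero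
  rw [hγ0'] at h3
  refine hφ (lineDeriv_eq_zero_of_eq_zero hV hf hfS
    (b.linearIndependent.comp _ Sum.inl_injective) ((isTangentTo_iff_mem_conormal b σ).2 hσ)
    ?_ h3 φ)
  have h4 : chartCoord b i a (lieAct (chartEnd b A) (chartPoint b)) = A i a := by
    rw [lieAct_chartPoint]
    simp [chartCoord_chartTangent, ite_and]
  rw [chartPoint] at h4
  exact fun h => hia (h4.symm.trans h)

theorem IsTangentTo.mono {W W' : Submodule ℂ V} {σ : Module.Dual ℂ (⋀[ℂ]^3 V)}
    (h : IsTangentTo W' σ) (hW : W ≤ W') : IsTangentTo W σ :=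
  fun x hx y hy v => h x (hW hx) y (hW hy) v

/-- The point of tangency is given by the gradient of the equation of the dual variety. -/
theorem isTangentTo_gradient (hV : Module.finrank ℂ V = 10)
    {f : Module.Dual ℂ (⋀[ℂ]^3 V) → ℂ} (hf : f ∈ polyFun (Module.Dual ℂ (⋀[ℂ]^3 V)))
    (hfS : ∀ σ ∈ tangentCone V, f σ = 0)
    (hgen : ∀ g ∈ polyFun (Module.Dual ℂ (⋀[ℂ]^3 V)), (∀ σ ∈ tangentCone V, g σ = 0) →
        ∃ h ∈ polyFun (Module.Dual ℂ (⋀[ℂ]^3 V)), ∀ σ, g σ = f σ * h σ)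
    (b : Module.Basis (Fin 3 ⊕ Fin 7) ℂ V) {σ : Module.Dual ℂ (⋀[ℂ]^3 V)} (hσ : f σ = 0) :
    IsTangentTo (Submodule.span ℂ (Set.range (chartFrame b (lineDeriv ℂ f σ (chartCoordZero b))
      (fun i a => lineDeriv ℂ f σ (chartCoord b i a))))) σ := by
  have : FiniteDimensional ℂ V := Module.Finite.of_basis b
  rw [isTangentTo_span_iff]
  intro i v
  let z : Fin 3 → Module.Dual ℂ (⋀[ℂ]^3 V) → V := fun j τ =>
    chartFrame b (lineDeriv ℂ f τ (chartCoordZero b))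
      (fun i a => lineDeriv ℂ f τ (chartCoord b i a)) j
  have hz : ∀ j, IsPolyMap (z j) := fun j =>
    ((isPolyMap_const _).smul (lineDeriv_mem_polyFun hf _)).add
      (IsPolyMap.sum _ fun a _ => (isPolyMap_const _).smul (lineDeriv_mem_polyFun hf _))
  -- The tangency condition for the gradient frame is polynomial in τ; once it vanishes on the cone
  -- it is a multiple of f, hence vanishes at every zero of f.
  have hg : (fun τ => τ (wedge (Function.update (fun j => z j τ) i v))) ∈
      polyFun (Module.Dual ℂ (⋀[ℂ]^3 V)) := by
    refine isPolyMap_id.dual_apply ?_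
    have h1 : (fun τ => wedge (Function.update (fun j => z j τ) i v)) = fun τ =>
        wedge (fun j => (Function.update z i (fun _ => v)) j τ) := by
      ext1 τ; congr 1; ext1 j
      by_cases hj : j = i
      · subst hj; simp
      · simp [hj]
    rw [h1]
    refine isPolyMap_wedge fun j => ?_
    by_cases hj : j = i
    · subst hj; simpa using isPolyMap_const v
    · simpa [hj] using hz j
  obtain ⟨h, -, hh⟩ := hgen _ hg fun τ hτ => by
    refine eq_zero_on_tangentCone hV b hg (fun B τ hτ => ?_) hτ
    have htan := isTangentTo_conormalMap b B hτ
    set ρ := conormalMap b B τ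
    -- At ρ the gradient is proportional to evaluation at the point with parameter B, so the
    -- gradient frame is a scalar multiple of the frame of B.
    have hA : ∀ i a, lineDeriv ℂ f ρ (chartCoord b i a) =
        B i a * lineDeriv ℂ f ρ (chartCoordZero b) := by
      intro i a
      have h1 := lineDeriv_eq_zero_of_apply_wedge hV hf hfS (linearIndependent_chartFrame b B) htan
        (φ := chartCoord b i a - B i a • chartCoordZero b) (by
          simp [chartCoord_chartFrame, chartCoordZero_chartFrame])
      obtain ⟨D, hD, -, -⟩ := exists_differential hf
      rw [hD] at h1
      rw [hD, hD]
      rw [map_sub, map_smul, smul_eq_mul] at h1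
      exact sub_eq_zero.1 h1
    have hle : Submodule.span ℂ (Set.range fun j => z j ρ) ≤
        Submodule.span ℂ (Set.range (chartFrame b 1 B)) := by
      rw [Submodule.span_le]
      rintro _ ⟨j, rfl⟩
      have : z j ρ = lineDeriv ℂ f ρ (chartCoordZero b) • chartFrame b 1 B j := by
        simp only [z, chartFrame, hA, smul_add, Finset.smul_sum, smul_smul, mul_one]
        simp only [mul_comm]
      simp only [this]
      exact Submodule.smul_mem _ _ (Submodule.subset_span ⟨j, rfl⟩)
    exact (isTangentTo_span_iff _ _).1 (htan.mono hle) i v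
  have := hh σ
  rw [hσ, zero_mul] at this
  exact this

end DualPoint

/-! ### Functions vanishing on a nondegenerate quadratic singularity. -/

section Morse

variable {E : Type*} [NormedAddCommGroup E] [NormedSpace ℂ E] [FiniteDimensional ℂ E]

/-- A nondegenerate quadratic form takes nonzero values on every hyperplane. -/
theorem exists_ne_zero_of_nondegenerate (H : E →ₗ[ℂ] E →ₗ[ℂ] ℂ)
    (hH : ∀ A, (∀ B, H A B = 0) → A = 0) (hE : 3 ≤ Module.finrank ℂ E) {q : E → ℂ}
    (hq : ∀ A B (s : ℂ), q (A + s • B) = q A + s * H A B + s ^ 2 * q B) (ℓ : Module.Dual ℂ E) :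
    ∃ y, ℓ y = 0 ∧ q y ≠ 0 := by
  by_contra! hc
  have hK : ∀ x ∈ LinearMap.ker ℓ, ∀ y ∈ LinearMap.ker ℓ, H x y = 0 := by
    intro x hx y hy
    have h1 := hq x y 1
    rw [hc x hx, hc y hy, hc _ (add_mem hx (Submodule.smul_mem _ _ hy))] at h1
    simpa using h1.symm
  have hrank := LinearMap.finrank_range_add_finrank_ker ℓ
  have hr1 : Module.finrank ℂ (LinearMap.range ℓ) ≤ 1 :=
    (Submodule.finrank_le _).trans (Module.finrank_self ℂ).le
  obtain ⟨v, hv⟩ : ∃ v, ∀ z, ∃ c : ℂ, z - c • v ∈ LinearMap.ker ℓ := by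
    by_cases hℓ : ∃ v, ℓ v ≠ 0
    · obtain ⟨v, hv⟩ := hℓ
      exact ⟨v, fun z => ⟨ℓ z / ℓ v, by simp [hv]⟩⟩
    · push Not at hℓ
      exact ⟨0, fun z => ⟨0, by simp [hℓ]⟩⟩
  -- If the kernel of ℓ is totally isotropic, H x for x in it is determined by its value at one
  -- complementary vector v. The kernel, of dimension at least 2, would then inject into ℂ.
  let T : LinearMap.ker ℓ →ₗ[ℂ] ℂ := (H.flip v) ∘ₗ (LinearMap.ker ℓ).subtype
  have hT : Function.Injective T := by
    rw [injective_iff_map_eq_zero]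
    rintro ⟨x, hx⟩ hxv
    refine Subtype.ext (hH x fun z => ?_)
    obtain ⟨c, hz⟩ := hv z
    have h1 := hK x hx _ hz
    have h2 : H x v = 0 := hxv
    rw [map_sub, map_smul, h2, smul_zero, sub_zero] at h1
    exact h1
  have h3 := LinearMap.finrank_le_finrank_of_injective hT
  rw [Module.finrank_self] at h3
  omega

/-- A function vanishing on a hypersurface with a nondegenerate quadratic singularity has zero
differential at the singular point. -/
theorem fderiv_eq_zero_of_vanishing_on_cone (H : E →ₗ[ℂ] E →ₗ[ℂ] ℂ)
    (hH : ∀ A, (∀ B, H A B = 0) → A = 0) (hE : 3 ≤ Module.finrank ℂ E) {q₂ q₃ : E → ℂ}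
    (hq₂ : ∀ A B (s : ℂ), q₂ (A + s • B) = q₂ A + s * H A B + s ^ 2 * q₂ B)
    (hq₂0 : q₂ 0 = 0) (hq₃p : q₃ ∈ polyFun E) (hq₃ : ∀ (t : ℂ) A, q₃ (t • A) = t ^ 3 * q₃ A)
    {g : E → ℂ} (hg : DifferentiableAt ℂ g 0)
    (h : ∀ᶠ A in nhds (0 : E), q₂ A + q₃ A = 0 → g A = 0) : fderiv ℂ g 0 = 0 := by
  by_contra hne
  obtain ⟨v₀, hv₀⟩ : ∃ v, fderiv ℂ g 0 v ≠ 0 := by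
    by_contra! hc
    exact hne (ContinuousLinearMap.ext hc)
  obtain ⟨y, hy, hqy⟩ := exists_ne_zero_of_nondegenerate H hH hE hq₂ (fderiv ℂ g 0).toLinearMap
  -- Adding r • y, with y in the kernel of the differential, makes v₀ isotropic without changing its
  -- image: the condition is a quadratic equation in r with leading coefficient q₂ y ≠ 0.
  obtain ⟨r, hr⟩ := exists_quadratic_eq_zero hqy
    (b := H v₀ y) (c := q₂ v₀) (IsAlgClosed.exists_eq_mul_self _)
  set v := v₀ + r • y with hvdef
  have hv : fderiv ℂ g 0 v ≠ 0 := by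
    have hy' : fderiv ℂ g 0 y = 0 := hy
    rw [hvdef, map_add, map_smul, hy', smul_zero, add_zero]
    exact hv₀
  have hqv : q₂ v = 0 := by rw [hvdef, hq₂]; linear_combination hr
  obtain ⟨w, hw⟩ : ∃ w, H v w ≠ 0 := by
    by_contra! hc
    exact hv (by rw [hH v hc, map_zero])
  have hq₂t : ∀ (t : ℂ) A, q₂ (t • A) = t ^ 2 * q₂ A := by
    intro t A
    have := hq₂ 0 A t
    simpa [hq₂0] using this
  -- With z = (t, s), this is the equation at t(v + s w) divided by t². Its s-derivative at the
  -- origin is H v w ≠ 0, so the implicit function theorem gives a curve on the hypersurface with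
  -- velocity v, along which g is zero.
  let G : ℂ × ℂ → ℂ := fun z => z.2 * H v w + z.2 ^ 2 * q₂ w + z.1 * q₃ (v + z.2 • w)
  have h₁ : (fun z : ℂ × ℂ => z.1) ∈ polyFun (ℂ × ℂ) := linear_mem_polyFun (LinearMap.fst ℂ ℂ ℂ)
  have h₂ : (fun z : ℂ × ℂ => z.2) ∈ polyFun (ℂ × ℂ) := linear_mem_polyFun (LinearMap.snd ℂ ℂ ℂ)
  have hG : G ∈ polyFun (ℂ × ℂ) :=
    add_mem_polyFun (add_mem_polyFun (mul_mem_polyFun h₂ (const_mem_polyFun _))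
      (mul_mem_polyFun (pow_mem_polyFun h₂ 2) (const_mem_polyFun _)))
      (mul_mem_polyFun h₁ (((isPolyMap_const v).add
        ((isPolyMap_const w).smul h₂)).comp_mem hq₃p))
  have hG1 : ContDiff ℂ 1 G := contDiff_of_mem_polyFun hG
  have hGd : HasStrictFDerivAt G (fderiv ℂ G 0) 0 := hG1.contDiffAt.hasStrictFDerivAt one_ne_zero
  have hG01 : fderiv ℂ G 0 (0, 1) = H v w := by
    rw [← (hG1.differentiable one_ne_zero 0).lineDeriv_eq_fderiv]
    refine HasDerivAt.deriv ?_
    have h1 := ((hasDerivAt_id (0 : ℂ)).mul_const (H v w)).add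
      (((hasDerivAt_id (0 : ℂ)).pow 2).mul_const (q₂ w))
    refine (h1.congr_deriv (by simp)).congr_of_eventuallyEq (Filter.Eventually.of_forall fun t => ?_)
    simp [G]
  have hinv : ((fderiv ℂ G 0) ∘L .inr ℂ ℂ ℂ).IsInvertible := by
    refine ⟨ContinuousLinearEquiv.unitsEquivAut ℂ (Units.mk0 _ hw), ?_⟩
    ext
    simp [hG01]
  let s := hGd.implicitFunctionOfProdDomain hinv
  have hs0 : s 0 = 0 :=
    (hGd.eventually_apply_eq_iff_implicitFunctionOfProdDomain hinv).self_of_nhds.1 rfl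
  have hs : HasDerivAt s _ (0 : ℂ) :=
    (hGd.hasStrictFDerivAt_implicitFunctionOfProdDomain hinv).hasFDerivAt.hasDerivAt
  have hsG : ∀ᶠ t in nhds (0 : ℂ), G (t, s t) = 0 := by
    have := hGd.eventually_apply_implicitFunctionOfProdDomain hinv
    filter_upwards [this] with t ht
    rw [ht]; simp [G]
  let γ : ℂ → E := fun t => t • (v + s t • w)
  have hγ : HasDerivAt γ v 0 := by
    have h1 := (hasDerivAt_id (0 : ℂ)).smul ((hs.smul_const w).const_add v)
    refine h1.congr_deriv ?_
    simp [hs0]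
  have hγ0 : γ 0 = 0 := by simp [γ]
  have hzero : ∀ᶠ t in nhds (0 : ℂ), g (γ t) = 0 := by
    have hc : Filter.Tendsto γ (nhds 0) (nhds 0) := by
      have := hγ.continuousAt.tendsto
      rwa [hγ0] at this
    filter_upwards [hc.eventually h, hsG] with t ht htG
    refine ht ?_
    simp only [γ]
    rw [hq₂t, hq₃, hq₂, hqv]
    simp only [G] at htG
    linear_combination t ^ 2 * htG
  have hd : HasDerivAt (fun t => g (γ t)) (fderiv ℂ g 0 v) 0 := by
    have hg' : HasFDerivAt g (fderiv ℂ g 0) (γ 0) := by rw [hγ0]; exact hg.hasFDerivAt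
    exact hg'.comp_hasDerivAt 0 hγ
  exact hv (hd.unique ((hasDerivAt_const (0 : ℂ) (0 : ℂ)).congr_of_eventuallyEq hzero))

end Morse

/-! ### Chart equations, smoothness and tangent spaces of the Grassmannian. -/

section Grassmannian

variable {V : Type*} [AddCommGroup V] [Module ℂ V]

/-- Nonzero decomposable trivectors. -/
def IsDecomposable (y : ⋀[ℂ]^3 V) : Prop :=
  ∃ w : Fin 3 → V, LinearIndependent ℂ w ∧ wedge w = y

theorem smul_wedge (c : ℂ) (w : Fin 3 → V) : ∃ w', wedge w' = c • wedge w :=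
  ⟨![c • w 0, w 1, w 2], by rw [wedge_smul₀, ← fin_three_eta]⟩

theorem isDecomposable_smul_wedge {c : ℂ} {w : Fin 3 → V} (h : c • wedge w ≠ 0) :
    IsDecomposable (c • wedge w) := by
  obtain ⟨w', hw'⟩ := smul_wedge c w
  exact ⟨w', linearIndependent_of_wedge_ne_zero (by rwa [hw']), hw'⟩

theorem wedge_ne_zero (hV : Module.finrank ℂ V = 10) {w : Fin 3 → V}
    (hw : LinearIndependent ℂ w) : wedge w ≠ 0 := by
  obtain ⟨b, rfl⟩ := exists_basis_extending hV hw
  exact chartPoint_ne_zero b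

theorem pluckerLine_span (w : Fin 3 → V) :
    pluckerLine 3 (Submodule.span ℂ (Set.range w)) = Submodule.span ℂ {wedge w} := by
  apply le_antisymm
  · rintro _ ⟨y, rfl⟩
    have hy : y ∈ Submodule.span ℂ (Set.range (exteriorPower.ιMulti ℂ 3
        (M := Submodule.span ℂ (Set.range w)))) := by
      rw [exteriorPower.ιMulti_span]; trivial
    induction hy using Submodule.span_induction with
    | zero => rw [map_zero]; exact zero_mem _
    | add x y _ _ hx hy => rw [map_add]; exact add_mem hx hy
    | smul c x _ hx => rw [map_smul]; exact Submodule.smul_mem _ _ hx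
    | mem x hx =>
      obtain ⟨v, rfl⟩ := hx
      rw [exteriorPower.map_apply_ιMulti]
      choose m hm using fun i => (Submodule.mem_span_range_iff_exists_fun ℂ).1 (v i).2
      have h1 : (Submodule.span ℂ (Set.range w)).subtype ∘ v = fun i => ∑ k, m i k • w k := by
        ext1 i; exact (hm i).symm
      rw [h1]
      have := wedge_matrix (Matrix.of m) w
      simp only [Matrix.of_apply] at this
      refine Eq.mpr (congrArg (· ∈ Submodule.span ℂ {wedge w}) this) ?_
      exact Submodule.smul_mem _ _ (Submodule.mem_span_singleton_self _)
  · rw [Submodule.span_singleton_le_iff_mem]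
    refine ⟨exteriorPower.ιMulti ℂ 3 fun i => ⟨w i, Submodule.subset_span ⟨i, rfl⟩⟩, ?_⟩
    rw [exteriorPower.map_apply_ιMulti]; rfl

theorem exists_linearIndependent_span {W : Submodule ℂ V} (hW : Module.finrank ℂ W = 3) :
    ∃ w : Fin 3 → V, LinearIndependent ℂ w ∧ Submodule.span ℂ (Set.range w) = W := by
  have : FiniteDimensional ℂ W := Module.finite_of_finrank_pos (by omega)
  let w := Module.finBasisOfFinrankEq ℂ W hW
  refine ⟨fun i => w i, w.linearIndependent.map' W.subtype (Submodule.ker_subtype W), ?_⟩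
  rw [show (fun i => (w i : V)) = W.subtype ∘ w from rfl, Set.range_comp,
    ← Submodule.map_span, w.span_eq, Submodule.map_top, Submodule.range_subtype]

theorem mem_pluckerGrassmannian_iff {x : ℙ ℂ (⋀[ℂ]^3 V)} :
    x ∈ pluckerGrassmannian 3 V ↔ IsDecomposable x.rep := by
  constructor
  · rintro ⟨W, hW, hx⟩
    obtain ⟨w, hw, rfl⟩ := exists_linearIndependent_span hW
    rw [pluckerLine_span] at hx
    have h1 : x.rep ∈ Submodule.span ℂ {wedge w} := by
      rw [← hx, Projectivization.submodule_eq]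
      exact Submodule.mem_span_singleton_self _
    obtain ⟨c, hc⟩ := Submodule.mem_span_singleton.1 h1
    rw [← hc]
    exact isDecomposable_smul_wedge (by rw [hc]; exact x.rep_nonzero)
  · rintro ⟨w, hw, hx⟩
    refine ⟨_, finrank_span_of_linearIndependent hw, ?_⟩
    rw [pluckerLine_span, hx, Projectivization.submodule_eq]

theorem mk_mem_pluckerGrassmannian_iff {y : ⋀[ℂ]^3 V}
    (hy : y ≠ 0) : Projectivization.mk ℂ y hy ∈ pluckerGrassmannian 3 V ↔ IsDecomposable y := by
  rw [mem_pluckerGrassmannian_iff]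
  obtain ⟨a, ha⟩ := Projectivization.exists_smul_eq_mk_rep ℂ y hy
  have hne := (Projectivization.mk ℂ y hy).rep_nonzero
  rw [← ha] at hne ⊢
  constructor
  · rintro ⟨w, hw, h⟩
    have h1 : y = (a⁻¹ : ℂˣ) • wedge w := by rw [h, inv_smul_smul]
    rw [h1]
    exact isDecomposable_smul_wedge (by rw [← Units.smul_def, ← h1]; exact hy)
  · rintro ⟨w, hw, h⟩
    rw [← h] at hne ⊢
    exact isDecomposable_smul_wedge hne

/-- A Plücker equation in a chart: the homogenization of the graph equation. -/
noncomputable def chartEquation {α : Type*} [Fintype α] (b : Module.Basis (Fin 3 ⊕ α) ℂ V)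
    (k : Module.Dual ℂ (⋀[ℂ]^3 V)) (y : ⋀[ℂ]^3 V) : ℂ :=
  chartCoordZero b y ^ 2 * k y -
    k (wedge (chartFrame b (chartCoordZero b y) fun i a => chartCoord b i a y))

theorem chartFrame_smul {α : Type*} [Fintype α] (b : Module.Basis (Fin 3 ⊕ α) ℂ V) (t s : ℂ)
    (A : Fin 3 → α → ℂ) (i : Fin 3) :
    chartFrame b (t * s) (fun i a => t * A i a) i = t • chartFrame b s A i := by
  simp [chartFrame, mul_smul, Finset.smul_sum]

theorem wedge_chartFrame_smul {α : Type*} [Fintype α] (b : Module.Basis (Fin 3 ⊕ α) ℂ V)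
    (t s : ℂ) (A : Fin 3 → α → ℂ) : wedge (chartFrame b (t * s) (fun i a => t * A i a)) =
      t ^ 3 • wedge (chartFrame b s A) := by
  have := (exteriorPower.ιMulti ℂ 3 (M := V)).toMultilinearMap.map_smul_univ (fun _ => t)
    (chartFrame b s A)
  rw [show chartFrame b (t * s) (fun i a => t * A i a) = fun i => t • chartFrame b s A i from
    funext (chartFrame_smul b t s A)]
  simpa using this

theorem isPolyMap_wedge_chartFrame [FiniteDimensional ℂ V] {Y : Type*} [AddCommGroup Y]
    [Module ℂ Y] {α : Type*} [Fintype α] (b : Module.Basis (Fin 3 ⊕ α) ℂ V) {s : Y → ℂ}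
    (hs : s ∈ polyFun Y) {A : Y → Fin 3 → α → ℂ} (hA : ∀ i a, (fun y => A y i a) ∈ polyFun Y) :
    IsPolyMap (fun y => wedge (chartFrame b (s y) (A y))) :=
  isPolyMap_wedge (x := fun i y => chartFrame b (s y) (A y) i) fun i =>
    ((isPolyMap_const _).smul hs).add (IsPolyMap.sum _ fun a _ => (isPolyMap_const _).smul (hA i a))

theorem isForm_linear {N : Type*} [AddCommGroup N] [Module ℂ N] (l : Module.Dual ℂ N) :
    IsForm 1 (fun v => l v) :=
  ⟨linear_mem_polyFun l, fun t v => by simp⟩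

theorem isForm_chartEquation [FiniteDimensional ℂ V] {α : Type*} [Fintype α]
    (b : Module.Basis (Fin 3 ⊕ α) ℂ V) (k : Module.Dual ℂ (⋀[ℂ]^3 V)) :
    IsForm 3 (chartEquation b k) := by
  constructor
  · exact sub_mem_polyFun (mul_mem_polyFun (pow_mem_polyFun (linear_mem_polyFun _) 2)
      (linear_mem_polyFun k)) (isPolyMap_wedge_chartFrame b (linear_mem_polyFun _)
        (fun i a => linear_mem_polyFun _) k)
  · intro t y
    simp only [chartEquation, map_smul, smul_eq_mul, wedge_chartFrame_smul]
    ring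

/-- A conormal k kills every wedge that differs from the centre in one factor, so the wedge term of
the equation starts in second order and the differential is k itself. -/
theorem hasDerivAt_chartEquation {α : Type*} [Fintype α] (b : Module.Basis (Fin 3 ⊕ α) ℂ V)
    {k : Module.Dual ℂ (⋀[ℂ]^3 V)} (hk : k ∈ conormal b) (w : ⋀[ℂ]^3 V) :
    HasDerivAt (fun t : ℂ => chartEquation b k (chartPoint b + t • w)) (k w) 0 := by
  set c : Fin 3 → V := chartFrame b (chartCoordZero b w) (fun i a => chartCoord b i a w)
  have hfr : ∀ t : ℂ, chartFrame b (chartCoordZero b (chartPoint b + t • w))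
      (fun i a => chartCoord b i a (chartPoint b + t • w)) =
      fun i => b (Sum.inl i) + t • c i := by
    intro t
    ext1 i
    simp only [map_add, map_smul, chartCoordZero_chartPoint, chartCoord_chartPoint, zero_add,
      smul_eq_mul, c, chartFrame, smul_add, Finset.smul_sum, mul_smul, add_smul, one_smul, add_assoc]
  have htan := (isTangentTo_span_iff _ _).1 ((isTangentTo_iff_mem_conormal b k).2 hk)
  set X := ∑ i, wedge (Function.update c i (b (Sum.inl i)))
  have heq : ∀ t : ℂ, chartEquation b k (chartPoint b + t • w) =
      (1 + t * chartCoordZero b w) ^ 2 * (t * k w) - t ^ 2 * k X - t ^ 3 * k (wedge c) := by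
    intro t
    have h1 := hk.1
    rw [chartEquation, hfr, wedge_add_smul]
    simp only [map_add, map_smul, map_sum, htan, h1, chartCoordZero_chartPoint, smul_eq_mul,
      Finset.sum_const_zero, X]
    have h2 : k (wedge fun i => b (Sum.inl i)) = 0 := h1
    rw [h2]
    ring
  have hd := ((((((hasDerivAt_id (0 : ℂ)).mul_const (chartCoordZero b w)).const_add 1).pow 2).mul
    ((hasDerivAt_id (0 : ℂ)).mul_const (k w))).sub
    (((hasDerivAt_id (0 : ℂ)).pow 2).mul_const (k X))).sub
    (((hasDerivAt_id (0 : ℂ)).pow 3).mul_const (k (wedge c)))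
  refine (hd.congr_deriv (by simp)).congr_of_eventuallyEq (Filter.Eventually.of_forall fun t => ?_)
  refine (heq t).trans ?_
  simp

theorem lineDeriv_chartEquation {α : Type*} [Fintype α] (b : Module.Basis (Fin 3 ⊕ α) ℂ V)
    {k : Module.Dual ℂ (⋀[ℂ]^3 V)} (hk : k ∈ conormal b) (w : ⋀[ℂ]^3 V) :
    lineDeriv ℂ (chartEquation b k) (chartPoint b) w = k w :=
  (hasDerivAt_chartEquation b hk w).deriv

/-- On the chart, y is decomposable when its square-rescaled multiple equals the wedge of its
homogenized frame. The leading and affine coordinates agree automatically, so only conormal forms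
have to be tested. -/
theorem isDecomposable_iff_chartEquation {α : Type*} [Fintype α]
    (b : Module.Basis (Fin 3 ⊕ α) ℂ V) {y : ⋀[ℂ]^3 V} (hy : chartCoordZero b y ≠ 0) :
    IsDecomposable y ↔ ∀ k ∈ conormal b, chartEquation b k y = 0 := by
  constructor
  · rintro ⟨w, -, rfl⟩ k -
    obtain ⟨A, hA, -⟩ := exists_chartFrame b w hy
    have h1 : ∀ i a, chartCoord b i a (wedge w) = chartCoordZero b (wedge w) * A i a := by
      intro i a
      conv_lhs => rw [hA]
      simp [chartCoord_chartFrame]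
    have h2 := wedge_chartFrame_smul b (chartCoordZero b (wedge w)) 1 A
    rw [mul_one] at h2
    simp only [chartEquation, h1, h2]
    have h3 : k (wedge w) = chartCoordZero b (wedge w) * k (wedge (chartFrame b 1 A)) := by
      conv_lhs => rw [hA]
      simp
    rw [h3, map_smul, smul_eq_mul]
    ring
  · intro h
    have h1 : chartCoordZero b y ^ 2 • y -
        wedge (chartFrame b (chartCoordZero b y) fun i a => chartCoord b i a y) = 0 := by
      refine eq_zero_of_chartCoord_eq_zero b ?_ (fun i a => ?_) fun τ hτ => ?_
      · rw [map_sub, map_smul, chartCoordZero_chartFrame, smul_eq_mul]; ring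
      · rw [map_sub, map_smul, chartCoord_chartFrame, smul_eq_mul]; ring
      · rw [map_sub, map_smul, smul_eq_mul]; exact h τ hτ
    have h2 : y = (chartCoordZero b y ^ 2)⁻¹ •
        wedge (chartFrame b (chartCoordZero b y) fun i a => chartCoord b i a y) := by
      rw [← sub_eq_zero.1 h1, smul_smul, inv_mul_cancel₀ (pow_ne_zero 2 hy), one_smul]
    have hy0 : y ≠ 0 := by rintro rfl; simp at hy
    rw [h2] at hy0 ⊢
    exact isDecomposable_smul_wedge hy0

theorem exists_basis_chartPoint_eq (hV : Module.finrank ℂ V = 10) {y : ⋀[ℂ]^3 V}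
    (hy : IsDecomposable y) : ∃ b : Module.Basis (Fin 3 ⊕ Fin 7) ℂ V, chartPoint b = y := by
  obtain ⟨w, hw, rfl⟩ := hy
  obtain ⟨b, rfl⟩ := exists_basis_extending hV hw
  exact ⟨b, rfl⟩

theorem linearIndependent_coe_dual {N : Type*} [AddCommGroup N] [Module ℂ N] {ι : Type*}
    {k : ι → Module.Dual ℂ N} (hk : LinearIndependent ℂ k) :
    LinearIndependent ℂ (fun i (w : N) => k i w) := by
  let T : Module.Dual ℂ N →ₗ[ℂ] (N → ℂ) :=
    { toFun := fun l w => l w, map_add' := fun _ _ => rfl, map_smul' := fun _ _ => rfl }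
  exact hk.map' T (LinearMap.ker_eq_bot.2 DFunLike.coe_injective)

theorem pluckerGrassmannian_inter_chart {α : Type*} [Fintype α]
    (b : Module.Basis (Fin 3 ⊕ α) ℂ V) {ι : Type*} [Fintype ι]
    (β : Module.Basis ι ℂ (conormal b)) {y : ℙ ℂ (⋀[ℂ]^3 V)} (hy : chartCoordZero b y.rep ≠ 0) :
    y ∈ pluckerGrassmannian 3 V ↔ ∀ i, chartEquation b (β i) y.rep = 0 := by
  rw [mem_pluckerGrassmannian_iff, isDecomposable_iff_chartEquation b hy]
  constructor
  · exact fun h i => h _ (β i).2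
  · intro h k hk
    have h1 : k = ∑ i, β.repr ⟨k, hk⟩ i • (β i : Module.Dual ℂ (⋀[ℂ]^3 V)) := by
      have := congrArg Subtype.val (β.sum_repr ⟨k, hk⟩)
      rw [AddSubmonoidClass.coe_finsetSum] at this
      exact this.symm
    generalize hc : (fun i => β.repr ⟨k, hk⟩ i) = c at h1
    have h2 : ∀ i, β.repr ⟨k, hk⟩ i = c i := fun i => congrFun hc i
    simp only [h2] at h1
    rw [h1]
    simp only [chartEquation] at h
    simp only [chartEquation, LinearMap.sum_apply, LinearMap.smul_apply, smul_eq_mul,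
      Finset.mul_sum, ← Finset.sum_sub_distrib]
    refine Finset.sum_eq_zero fun i _ => ?_
    linear_combination (c i) * h i

/-- The chart equations of a basis of the conormal space have that basis as differentials at the
centre. -/
theorem isSmoothPoint_pluckerGrassmannian (hV : Module.finrank ℂ V = 10) {x : ℙ ℂ (⋀[ℂ]^3 V)}
    (hx : x ∈ pluckerGrassmannian 3 V) : IsSmoothPoint (pluckerGrassmannian 3 V) x := by
  have : FiniteDimensional ℂ V := Module.finite_of_finrank_pos (by omega)
  obtain ⟨b, hb⟩ := exists_basis_chartPoint_eq hV (mem_pluckerGrassmannian_iff.1 hx)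
  let β := Module.finBasis ℂ (conormal b)
  refine ⟨hx, _, fun _ => 3, fun i => chartEquation b (β i), (projZeros (chartCoordZero b))ᶜ,
    fun i => isForm_chartEquation b _, isZariskiOpen_compl_projZeros (isForm_linear _), ?_, ?_, ?_⟩
  · simp [projZeros, ← hb, chartCoordZero_chartPoint]
  · ext y
    simp only [Set.mem_inter_iff, Set.mem_compl_iff, Set.mem_iInter, mem_projZeros]
    exact and_congr_left fun hy => pluckerGrassmannian_inter_chart b β hy
  · have h1 : (fun i w => lineDeriv ℂ (chartEquation b (β i)) x.rep w) = fun i w => (β i).1 w := by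
      ext i w
      rw [← hb, lineDeriv_chartEquation b (β i).2]
    rw [h1]
    exact linearIndependent_coe_dual
      (β.linearIndependent.map' (conormal b).subtype (Submodule.ker_subtype _))

/-- Adjoining σ to the chart equations keeps the differentials independent exactly because σ is not
conormal. -/
theorem isSmoothPoint_hyperplaneSection [FiniteDimensional ℂ V] {x : ℙ ℂ (⋀[ℂ]^3 V)}
    {σ : Module.Dual ℂ (⋀[ℂ]^3 V)} (hx : x ∈ hyperplaneSection (pluckerGrassmannian 3 V) σ)
    {α : Type*} [Fintype α] {b : Module.Basis (Fin 3 ⊕ α) ℂ V} (hb : chartPoint b = x.rep)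
    (hσ : σ ∉ conormal b) : IsSmoothPoint (hyperplaneSection (pluckerGrassmannian 3 V) σ) x := by
  let β := Module.finBasis ℂ (conormal b)
  refine ⟨hx, _, Fin.cons 1 fun _ => 3, Fin.cons (fun v => σ v) fun i => chartEquation b (β i),
    (projZeros (chartCoordZero b))ᶜ,
    Fin.cases (isForm_linear σ) fun i => isForm_chartEquation b _,
    isZariskiOpen_compl_projZeros (isForm_linear _), ?_, ?_, ?_⟩
  · simp [projZeros, ← hb, chartCoordZero_chartPoint]
  · ext y
    simp only [Set.mem_inter_iff, Set.mem_compl_iff, Set.mem_iInter, mem_projZeros,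
      Fin.forall_fin_succ, Fin.cons_zero, Fin.cons_succ, hyperplaneSection, Set.mem_ofPred_eq]
    refine and_congr_left fun hy => ?_
    rw [pluckerGrassmannian_inter_chart b β hy, and_comm]
  · let k : Fin (_ + 1) → Module.Dual ℂ (⋀[ℂ]^3 V) :=
      Fin.cons σ fun i => (β i : Module.Dual ℂ (⋀[ℂ]^3 V))
    have h1 : (fun i w => lineDeriv ℂ ((Fin.cons (fun v => σ v) fun i => chartEquation b (β i) :
        Fin (_ + 1) → (⋀[ℂ]^3 V) → ℂ) i) x.rep w) = fun i w => k i w := by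
      ext i w
      refine Fin.cases ?_ (fun i => ?_) i
      · exact (hasWeakDerivAt_line x.rep w 0 σ).deriv
      · rw [← hb]
        exact lineDeriv_chartEquation b (β i).2 w
    rw [h1]
    refine linearIndependent_coe_dual (linearIndependent_finCons.2 ⟨β.linearIndependent.map'
      (conormal b).subtype (Submodule.ker_subtype _), fun h => hσ ?_⟩)
    refine (Submodule.span_le.2 ?_ : _ ≤ conormal b) h
    rintro _ ⟨i, rfl⟩
    exact (β i).2

/-- The forms vanishing on the embedded tangent space of the Grassmannian. -/
theorem forall_embTangent_iff [FiniteDimensional ℂ V] {x : ℙ ℂ (⋀[ℂ]^3 V)}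
    {α : Type*} [Fintype α] {b : Module.Basis (Fin 3 ⊕ α) ℂ V} (hb : chartPoint b = x.rep)
    (σ : Module.Dual ℂ (⋀[ℂ]^3 V)) :
    (∀ w ∈ embTangent (pluckerGrassmannian 3 V) x, σ w = 0) ↔ σ ∈ conormal b := by
  constructor
  · intro h
    refine ⟨h _ fun d f hf hX => ?_, fun i a => h _ fun d f hf hX => ?_⟩
    · rw [hb]
      refine lineDeriv_self_of_isForm hf (hX ?_)
      rw [mem_pluckerGrassmannian_iff, ← hb]
      exact ⟨_, b.linearIndependent.comp _ Sum.inl_injective, rfl⟩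
    -- The line from the centre in a tangent direction lies in the Grassmannian: only one vector of
    -- the frame moves.
    · have h1 : (fun t : ℂ => f (x.rep + t • chartTangent b i a)) = fun _ => 0 := by
        ext t
        have h2 : x.rep + t • chartTangent b i a = wedge (Function.update
            (fun i => b (Sum.inl i)) i (b (Sum.inl i) + t • b (Sum.inr a))) := by
          rw [← hb, wedge, AlternatingMap.map_update_add, AlternatingMap.map_update_smul,
            Function.update_eq_self_iff.2 rfl]
          rfl
        have h3 : chartCoordZero b (x.rep + t • chartTangent b i a) ≠ 0 := by
          rw [← hb, map_add, map_smul, chartCoordZero_chartPoint, chartCoordZero_chartTangent]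
          simp
        have h4 : x.rep + t • chartTangent b i a ≠ 0 := by
          intro h4; rw [h4, map_zero] at h3; exact h3 rfl
        rw [← hf.rep_mk_eq_zero_iff h4]
        refine hX ((mk_mem_pluckerGrassmannian_iff h4).2 ?_)
        exact ⟨_, linearIndependent_of_wedge_ne_zero (by rw [← h2]; exact h4), h2.symm⟩
      rw [lineDeriv, h1, deriv_const]
  · intro hσ w hw
    -- The factor makes the chart equation vanish on the whole Grassmannian. It equals 1 at the
    -- centre, where the equation vanishes, so the differential is unchanged.
    have h1 := hw _ (fun y => chartCoordZero b y * chartEquation b σ y)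
      ((isForm_linear _).mul (isForm_chartEquation b σ)) (fun y hy => by
        rw [mem_projZeros]
        by_cases h0 : chartCoordZero b y.rep = 0
        · rw [h0, zero_mul]
        · rw [(isDecomposable_iff_chartEquation b h0).1
            ((mem_pluckerGrassmannian_iff).1 hy) σ hσ, mul_zero])
    have h2 : HasDerivAt (fun t : ℂ => chartCoordZero b (chartPoint b + t • w))
        (chartCoordZero b w) 0 := hasWeakDerivAt_line _ _ 0 (chartCoordZero b)
    have h3 := (h2.mul (hasDerivAt_chartEquation b hσ w)).deriv
    rw [← hb, lineDeriv] at h1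
    have h4 : chartEquation b σ (chartPoint b) = 0 := by
      refine (isDecomposable_iff_chartEquation b ?_).1 ?_ σ hσ
      · rw [chartCoordZero_chartPoint]; exact one_ne_zero
      · exact ⟨_, b.linearIndependent.comp _ Sum.inl_injective, rfl⟩
    have h5 := h3.symm.trans h1
    simpa [h4, chartCoordZero_chartPoint] using h5

end Grassmannian

/-! ### The singularity of a hyperplane section at a point of nondegenerate tangency. -/

section Singular

variable {V : Type*} [AddCommGroup V] [Module ℂ V]

theorem lieAct₂_wedge (C : V →ₗ[ℂ] V) (x : Fin 3 → V) :
    lieAct₂ C (wedge x) = ∑ i, wedge (Function.update (fun j => C (x j)) i (x i)) := by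
  have h1 := map_one_add_smul_wedge C x 1
  rw [one_smul] at h1
  simp only [lieAct₂, LinearMap.sub_apply, h1, map_wedge, lieAct_wedge, Module.End.one_apply]
  module

theorem wedge_zero₀ (y z : V) : wedge ![0, y, z] = 0 := by
  simpa using wedge_smul₀ 0 (0 : V) y z

theorem wedge_zero₁ (y z : V) : wedge ![y, 0, z] = 0 := by
  simpa using wedge_smul₁ 0 y (0 : V) z

theorem wedge_zero₂ (y z : V) : wedge ![y, z, 0] = 0 := by
  simpa using wedge_smul₂ 0 y z (0 : V)

/-- Composing the two derivations gives the mixed terms together with CD acting in a single slot,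
and the latter vanish since CD = 0. -/
theorem lieAct₂_add_smul {C D : V →ₗ[ℂ] V} (h : C * D = 0) (s : ℂ) :
    lieAct₂ (C + s • D) = lieAct₂ C + s • (lieAct C * lieAct D) + s ^ 2 • lieAct₂ D := by
  apply linearMap_ext_wedge
  intro x
  have hCD : ∀ v, C (D v) = 0 := fun v => congrArg (fun f : V →ₗ[ℂ] V => f v) h
  simp only [LinearMap.add_apply, LinearMap.smul_apply, Module.End.mul_apply, lieAct₂_wedge,
    lieAct_wedge, map_sum]
  rw [fin_three_eta x, fin_three_eta (fun j => C _ + s • D _), fin_three_eta (fun j => C _),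
    fin_three_eta (fun j => D _)]
  simp only [Fin.sum_univ_three, Matrix.cons_val_zero, Matrix.cons_val_one, Matrix.cons_val,
    update_zero, update_one, update_two, hCD, wedge_zero₀, wedge_zero₁, wedge_zero₂,
    wedge_add₀, wedge_add₁, wedge_add₂, wedge_smul₀, wedge_smul₁, wedge_smul₂]
  module

theorem wedge_chartFrame_one {α : Type*} [Fintype α] (b : Module.Basis (Fin 3 ⊕ α) ℂ V)
    (A : Fin 3 → α → ℂ) :
    wedge (chartFrame b 1 A) = exteriorPower.map 3 (1 + chartEnd b A) (chartPoint b) := by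
  rw [chartPoint, map_wedge]
  congr 1
  ext1 i
  simp [chartFrame_eq]

theorem wedge_chartFrame_one_smul {α : Type*} [Fintype α] (b : Module.Basis (Fin 3 ⊕ α) ℂ V)
    (A : Fin 3 → α → ℂ) (t : ℂ) :
    wedge (chartFrame b 1 (t • A)) = chartPoint b + t • lieAct (chartEnd b A) (chartPoint b) +
      t ^ 2 • lieAct₂ (chartEnd b A) (chartPoint b) +
      t ^ 3 • exteriorPower.map 3 (chartEnd b A) (chartPoint b) := by
  rw [wedge_chartFrame_one, map_smul, map_one_add_smul]
  rfl

theorem hasWeakDerivAt_wedge_chartFrame {α : Type*} [Fintype α]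
    (b : Module.Basis (Fin 3 ⊕ α) ℂ V) (A : Fin 3 → α → ℂ) (z : ⋀[ℂ]^3 V) :
    HasWeakDerivAt (fun t : ℂ => wedge (chartFrame b 1 (t • A)) + t • z)
      (lieAct (chartEnd b A) (chartPoint b) + z) 0 := by
  have h : (fun t : ℂ => wedge (chartFrame b 1 (t • A)) + t • z) = fun t : ℂ => chartPoint b +
      t • (lieAct (chartEnd b A) (chartPoint b) + z) +
      t ^ 2 • lieAct₂ (chartEnd b A) (chartPoint b) +
      t ^ 3 • exteriorPower.map 3 (chartEnd b A) (chartPoint b) + t ^ 4 • (0 : ⋀[ℂ]^3 V) := by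
    ext1 t
    rw [wedge_chartFrame_one_smul]
    module
  rw [h]
  exact hasWeakDerivAt_quartic _ _ _ _ _

/-- The quadratic part of a conormal form in a chart. -/
noncomputable def chartQuadratic {α : Type*} [Fintype α] (b : Module.Basis (Fin 3 ⊕ α) ℂ V)
    (σ : Module.Dual ℂ (⋀[ℂ]^3 V)) (A : Fin 3 → α → ℂ) : ℂ :=
  σ (lieAct₂ (chartEnd b A) (chartPoint b))

/-- The cubic part of a conormal form in a chart. -/
noncomputable def chartCubic {α : Type*} [Fintype α] (b : Module.Basis (Fin 3 ⊕ α) ℂ V)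
    (σ : Module.Dual ℂ (⋀[ℂ]^3 V)) (A : Fin 3 → α → ℂ) : ℂ :=
  σ (exteriorPower.map 3 (chartEnd b A) (chartPoint b))

/-- The polar form of the quadratic part of a conormal form in a chart. -/
noncomputable def chartPolar {α : Type*} [Fintype α] (b : Module.Basis (Fin 3 ⊕ α) ℂ V)
    (σ : Module.Dual ℂ (⋀[ℂ]^3 V)) : (Fin 3 → α → ℂ) →ₗ[ℂ] (Fin 3 → α → ℂ) →ₗ[ℂ] ℂ :=
  LinearMap.mk₂ ℂ (fun A B => σ (lieAct (chartEnd b A) (lieAct (chartEnd b B) (chartPoint b))))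
    (by simp [lieAct_add]) (by simp [lieAct_smul]) (by simp [lieAct_add]) (by simp [lieAct_smul])

theorem chartPolar_apply {α : Type*} [Fintype α] (b : Module.Basis (Fin 3 ⊕ α) ℂ V)
    (σ : Module.Dual ℂ (⋀[ℂ]^3 V)) (A B : Fin 3 → α → ℂ) : chartPolar b σ A B =
      σ (lieAct (chartEnd b A) (lieAct (chartEnd b B) (chartPoint b))) := rfl

theorem lieAct_single_chartPoint {α : Type*} [Fintype α] [DecidableEq α]
    (b : Module.Basis (Fin 3 ⊕ α) ℂ V) (i : Fin 3) (a : α) :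
    lieAct (chartEnd b (Pi.single i (Pi.single a 1))) (chartPoint b) = chartTangent b i a := by
  rw [lieAct_chartPoint, Finset.sum_eq_single i, Finset.sum_eq_single a]
  · simp
  · intro c _ hc; simp [hc]
  · simp
  · intro j _ hj; simp [hj]
  · simp

theorem chartHessian_eq_zero_of_chartPolar {α : Type*} [Fintype α]
    (b : Module.Basis (Fin 3 ⊕ α) ℂ V) (σ : Module.Dual ℂ (⋀[ℂ]^3 V)) {A : Fin 3 → α → ℂ}
    (h : ∀ B, chartPolar b σ A B = 0) : chartHessian b σ A = 0 := by
  classical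
  ext i a
  rw [chartHessian_apply, ← lieAct_single_chartPoint]
  exact h _

theorem chartQuadratic_add_smul {α : Type*} [Fintype α] (b : Module.Basis (Fin 3 ⊕ α) ℂ V)
    (σ : Module.Dual ℂ (⋀[ℂ]^3 V)) (A B : Fin 3 → α → ℂ) (s : ℂ) :
    chartQuadratic b σ (A + s • B) =
      chartQuadratic b σ A + s * chartPolar b σ A B + s ^ 2 * chartQuadratic b σ B := by
  simp only [chartQuadratic, chartPolar_apply, map_add, map_smul,
    lieAct₂_add_smul (chartEnd_comp_self b A B), LinearMap.add_apply, LinearMap.smul_apply,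
    Module.End.mul_apply, smul_eq_mul]

theorem chartQuadratic_zero {α : Type*} [Fintype α] (b : Module.Basis (Fin 3 ⊕ α) ℂ V)
    (σ : Module.Dual ℂ (⋀[ℂ]^3 V)) : chartQuadratic b σ 0 = 0 := by
  simp only [chartQuadratic, chartPoint, map_zero, lieAct₂_wedge, LinearMap.zero_apply]
  rw [fin_three_eta (fun j => (0 : V))]
  simp [Fin.sum_univ_three, update_zero, update_one, update_two, wedge_zero₀, wedge_zero₁]

theorem chartCubic_smul {α : Type*} [Fintype α] (b : Module.Basis (Fin 3 ⊕ α) ℂ V)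
    (σ : Module.Dual ℂ (⋀[ℂ]^3 V)) (t : ℂ) (A : Fin 3 → α → ℂ) :
    chartCubic b σ (t • A) = t ^ 3 * chartCubic b σ A := by
  have := (exteriorPower.ιMulti ℂ 3 (M := V)).toMultilinearMap.map_smul_univ (fun _ => t)
    (fun i => chartEnd b A (b (Sum.inl i)))
  simp only [chartCubic, chartPoint, map_wedge, map_smul, LinearMap.smul_apply]
  rw [← smul_eq_mul, ← map_smul]
  exact congrArg σ (this.trans (by simp))

theorem chartCubic_mem_polyFun [FiniteDimensional ℂ V] {α : Type*} [Fintype α]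
    (b : Module.Basis (Fin 3 ⊕ α) ℂ V) (σ : Module.Dual ℂ (⋀[ℂ]^3 V)) :
    chartCubic b σ ∈ polyFun (Fin 3 → α → ℂ) :=
  isPolyMap_map (C := fun A => chartEnd b A)
    (fun v => isPolyMap_linear ((chartEnd b).flip v)) (isPolyMap_const _) σ

/-- For a conormal form the constant and linear terms of the expansion in the chart disappear. -/
theorem apply_wedge_chartFrame {α : Type*} [Fintype α] {b : Module.Basis (Fin 3 ⊕ α) ℂ V}
    {σ : Module.Dual ℂ (⋀[ℂ]^3 V)} (hσ : σ ∈ conormal b) (A : Fin 3 → α → ℂ) :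
    σ (wedge (chartFrame b 1 A)) = chartQuadratic b σ A + chartCubic b σ A := by
  have h := wedge_chartFrame_one_smul b A 1
  rw [one_smul, lieAct_chartPoint] at h
  rw [h]
  simp [hσ.1, hσ.2, chartQuadratic, chartCubic]

theorem isPolyMap_wedge_chartFrame_one [FiniteDimensional ℂ V] {α : Type*} [Fintype α]
    (b : Module.Basis (Fin 3 ⊕ α) ℂ V) :
    IsPolyMap (fun A : Fin 3 → α → ℂ => wedge (chartFrame b 1 A)) :=
  isPolyMap_wedge_chartFrame b (const_mem_polyFun 1) fun i a =>
    linear_mem_polyFun (LinearMap.proj a ∘ₗ LinearMap.proj (R := ℂ) (φ := fun _ => α → ℂ) i)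

/-- Homogeneity lifts the local equations to the affine cone and makes their differentials kill the
radial direction; the neighbourhood shrinks to a basic open set u ≠ 0. -/
theorem IsSmoothPoint.exists_local_equations {N : Type*} [AddCommGroup N] [Module ℂ N]
    {X : Set (ℙ ℂ N)} {x : ℙ ℂ N} (h : IsSmoothPoint X x) :
    ∃ (c : ℕ) (f : Fin c → N → ℂ) (u : N → ℂ), (∀ i, f i ∈ polyFun N) ∧ u ∈ polyFun N ∧
      u x.rep ≠ 0 ∧ (∀ i, f i x.rep = 0) ∧ (∀ i, lineDeriv ℂ (f i) x.rep x.rep = 0) ∧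
      (∀ y, u y ≠ 0 → ∀ hy : y ≠ 0,
        (Projectivization.mk ℂ y hy ∈ X ↔ ∀ i, f i y = 0)) ∧
      LinearIndependent ℂ (fun (i : Fin c) (w : N) => lineDeriv ℂ (f i) x.rep w) := by
  obtain ⟨hx, c, d, f, U, hf, hU, hxU, hXU, hli⟩ := h
  obtain ⟨e, u, hu, hux, huU⟩ := hU.exists_form hxU
  have hfx : ∀ i, f i x.rep = 0 := fun i =>
    Set.mem_iInter.1 ((Set.ext_iff.1 hXU x).1 ⟨hx, hxU⟩).1 i
  refine ⟨c, f, u, fun i => (hf i).1, hu.1, hux, hfx,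
    fun i => lineDeriv_self_of_isForm (hf i) (hfx i), fun y huy hy => ?_, hli⟩
  have hyU : Projectivization.mk ℂ y hy ∈ U :=
    huU fun h => huy ((hu.rep_mk_eq_zero_iff hy).1 h)
  have := Set.ext_iff.1 hXU (Projectivization.mk ℂ y hy)
  simp only [Set.mem_inter_iff, hyU, and_true, Set.mem_iInter, mem_projZeros] at this
  rw [this]
  exact forall_congr' fun i => (hf i).rep_mk_eq_zero_iff hy

theorem exists_dual_vectors {N : Type*} [AddCommGroup N] [Module ℂ N] [FiniteDimensional ℂ N]
    {c : ℕ} {D : Fin c → Module.Dual ℂ N} (hD : LinearIndependent ℂ D) :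
    ∃ v : Fin c → N, ∀ i j, D i (v j) = if i = j then 1 else 0 := by
  classical
  have hinj : Function.Injective (Fintype.linearCombination ℂ D) := hD.fintypeLinearCombination_injective
  have hv : ∀ j : Fin c, ∃ v : N, ∀ i, D i v = if i = j then 1 else 0 := by
    intro j
    obtain ⟨Φ, hΦ⟩ := LinearMap.dualMap_surjective_of_injective hinj (LinearMap.proj j)
    obtain ⟨v, rfl⟩ := (Module.evalEquiv ℂ N).surjective Φ
    refine ⟨v, fun i => ?_⟩
    have := congrArg (fun l => l (Pi.single i 1)) hΦ
    simpa [Pi.single_apply, eq_comm] using this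
  choose v hv using hv
  exact ⟨v, fun i j => hv j i⟩

theorem ne_zero_of_chartCoordZero_eq_one {α : Type*} {b : Module.Basis (Fin 3 ⊕ α) ℂ V}
    {y : ⋀[ℂ]^3 V} (h : chartCoordZero b y = 1) : y ≠ 0 := by
  rintro rfl
  simp at h

theorem chartCoordZero_chartFrame_one {α : Type*} [Fintype α] (b : Module.Basis (Fin 3 ⊕ α) ℂ V)
    (A : Fin 3 → α → ℂ) : chartCoordZero b (wedge (chartFrame b 1 A)) = 1 := by
  rw [chartCoordZero_chartFrame, one_pow]

theorem wedge_chartFrame_one_zero {α : Type*} [Fintype α] (b : Module.Basis (Fin 3 ⊕ α) ℂ V) :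
    wedge (chartFrame b 1 0) = chartPoint b := by
  rw [chartFrame_one_zero]; rfl

theorem eventually_ne_zero_chart [FiniteDimensional ℂ V] {α : Type*} [Fintype α]
    {b : Module.Basis (Fin 3 ⊕ α) ℂ V} {u : (⋀[ℂ]^3 V) → ℂ} (hu : u ∈ polyFun (⋀[ℂ]^3 V))
    (hub : u (chartPoint b) ≠ 0) :
    ∀ᶠ A in nhds (0 : Fin 3 → α → ℂ), u (wedge (chartFrame b 1 A)) ≠ 0 :=
  (contDiff_of_mem_polyFun ((isPolyMap_wedge_chartFrame_one b).comp_mem hu)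
    (n := 1)).continuous.continuousAt.eventually_ne
      (by simpa only [wedge_chartFrame_one_zero] using hub)

/-- The differential of an equation of a hyperplane section with nondegenerate Hessian kills the
tangent space of the Grassmannian. -/
theorem differential_chartTangent_eq_zero [FiniteDimensional ℂ V]
    {σ : Module.Dual ℂ (⋀[ℂ]^3 V)} {b : Module.Basis (Fin 3 ⊕ Fin 7) ℂ V} (hσ : σ ∈ conormal b)
    (hinj : Function.Injective (chartHessian b σ)) {g : (⋀[ℂ]^3 V) → ℂ}
    (hg : g ∈ polyFun (⋀[ℂ]^3 V)) {D : Module.Dual ℂ (⋀[ℂ]^3 V)}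
    (hD : ∀ (γ : ℂ → ⋀[ℂ]^3 V) γ', γ 0 = chartPoint b → HasWeakDerivAt γ γ' 0 →
      HasDerivAt (fun s => g (γ s)) (D γ') 0)
    (h : ∀ᶠ A in nhds (0 : Fin 3 → Fin 7 → ℂ), σ (wedge (chartFrame b 1 A)) = 0 →
      g (wedge (chartFrame b 1 A)) = 0) (A : Fin 3 → Fin 7 → ℂ) :
    D (lieAct (chartEnd b A) (chartPoint b)) = 0 := by
  have hpolar : ∀ A, (∀ B, chartPolar b σ A B = 0) → A = 0 := fun A hA =>
    hinj (by rw [chartHessian_eq_zero_of_chartPolar b σ hA, map_zero])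
  have hgd : DifferentiableAt ℂ (fun A => g (wedge (chartFrame b 1 A))) 0 :=
    (contDiff_of_mem_polyFun ((isPolyMap_wedge_chartFrame_one b).comp_mem hg)
      (n := 1)).differentiable one_ne_zero 0
  have h0 := fderiv_eq_zero_of_vanishing_on_cone (chartPolar b σ) hpolar
    (by simp [Module.finrank_pi_fintype])
    (chartQuadratic_add_smul b σ) (chartQuadratic_zero b σ) (chartCubic_mem_polyFun b σ)
    (chartCubic_smul b σ) hgd (by
      filter_upwards [h] with A hA h
      rw [← apply_wedge_chartFrame hσ] at h
      exact hA h)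
  have h1 := hD (fun t : ℂ => wedge (chartFrame b 1 (t • A)) + t • (0 : ⋀[ℂ]^3 V)) _
    (by simp [wedge_chartFrame_one_zero]) (hasWeakDerivAt_wedge_chartFrame b A 0)
  have h2 := (hgd.hasFDerivAt.hasLineDerivAt A).lineDeriv
  rw [h0, lineDeriv] at h2
  simp only [smul_zero, add_zero, zero_add] at h1 h2
  exact h1.deriv.symm.trans h2

/-- Dual vectors to the D i are stripped of their components along the centre and its tangent
vectors, which conormal forms do not see. -/
theorem exists_transversal [FiniteDimensional ℂ V] {α : Type*} [Fintype α]
    (b : Module.Basis (Fin 3 ⊕ α) ℂ V) {c : ℕ} {D : Fin c → Module.Dual ℂ (⋀[ℂ]^3 V)}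
    (hD : LinearIndependent ℂ D) (hDc : ∀ i, D i ∈ conormal b) :
    ∃ κ : (Fin c → ℂ) →ₗ[ℂ] ⋀[ℂ]^3 V, (∀ k, chartCoordZero b (κ k) = 0) ∧
      (∀ k i a, chartCoord b i a (κ k) = 0) ∧ ∀ k i, D i (κ k) = k i := by
  classical
  obtain ⟨v, hv⟩ := exists_dual_vectors hD
  refine ⟨Fintype.linearCombination ℂ fun j => v j - (chartCoordZero b (v j) • chartPoint b +
    ∑ i, ∑ a, chartCoord b i a (v j) • chartTangent b i a), ?_, ?_, ?_⟩
  · intro k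
    simp [Fintype.linearCombination_apply, chartCoordZero_chartPoint, chartCoordZero_chartTangent]
  · intro k i a
    simp [Fintype.linearCombination_apply, chartCoord_chartPoint, chartCoord_chartTangent, ite_and]
  · intro k i
    obtain ⟨h1, h2⟩ := hDc i
    rw [Fintype.linearCombination_apply, map_sum]
    simp only [map_smul, map_sub, map_add, map_sum, h1, h2, hv, smul_zero, add_zero, sub_zero,
      Finset.sum_const_zero]
    simp

/-- The equations with differentials in the conormal space can be solved over the chart. -/
theorem eventually_exists_solution [FiniteDimensional ℂ V] {α : Type*} [Fintype α]
    (b : Module.Basis (Fin 3 ⊕ α) ℂ V) {c : ℕ} {f : Fin c → (⋀[ℂ]^3 V) → ℂ}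
    {u : (⋀[ℂ]^3 V) → ℂ} (hf : ∀ i, f i ∈ polyFun (⋀[ℂ]^3 V)) (hu : u ∈ polyFun (⋀[ℂ]^3 V))
    (hfb : ∀ i, f i (chartPoint b) = 0) (hub : u (chartPoint b) ≠ 0)
    {D : Fin c → Module.Dual ℂ (⋀[ℂ]^3 V)}
    (hD : ∀ i (γ : ℂ → ⋀[ℂ]^3 V) γ', γ 0 = chartPoint b → HasWeakDerivAt γ γ' 0 →
      HasDerivAt (fun s => f i (γ s)) (D i γ') 0)
    (hDli : LinearIndependent ℂ D) (hDc : ∀ i, D i ∈ conormal b) :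
    ∀ᶠ A in nhds (0 : Fin 3 → α → ℂ), ∃ y, chartCoordZero b y = 1 ∧
      (∀ i a, chartCoord b i a y = A i a) ∧ u y ≠ 0 ∧ ∀ i, f i y = 0 := by
  obtain ⟨κ, hκ0, hκ1, hκD⟩ := exists_transversal b hDli hDc
  let P : (Fin 3 → α → ℂ) × (Fin c → ℂ) → ⋀[ℂ]^3 V :=
    fun z => wedge (chartFrame b 1 z.1) + κ z.2
  have hP1 : IsPolyMap fun z : (Fin 3 → α → ℂ) × (Fin c → ℂ) => wedge (chartFrame b 1 z.1) :=
    (isPolyMap_wedge_chartFrame_one b).comp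
      (isPolyMap_linear (LinearMap.fst ℂ (Fin 3 → α → ℂ) (Fin c → ℂ)))
  have hP2 : IsPolyMap fun z : (Fin 3 → α → ℂ) × (Fin c → ℂ) => κ z.2 :=
    isPolyMap_linear (κ ∘ₗ LinearMap.snd ℂ (Fin 3 → α → ℂ) (Fin c → ℂ))
  have hP : IsPolyMap P := hP1.add hP2
  have hP0 : P 0 = chartPoint b := by simp [P, wedge_chartFrame_one_zero]
  -- Chart parameter together with the values of the equations. The derivative at the origin is the
  -- identity, so F is open there and (A, 0) is attained for all small A, with u still nonzero.
  let F : (Fin 3 → α → ℂ) × (Fin c → ℂ) → (Fin 3 → α → ℂ) × (Fin c → ℂ) :=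
    fun z => (z.1, fun i => f i (P z))
  have hFc : ContDiff ℂ 1 F := contDiff_fst.prodMk
    (contDiff_pi.2 fun i => contDiff_of_mem_polyFun (hP.comp_mem (hf i)))
  have hF0 : F 0 = 0 := by
    simp only [F, hP0, hfb]; rfl
  have hFd : ∀ z, fderiv ℂ F 0 z = z := by
    intro z
    have h1 := ((hFc.differentiable one_ne_zero 0).hasFDerivAt.hasLineDerivAt z)
    refine HasDerivAt.unique h1 ?_
    have h2 : HasDerivAt (fun t : ℂ => (0 : Fin 3 → α → ℂ) + t • z.1) z.1 0 := by
      simpa using ((hasDerivAt_id (0 : ℂ)).smul_const z.1).const_add 0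
    have h3 : ∀ i, HasDerivAt (fun t : ℂ => f i (P (0 + t • z))) (z.2 i) 0 := by
      intro i
      have h4 := hD i (fun t : ℂ => wedge (chartFrame b 1 (t • z.1)) + t • κ z.2) _
        (by simp [wedge_chartFrame_one_zero]) (hasWeakDerivAt_wedge_chartFrame b z.1 (κ z.2))
      rw [map_add, hκD, lieAct_chartPoint] at h4
      simpa [P, (hDc i).2] using h4
    exact h2.prodMk (hasDerivAt_pi.2 h3)
  have hmap := (hFc.contDiffAt.hasStrictFDerivAt one_ne_zero).map_nhds_eq_of_surj
    (LinearMap.range_eq_top.2 fun z => ⟨z, hFd z⟩)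
  have huP : ∀ᶠ z in nhds 0, u (P z) ≠ 0 :=
    (contDiff_of_mem_polyFun (hP.comp_mem hu) (n := 1)).continuous.continuousAt.eventually_ne
      (by simpa only [hP0] using hub)
  have himg : F '' {z | u (P z) ≠ 0} ∈ nhds (0 : (Fin 3 → α → ℂ) × (Fin c → ℂ)) := by
    have := Filter.image_mem_map (m := F) huP
    rwa [hmap, hF0] at this
  have hc : Filter.Tendsto (fun A : Fin 3 → α → ℂ => (A, (0 : Fin c → ℂ))) (nhds 0) (nhds 0) := by
    have : Continuous fun A : Fin 3 → α → ℂ => (A, (0 : Fin c → ℂ)) := by fun_prop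
    exact this.tendsto 0
  filter_upwards [hc himg] with A hA
  obtain ⟨⟨A', k⟩, hz, hzA⟩ := hA
  obtain ⟨h1, hfz⟩ := Prod.ext_iff.1 hzA
  obtain rfl : A' = A := h1
  refine ⟨P (A', k), ?_, fun i a => ?_, hz, fun i => congrFun hfz i⟩
  · simp [P, chartCoordZero_chartFrame, hκ0]
  · simp [P, chartCoord_chartFrame, hκ1]

theorem IsDecomposable.eq_wedge_chartFrame {α : Type*} [Fintype α]
    {b : Module.Basis (Fin 3 ⊕ α) ℂ V} {y : ⋀[ℂ]^3 V} (hy : IsDecomposable y)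
    (h0 : chartCoordZero b y = 1) {A : Fin 3 → α → ℂ} (h1 : ∀ i a, chartCoord b i a y = A i a) :
    y = wedge (chartFrame b 1 A) := by
  obtain ⟨w, -, rfl⟩ := hy
  obtain ⟨B, hB, -⟩ := exists_chartFrame b w (by rw [h0]; exact one_ne_zero)
  rw [h0, one_smul] at hB
  rw [hB]
  congr 2
  ext i a
  rw [← h1, hB, chartCoord_chartFrame, one_pow, one_mul]

/-- If σ vanished on the chart, comparing A with −A would kill the quadratic part, hence its polar
form and the Hessian. -/
theorem exists_apply_wedge_chartFrame_ne_zero [FiniteDimensional ℂ V]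
    {σ : Module.Dual ℂ (⋀[ℂ]^3 V)} {b : Module.Basis (Fin 3 ⊕ Fin 7) ℂ V} (hσ : σ ∈ conormal b)
    (hinj : Function.Injective (chartHessian b σ)) :
    ∃ A, σ (wedge (chartFrame b 1 A)) ≠ 0 := by
  by_contra! hQ
  simp only [apply_wedge_chartFrame hσ] at hQ
  have hq : ∀ A, chartQuadratic b σ A = 0 := by
    intro A
    have h1 := hQ A
    have h2 := hQ ((-1 : ℂ) • A)
    have h3 := chartQuadratic_add_smul b σ 0 A (-1)
    rw [chartCubic_smul] at h2
    simp only [map_zero, LinearMap.zero_apply, zero_add, chartQuadratic_zero b σ] at h3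
    rw [h3] at h2
    linear_combination (1 / 2 : ℂ) * h1 + (1 / 2 : ℂ) * h2
  have hone : (fun _ _ => 1 : Fin 3 → Fin 7 → ℂ) = 0 := by
    refine hinj ?_
    rw [map_zero]
    refine chartHessian_eq_zero_of_chartPolar b σ fun B => ?_
    have h := chartQuadratic_add_smul b σ (fun _ _ => 1) B 1
    rw [hq, hq, hq] at h
    linear_combination -h
  exact one_ne_zero (congrFun (congrFun hone 0) 0)

/-- Equations of the section have differentials vanishing on the tangent space of G, by the
nondegenerate quadratic singularity. If independent, they can be solved over every small chart
parameter; the solutions lie on the section, so σ would vanish on an open part of G, hence on the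
whole chart. -/
theorem not_isSmoothPoint_hyperplaneSection [FiniteDimensional ℂ V] {x : ℙ ℂ (⋀[ℂ]^3 V)}
    {σ : Module.Dual ℂ (⋀[ℂ]^3 V)} {b : Module.Basis (Fin 3 ⊕ Fin 7) ℂ V}
    (hb : chartPoint b = x.rep) (hσ : σ ∈ conormal b)
    (hinj : Function.Injective (chartHessian b σ)) :
    ¬ IsSmoothPoint (hyperplaneSection (pluckerGrassmannian 3 V) σ) x := by
  intro hx
  obtain ⟨c, f, u, hf, hu, hux, hfx, hfxx, hloc, hli⟩ := hx.exists_local_equations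
  choose D hDl _ hD using fun i => exists_differential (hf i)
  rw [← hb] at hux
  simp only [← hb] at hfx hfxx hli
  have hloc' : ∀ y, u y ≠ 0 → y ≠ 0 → ((IsDecomposable y ∧ σ y = 0) ↔ ∀ i, f i y = 0) := by
    intro y huy hy
    rw [← hloc y huy hy, ← mk_mem_pluckerGrassmannian_iff hy,
      ← (isForm_linear σ).rep_mk_eq_zero_iff hy]
    rfl
  have hD' : ∀ i (γ : ℂ → ⋀[ℂ]^3 V) γ', γ 0 = chartPoint b → HasWeakDerivAt γ γ' 0 →
      HasDerivAt (fun s => f i (γ s)) (D i (chartPoint b) γ') 0 := by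
    intro i γ γ' h0 h
    rw [← h0]
    exact hD i γ γ' 0 h
  have hDc : ∀ i, D i (chartPoint b) ∈ conormal b := by
    refine fun i => ⟨by rw [← hDl]; exact hfxx i, fun j a => ?_⟩
    rw [← lieAct_single_chartPoint]
    refine differential_chartTangent_eq_zero hσ hinj (hf i) (hD' i) ?_ _
    filter_upwards [eventually_ne_zero_chart hu hux] with A hA h
    exact (hloc' _ hA (ne_zero_of_chartCoordZero_eq_one (chartCoordZero_chartFrame_one b A))).1
      ⟨⟨_, linearIndependent_chartFrame b A, rfl⟩, h⟩ i
  have hDli : LinearIndependent ℂ (fun i => D i (chartPoint b)) := by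
    simp only [hDl] at hli
    let T : Module.Dual ℂ (⋀[ℂ]^3 V) →ₗ[ℂ] ((⋀[ℂ]^3 V) → ℂ) :=
      { toFun := fun l w => l w, map_add' := fun _ _ => rfl, map_smul' := fun _ _ => rfl }
    exact LinearIndependent.of_comp T hli
  obtain ⟨A, hA⟩ := exists_apply_wedge_chartFrame_ne_zero hσ hinj
  refine hA (polyFun_eq_zero_of_eventually
    ((isPolyMap_wedge_chartFrame_one b).comp_mem (linear_mem_polyFun σ)) (a := 0) ?_ A)
  filter_upwards [eventually_exists_solution b hf hu hfx hux hD' hDli hDc] with A hA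
  obtain ⟨y, h0, h1, huy, hfy⟩ := hA
  obtain ⟨hy, hσy⟩ := (hloc' y huy (ne_zero_of_chartCoordZero_eq_one h0)).2 hfy
  rw [← hy.eq_wedge_chartFrame h0 h1]
  exact hσy

end Singular

/-! ### Identification of the dual variety and uniqueness of the singular point. -/

section Dual

variable {V : Type*} [AddCommGroup V] [Module ℂ V]

theorem exists_basis_chartPoint_eq_rep (hV : Module.finrank ℂ V = 10) {w : Fin 3 → V}
    (hw : wedge w ≠ 0) : ∃ b : Module.Basis (Fin 3 ⊕ Fin 7) ℂ V,
      chartPoint b = (Projectivization.mk ℂ (wedge w) hw).rep ∧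
      Submodule.span ℂ (Set.range fun i => b (Sum.inl i)) ≤ Submodule.span ℂ (Set.range w) := by
  obtain ⟨a, ha⟩ := Projectivization.exists_smul_eq_mk_rep ℂ (wedge w) hw
  have h1 : wedge ![a.1 • w 0, w 1, w 2] = (Projectivization.mk ℂ (wedge w) hw).rep := by
    rw [wedge_smul₀, ← fin_three_eta, ← ha]; rfl
  have h2 : LinearIndependent ℂ ![a.1 • w 0, w 1, w 2] :=
    linearIndependent_of_wedge_ne_zero (by rw [h1]; exact Projectivization.rep_nonzero _)
  obtain ⟨b, hb⟩ := exists_basis_extending hV h2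
  refine ⟨b, ?_, ?_⟩
  · rw [chartPoint, hb, h1]
  · rw [hb, Submodule.span_le]
    have hm : ∀ i, w i ∈ Submodule.span ℂ (Set.range w) := fun i => Submodule.subset_span ⟨i, rfl⟩
    rintro _ ⟨i, rfl⟩
    fin_cases i
    · exact Submodule.smul_mem _ _ (hm 0)
    · exact hm 1
    · exact hm 2

/-- All points of G are smooth, and the forms vanishing on the embedded tangent space are the
conormal ones, so the two sets agree before closure. -/
theorem dualVariety_pluckerGrassmannian (hV : Module.finrank ℂ V = 10) :
    dualVariety (pluckerGrassmannian 3 V) =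
      @closure _ (zariskiTopology (Module.Dual ℂ (⋀[ℂ]^3 V))) {φ | φ.rep ∈ tangentCone V} := by
  have : FiniteDimensional ℂ V := Module.finite_of_finrank_pos (by omega)
  rw [dualVariety]
  congr 1
  ext φ
  constructor
  · rintro ⟨x, hx, hφ⟩
    obtain ⟨b, hb⟩ := exists_basis_chartPoint_eq hV (mem_pluckerGrassmannian_iff.1 hx.1)
    exact conormal_le_tangentCone b ((forall_embTangent_iff hb _).1 hφ)
  · rintro ⟨W, hW, hφ⟩
    obtain ⟨w, hw, rfl⟩ := exists_linearIndependent_span hW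
    have hw0 := wedge_ne_zero hV hw
    obtain ⟨b, hb, hbw⟩ := exists_basis_chartPoint_eq_rep hV hw0
    exact ⟨_, isSmoothPoint_pluckerGrassmannian hV
      ((mk_mem_pluckerGrassmannian_iff hw0).2 ⟨w, hw, rfl⟩),
      (forall_embTangent_iff hb _).2 ((isTangentTo_iff_mem_conormal b _).1 (hφ.mono hbw))⟩

theorem morseForm_ne_zero (b : Module.Basis (Fin 3 ⊕ Fin 7) ℂ V) : morseForm b ≠ 0 := by
  intro h
  have h1 := injective_chartHessian_morseForm b (a₁ := fun _ _ => 1) (a₂ := 0) (by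
    ext i a; simp [chartHessian_apply, h])
  exact one_ne_zero (congrFun (congrFun h1 0) 0)

theorem exists_ne_zero_mem_tangentCone (hV : Module.finrank ℂ V = 10) :
    ∃ σ ∈ tangentCone V, σ ≠ 0 := by
  have : FiniteDimensional ℂ V := Module.finite_of_finrank_pos (by omega)
  let b : Module.Basis (Fin 3 ⊕ Fin 7) ℂ V :=
    (Module.finBasisOfFinrankEq ℂ V hV).reindex (finSumFinEquiv (m := 3) (n := 7)).symm
  exact ⟨_, conormal_le_tangentCone b (morseForm_mem_conormal b), morseForm_ne_zero b⟩

theorem rep_mk_mem_tangentCone {σ : Module.Dual ℂ (⋀[ℂ]^3 V)} (h : σ ∈ tangentCone V)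
    (hσ : σ ≠ 0) : (Projectivization.mk ℂ σ hσ).rep ∈ tangentCone V := by
  obtain ⟨a, ha⟩ := Projectivization.exists_smul_eq_mk_rep ℂ σ hσ
  rw [← ha, Units.smul_def]
  exact smul_mem_tangentCone _ h

theorem IsForm.eq_zero_on_tangentCone (hV : Module.finrank ℂ V = 10) {d : ℕ}
    {g : Module.Dual ℂ (⋀[ℂ]^3 V) → ℂ} (hg : IsForm d g)
    (h : ∀ φ : ℙ ℂ (Module.Dual ℂ (⋀[ℂ]^3 V)), φ.rep ∈ tangentCone V → g φ.rep = 0)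
    {σ : Module.Dual ℂ (⋀[ℂ]^3 V)} (hσ : σ ∈ tangentCone V) : g σ = 0 := by
  have key : ∀ σ ∈ tangentCone V, σ ≠ 0 → g σ = 0 := fun σ hσ h0 =>
    (hg.rep_mk_eq_zero_iff h0).1 (h _ (rep_mk_mem_tangentCone hσ h0))
  by_cases h0 : σ = 0
  · obtain ⟨τ, hτ, hτ0⟩ := exists_ne_zero_mem_tangentCone hV
    rw [h0, ← zero_smul ℂ τ, hg.2, key τ hτ hτ0, mul_zero]
  · exact key σ hσ h0

/-- A form vanishing on the cone is a multiple of f, so the closure contains all zeros of f. -/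
theorem dualVariety_pluckerGrassmannian_eq_projZeros (hV : Module.finrank ℂ V = 10) {d : ℕ}
    {f : Module.Dual ℂ (⋀[ℂ]^3 V) → ℂ} (hf : IsForm d f) (hfS : ∀ σ ∈ tangentCone V, f σ = 0)
    (hgen : ∀ g ∈ polyFun (Module.Dual ℂ (⋀[ℂ]^3 V)), (∀ σ ∈ tangentCone V, g σ = 0) →
        ∃ h ∈ polyFun (Module.Dual ℂ (⋀[ℂ]^3 V)), ∀ σ, g σ = f σ * h σ) :
    dualVariety (pluckerGrassmannian 3 V) = projZeros f := by
  ext φ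
  rw [dualVariety_pluckerGrassmannian hV, mem_zariskiClosure_iff, mem_projZeros]
  constructor
  · exact fun h => h d f hf fun ψ hψ => hfS _ hψ
  · intro h e g hg hZ
    obtain ⟨k, -, hk⟩ := hgen g hg.1 fun σ hσ => hg.eq_zero_on_tangentCone hV hZ hσ
    rw [hk, h, zero_mul]

theorem isZariskiIrreducible_dualVariety (hV : Module.finrank ℂ V = 10) :
    IsZariskiIrreducible (dualVariety (pluckerGrassmannian 3 V)) := by
  rw [dualVariety_pluckerGrassmannian hV]
  refine isZariskiIrreducible_closure ?_ fun d e f g hf hg h => ?_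
  · obtain ⟨σ, hσ, h0⟩ := exists_ne_zero_mem_tangentCone hV
    exact ⟨_, rep_mk_mem_tangentCone hσ h0⟩
  · refine (eq_zero_or_on_tangentCone hV hf.1 hg.1 fun σ hσ =>
      (hf.mul hg).eq_zero_on_tangentCone hV h hσ).imp ?_ ?_ <;>
    exact fun h φ hφ => h _ hφ

/-- A hyperplane section with nonzero gradient of the dual equation has exactly one singular
point. -/
theorem singularPoints_hyperplaneSection (hV : Module.finrank ℂ V = 10)
    {f : Module.Dual ℂ (⋀[ℂ]^3 V) → ℂ} (hf : f ∈ polyFun (Module.Dual ℂ (⋀[ℂ]^3 V)))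
    (hfS : ∀ σ ∈ tangentCone V, f σ = 0) {w : Fin 3 → V} (hw : wedge w ≠ 0)
    {σ φ : Module.Dual ℂ (⋀[ℂ]^3 V)} (hσ : IsTangentTo (Submodule.span ℂ (Set.range w)) σ)
    (hφ : lineDeriv ℂ f σ φ ≠ 0) :
    singularPoints (hyperplaneSection (pluckerGrassmannian 3 V) σ) =
      {Projectivization.mk ℂ (wedge w) hw} := by
  have : FiniteDimensional ℂ V := Module.finite_of_finrank_pos (by omega)
  have hwi := linearIndependent_of_wedge_ne_zero hw
  ext y
  rw [Set.mem_singleton_iff]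
  constructor
  · rintro ⟨hy, hsing⟩
    obtain ⟨b, hb⟩ := exists_basis_chartPoint_eq hV (mem_pluckerGrassmannian_iff.1 hy.1)
    have hσb : σ ∈ conormal b := by
      by_contra hc
      exact hsing (isSmoothPoint_hyperplaneSection hy hb hc)
    -- Otherwise some ψ vanishes at `wedge w` but not at y. Tangency at w makes the differential of
    -- f kill ψ, and tangency at y then makes that differential zero.
    have hmem : y.rep ∈ Submodule.span ℂ {wedge w} := by
      by_contra hc
      obtain ⟨ψ, hψ, hψw⟩ := Submodule.exists_le_ker_of_notMem hc
      have h1 : ψ (wedge w) = 0 := hψw (Submodule.mem_span_singleton_self _)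
      rw [← hb] at hψ
      exact hφ (lineDeriv_eq_zero_of_eq_zero hV hf hfS
        (b.linearIndependent.comp _ Sum.inl_injective)
        ((isTangentTo_iff_mem_conormal b σ).2 hσb) hψ
        (lineDeriv_eq_zero_of_apply_wedge hV hf hfS hwi hσ h1) φ)
    obtain ⟨c, hc⟩ := Submodule.mem_span_singleton.1 hmem
    rw [← y.mk_rep, Projectivization.mk_eq_mk_iff']
    exact ⟨c, hc⟩
  · rintro rfl
    obtain ⟨b, hb, hbw⟩ := exists_basis_chartPoint_eq_rep hV hw
    have hσb : σ ∈ conormal b := (isTangentTo_iff_mem_conormal b σ).1 (hσ.mono hbw)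
    refine ⟨⟨(mk_mem_pluckerGrassmannian_iff hw).2 ⟨w, hwi, rfl⟩, ?_⟩,
      not_isSmoothPoint_hyperplaneSection hb hσb
        (injective_chartHessian_of_lineDeriv_ne_zero hV hf hfS b hσb hφ)⟩
    rw [← hb]
    exact hσb.1

end Dual

/-! ### Assembly of the theorem. -/

theorem proposition3p1 {V : Type*} [AddCommGroup V] [Module ℂ V]
    (hV : Module.finrank ℂ V = 10) :
    IsProjHypersurface (dualVariety (pluckerGrassmannian 3 V)) ∧
    IsZariskiIrreducible (dualVariety (pluckerGrassmannian 3 V)) ∧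
    ∃ U : Set (ℙ ℂ (Module.Dual ℂ (⋀[ℂ]^3 V))),
      IsZariskiOpen U ∧
      (U ∩ dualVariety (pluckerGrassmannian 3 V)).Nonempty ∧
      ∀ (σ : Module.Dual ℂ (⋀[ℂ]^3 V)) (hσ : σ ≠ 0),
        Projectivization.mk ℂ σ hσ ∈ U ∩ dualVariety (pluckerGrassmannian 3 V) →
        ∃ (x : ℙ ℂ (⋀[ℂ]^3 V)) (W : Submodule ℂ V),
          singularPoints (hyperplaneSection (pluckerGrassmannian 3 V) σ) = {x} ∧
          Module.finrank ℂ W = 3 ∧ x.submodule = pluckerLine 3 W ∧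
          ∀ w₁ ∈ W, ∀ w₂ ∈ W, ∀ v : V,
            σ (exteriorPower.ιMulti ℂ 3 ![w₁, w₂, v]) = 0 := by
  have : FiniteDimensional ℂ V := Module.finite_of_finrank_pos (by omega)
  let b : Module.Basis (Fin 3 ⊕ Fin 7) ℂ V :=
    (Module.finBasisOfFinrankEq ℂ V hV).reindex (finSumFinEquiv (m := 3) (n := 7)).symm
  obtain ⟨f, hfp, hfS, hgen, σ₀, hσ₀, hl₀⟩ := exists_tangentCone_equation hV b
  have hf0 : f ≠ 0 := by
    rintro rfl
    exact hl₀ (by simp [lineDeriv])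
  obtain ⟨v₀, hv₀⟩ : ∃ v₀, f v₀ ≠ 0 := by
    by_contra! h
    exact hf0 (funext h)
  obtain ⟨τ, hτ, -⟩ := exists_ne_zero_mem_tangentCone hV
  obtain ⟨d, hd, hf⟩ := exists_isForm_of_generator (fun t _ h => smul_mem_tangentCone t h)
    (by simpa using smul_mem_tangentCone 0 hτ) hfp hfS hgen hv₀
  have hX := dualVariety_pluckerGrassmannian_eq_projZeros hV hf hfS hgen
  -- The open set is the nonvanishing locus of this partial derivative; it meets the dual variety
  -- because the derivative is nonzero at a tangent form.
  have hl := isForm_lineDeriv hf hd (chartCoordZero b)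
  refine ⟨⟨d, f, hd, hf0, hf, hX⟩, isZariskiIrreducible_dualVariety hV, _,
    isZariskiOpen_compl_projZeros hl, ?_, ?_⟩
  · by_contra hc
    refine hl₀ (hl.eq_zero_on_tangentCone hV (fun φ hφ => ?_) hσ₀)
    by_contra hne
    exact hc ⟨φ, hne, by rw [hX]; exact hfS _ hφ⟩
  · rintro σ hσ ⟨hσU, hσX⟩
    rw [hX, mem_projZeros, hf.rep_mk_eq_zero_iff] at hσX
    rw [Set.mem_compl_iff, mem_projZeros, hl.rep_mk_eq_zero_iff] at hσU
    -- W is spanned by the gradient frame, whose leading Plücker coordinate is the cube of the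
    -- nonzero partial derivative, so W has dimension 3.
    have ht := isTangentTo_gradient hV hfp hfS hgen b hσX
    have hw : wedge (chartFrame b (lineDeriv ℂ f σ (chartCoordZero b))
        fun i a => lineDeriv ℂ f σ (chartCoord b i a)) ≠ 0 := by
      intro h
      have h1 := chartCoordZero_chartFrame b (lineDeriv ℂ f σ (chartCoordZero b))
        fun i a => lineDeriv ℂ f σ (chartCoord b i a)
      rw [h, map_zero] at h1
      exact hσU (pow_eq_zero_iff (three_ne_zero) |>.1 h1.symm)
    exact ⟨_, _, singularPoints_hyperplaneSection hV hfp hfS hw ht hσU,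
      finrank_span_of_linearIndependent (linearIndependent_of_wedge_ne_zero hw),
      by rw [pluckerLine_span, Projectivization.submodule_mk], ht⟩
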